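/- **Setting.** Let $(X,D)$ be a metric space, $S\subseteq X$ a set of $n\ge 2$ points, $r>0$, $c>1$, and write $B_S(q,r)=\{p\in S: D(p,q)\le r\}$, $b_S(q,r)=|B_S(q,r)|$. Let $\mathcal H$ be a distribution over maps $h:X\to U$ that is $(r,cr,p_1,p_2)$-sensitive: $\Pr[h(x)=h(y)]\ge p_1$ if $D(x,y)\le r$, and $\Pr[h(x)=h(y)]\le p_2$ if $D(x,y)>cr$. Assume $p_2<p_1$ and $a/n\le p_2\le b/n$ with constants $a,b>0$, and let $\rho=\log p_1/\log p_2$. Evaluating a distance or a hash function, an access to a hash table (dictionary), drawing a random value, and elementary operations on words cost one unit of time; a point, a hash value and a hash function take one word. **Construction.** Draw independently $L=\Theta(p_1^{-1}\log n)$ functions $\ell_1,\dots,\ell_L$ from $\mathcal H$, a uniformly random permutation of $S$ (which gives each point a rank in $\{0,\dots,n-1\}$), and $\Theta(\log n)$ functions $\psi_w:[n]\to[n^3]$ from a pairwise independent family. For each $i$ store the non-empty buckets $S_{i,j}=\{p\in S:\ell_i(p)=j\}$ in a hash table, each bucket with an index that supports reporting its points with rank in a given range, and, if it has at least $\Theta(\log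 n)$ points, with its count distinct sketch (for each $w$, the $t=\Theta(1)$ smallest distinct values of $\psi_w$ on the bucket; the estimate of the number of distinct elements is the median over $w$ of $tn^3/v_w$, with $v_w$ the $t$-th smallest value, or of the number of values if there are fewer than $t$). **Query $q$.** Let $S_q=\bigcup_i S_{i,\ell_i(q)}$. Merge the sketches of the buckets $S_{i,\ell_i(q)}$ (computing those not stored) into an estimate $\hat s$ of $|S_q|$, and let $k$ be the smallest power of two with $k\ge 2\hat s$. Let $\lambda=\Theta(\log n)$ and $\Sigma=\Theta(\log^2 n)$. As long as $k\ge2$: do up to $\Sigma$ times the following, and then replace $k$ by $k/2$. Choose $h\in\{0,\dots,k-1\}$ uniformly; using the indices, collect the set $\Lambda'$ of all points of $S_q\cap B_S(q,r)$ with rank in $[hn/k,(h+1)n/k)$; with probability $\min(1,|\Lambda'|/\lambda)$ stop and return a uniform element of $\Lambda'$. If $k<2$ is reached, return $\perp$. All random choices are fresh and independent. **Theorem.** The constants in $L,\lambda,\Sigma$, in the number and length of the lists of the sketch, and in the bucket size threshold can be chosen as absolute constants such that the following holds, with constants in $O$ and $\Theta$ that depend only on $a$ and $b$. 1. The data structure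 solves the $r$-near neighbor independent sampling problem with probability at least $1-1/n$: for every sequence $q_1,\dots,q_m$ of $m\le n$ queries there is an event $E$ with $\Pr[E]\ge 1-1/n$ (over the construction and the queries) such that, conditionally on $E$, for each $i$ and each $p\in B_S(q_i,r)$ the output satisfies $\Pr[\mathrm{OUT}_i=p]=1/b_S(q_i,r)$, and also $\Pr[\mathrm{OUT}_i=p\mid \mathrm{OUT}_{i-1}=o_{i-1},\dots,\mathrm{OUT}_1=o_1]=1/b_S(q_i,r)$ for all $o_1,\dots,o_{i-1}$ for which the condition has positive probability; the latter holds also conditionally on the random choices of the construction. A query with $B_S(q_i,r)=\emptyset$ returns $\perp$ almost surely. 2. It uses $\Theta(n^{1+\rho}\log n)$ words of memory. 3. It is constructed in time $O(n^{1+\rho}\log^2 n)$. 4. If moreover $\Pr[h(x)=h(y)]\le p_1$ for all $x,y\in X$ with $r<D(x,y)\le cr$, then for each query $q\in X$ the expected query time (over the construction and the query) is $$O\!\left(\Bigl(n^\rho+\frac{b_S(q,cr)}{\max(1,b_S(q,r))}\Bigr)\log^5 n\right).$$ -/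

import Mathlib

open MeasureTheory
open scoped ENNReal NNReal

noncomputable section

namespace NNIS

/-! ## Locality sensitive hashing and near neighbours -/

/-- `B_S(q, r)`: the (positions of the) points of the data set `S` at distance at most `r`
from `q`. The data set is an array of `n` distinct points. -/
def ball {X : Type*} [MetricSpace X] {n : ℕ} (S : Fin n ↪ X) (q : X) (r : ℝ) :
    Set (Fin n) :=
  {p | dist (S p) q ≤ r}

/-- `b_S(q, r)`. -/
def ballCard {X : Type*} [MetricSpace X] {n : ℕ} (S : Fin n ↪ X) (q : X) (r : ℝ) : ℕ :=
  (ball S q r).ncard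

/-- A distribution over maps `X → U`, given as a random map `h` on a probability space
`(Ω, μ)`, is `(r, R, p₁, p₂)`-sensitive. -/
structure IsSensitive {X : Type*} [MetricSpace X] {U : Type*} {Ω : Type*} [MeasurableSpace Ω]
    (μ : Measure Ω) (h : Ω → X → U) (r R p₁ p₂ : ℝ) : Prop where
  measurable_collision : ∀ x y, MeasurableSet {ω | h ω x = h ω y}
  near : ∀ x y, dist x y ≤ r → p₁ ≤ μ.real {ω | h ω x = h ω y}
  far : ∀ x y, R < dist x y → μ.real {ω | h ω x = h ω y} ≤ p₂

/-- A pairwise independent family of hash functions `[n] → [n³]` (a distribution on functions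
under which the values at any two different arguments are uniform and independent). -/
def PairwiseIndep {n : ℕ} (law : PMF (Fin n → Fin (n ^ 3))) : Prop :=
  ∀ i j, i ≠ j → ∀ a b,
    law.toOuterMeasure {f | f i = a ∧ f j = b} = ((n ^ 3 : ℕ) : ℝ≥0∞)⁻¹ ^ 2

/-! ## Computations with a step count -/

/-- A deterministic computation: its result and the number of unit-cost operations executed. -/
structure Timed (α : Type*) where
  val : α
  time : ℕ

namespace Timed

/-- Return a value. -/
def pure {α : Type*} (a : α) : Timed α := ⟨a, 0⟩

/-- Sequential composition. -/
def bind {α β : Type*} (x : Timed α) (f : α → Timed β) : Timed β :=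
  ⟨(f x.val).val, x.time + (f x.val).time⟩

/-- Execute `k` unit-cost operations and continue with `x`. -/
def charge {α : Type*} (k : ℕ) (x : Timed α) : Timed α := ⟨x.val, k + x.time⟩

/-- A loop over a list (one operation of overhead for every round). -/
def foldl {α β : Type*} (f : β → α → Timed β) : β → List α → Timed β
  | b, [] => pure b
  | b, a :: l => charge 1 ((f b a).bind fun b' => foldl f b' l)

/-- A loop that fills an array of length `m` (one operation of overhead for every entry). -/
def tabulate {α : Type*} {m : ℕ} (f : Fin m → Timed α) : Timed (Fin m → α) :=
  ⟨fun w => (f w).val, ∑ w, (1 + (f w).time)⟩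

end Timed

/-- A randomized computation: the joint law of its result and of its number of operations. -/
abbrev RandTimed (α : Type*) := PMF (α × ℕ)

namespace RandTimed

/-- A deterministic computation as a randomized one. -/
def ofTimed {α : Type*} (x : Timed α) : RandTimed α := PMF.pure (x.val, x.time)

/-- Draw a fresh random value from a given law, at unit cost. -/
def draw {α : Type*} (p : PMF α) : RandTimed α := p.map fun a => (a, 1)

/-- Sequential composition; the random choices of the two parts are independent. -/
def bind {α β : Type*} (x : RandTimed α) (f : α → RandTimed β) : RandTimed β :=
  PMF.bind x fun a => (f a.1).map fun b => (b.1, a.2 + b.2)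

end RandTimed

/-- A coin that shows `true` with probability `x`, or with probability `1` if `x > 1`. -/
def coin (x : ℝ≥0) : PMF Bool :=
  PMF.ofFintype (fun b => cond b ((min 1 x : ℝ≥0) : ℝ≥0∞) ((1 - min 1 x : ℝ≥0) : ℝ≥0∞)) (by
    rw [Fintype.sum_bool]
    simp only [cond_true, cond_false]
    rw [← ENNReal.coe_add, add_tsub_cancel_of_le (min_le_left _ _), ENNReal.coe_one])

/-! ## Parameters -/

/-- The constant factors hidden in the `Θ`'s of the parameters of the data structure. -/
structure Constants where
  /-- `L = ⌈cL · p₁⁻¹ · log n⌉` hash tables. -/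
  cL : ℕ
  /-- A sketch has `cΔ · log n` lists. -/
  cΔ : ℕ
  /-- A list of a sketch stores the `t` smallest hash values. -/
  t : ℕ
  /-- Buckets with at least `cτ · log n` points store their sketch. -/
  cτ : ℕ
  /-- `λ = cλ · log n`. -/
  cl : ℕ
  /-- `Σ = cΣ · log² n`. -/
  cσ : ℕ
  cL_pos : 0 < cL
  cΔ_pos : 0 < cΔ
  t_pos : 0 < t
  cτ_pos : 0 < cτ
  cl_pos : 0 < cl
  cσ_pos : 0 < cσ

/-- `⌈log₂ n⌉`. -/
def lg (n : ℕ) : ℕ := Nat.clog 2 n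

/-- The number of hash tables. -/
def numTables (K : Constants) (n : ℕ) (p₁ : ℝ) : ℕ := ⌈K.cL * lg n / p₁⌉₊

/-- The number of lists in a sketch. -/
def numLists (K : Constants) (n : ℕ) : ℕ := K.cΔ * lg n

/-! ## The count distinct sketch -/

/-- A sketch: for each of the `Δ` hash functions, the sorted list of the smallest distinct hash
values seen so far. -/
abbrev Sketch (Δ : ℕ) := Fin Δ → List ℕ

/-- Insert `v` into a sorted list without repetitions and keep the `t` smallest values. -/
def insertSmallest (v : ℕ) : ℕ → List ℕ → Timed (List ℕ)
  | 0, _ => .pure []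
  | _ + 1, [] => .charge 1 (.pure [v])
  | t + 1, a :: l => .charge 1 <|
      if v < a then .charge (t + 1) (.pure (v :: (a :: l).take t))
      else if v = a then .pure (a :: l)
      else (insertSmallest v t l).bind fun l' => .pure (a :: l')

namespace Sketch

variable {n Δ : ℕ}

/-- Add the point `p` to a sketch. Hash values range over `{1, …, n³}`. -/
def insert (t : ℕ) (ψ : Fin Δ → Fin n → Fin (n ^ 3)) (s : Sketch Δ) (p : Fin n) :
    Timed (Sketch Δ) :=
  Timed.tabulate fun w => .charge 1 (insertSmallest ((ψ w p : ℕ) + 1) t (s w))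

/-- The sketch of a list of points. -/
def ofPoints (t : ℕ) (ψ : Fin Δ → Fin n → Fin (n ^ 3)) (l : List (Fin n)) :
    Timed (Sketch Δ) :=
  .charge Δ (Timed.foldl (insert t ψ) (fun _ => []) l)

/-- The sketch of the concatenation of two streams from their sketches. -/
def merge (t : ℕ) (s s' : Sketch Δ) : Timed (Sketch Δ) :=
  Timed.tabulate fun w => Timed.foldl (fun l v => insertSmallest v t l) (s w) (s' w)

/-- The estimate given by one list: `t · n³ / v`, with `v` the `t`-th smallest hash value; the
number of values if there are fewer than `t`. -/
def listEstimate (n t : ℕ) (l : List ℕ) : ℚ :=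
  if l.length < t then l.length else t * (n : ℚ) ^ 3 / (l.getD (t - 1) 0 : ℕ)

/-- Insertion into a sorted list. -/
def insertSorted (x : ℚ) : List ℚ → Timed (List ℚ)
  | [] => .charge 1 (.pure [x])
  | a :: l => .charge 1 <|
      if x ≤ a then .pure (x :: a :: l)
      else (insertSorted x l).bind fun l' => .pure (a :: l')

/-- The estimate of the number of distinct elements: the median of the estimates of the lists. -/
def estimate (n t : ℕ) (s : Sketch Δ) : Timed ℚ :=
  (Timed.foldl (fun l w => .charge (t + 1) (insertSorted (listEstimate n t (s w)) l)) []
    (List.finRange Δ)).bind fun l => .charge Δ (.pure (l.getD (Δ / 2) 0))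

/-- Number of memory words. -/
def words (s : Sketch Δ) : ℕ := ∑ w, (1 + (s w).length)

end Sketch

/-! ## The data structure -/

/-- A hash table. It is a dictionary from the hash values in `keys` (those of the non-empty
buckets) to buckets. A bucket is stored as an array of points sorted by rank, which is the index
for retrieving ranges of ranks, together with a sketch if the bucket is large. -/
structure Table (U : Type*) (n Δ : ℕ) where
  keys : List U
  bucket : U → Array (Fin n)
  sketch : U → Option (Sketch Δ)

/-- The data structure. The random hash functions are part of it. Points are referred to by
their position in the array `pts`. -/
structure Index (X U : Type*) (n L Δ : ℕ) where
  pts : Fin n → X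
  rank : Fin n → Fin n
  hash : Fin L → X → U
  sketchHash : Fin Δ → Fin n → Fin (n ^ 3)
  table : Fin L → Table U n Δ

/-- Number of memory words of a table: a key and a pointer, the points, and the sketch, for each
non-empty bucket. -/
def Table.words {U : Type*} {n Δ : ℕ} (T : Table U n Δ) : ℕ :=
  1 + (T.keys.map fun u => 2 + (T.bucket u).size + ((T.sketch u).map Sketch.words).getD 0).sum

/-- Number of memory words of the data structure: the points, their ranks, a bit array of length
`n` used by the query algorithm (with one word per entry), the hash functions, the tables. -/
def Index.words {X U : Type*} {n L Δ : ℕ} (D : Index X U n L Δ) : ℕ :=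
  3 * n + L + Δ + ∑ i, (D.table i).words

/-! ### Construction -/

open Classical in
/-- Append `p` to its bucket: an evaluation of the hash function `f`, an access to the
dictionary, and a write. -/
def Table.insertPoint {X U : Type*} {n Δ : ℕ} (S : Fin n ↪ X) (f : X → U) (T : Table U n Δ)
    (p : Fin n) : Timed (Table U n Δ) :=
  .charge 3 <| .pure
    { T with
      keys := if (T.bucket (f (S p))).isEmpty then f (S p) :: T.keys else T.keys
      bucket := Function.update T.bucket (f (S p)) ((T.bucket (f (S p))).push p) }

open Classical in
/-- Compute and store the sketch of the bucket `u` if it has at least `τ` points. -/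
def Table.addSketch {U : Type*} {n Δ : ℕ} (t τ : ℕ) (ψ : Fin Δ → Fin n → Fin (n ^ 3))
    (T : Table U n Δ) (u : U) : Timed (Table U n Δ) :=
  .charge 2 <|
    if (T.bucket u).size < τ then .pure T
    else (Sketch.ofPoints t ψ (T.bucket u).toList).bind fun s =>
      .pure { T with sketch := Function.update T.sketch u (some s) }

/-- Build one table: insert the points by increasing rank, then compute the sketches. -/
def buildTable {X U : Type*} {n Δ : ℕ} (K : Constants) (S : Fin n ↪ X)
    (π : Equiv.Perm (Fin n)) (ψ : Fin Δ → Fin n → Fin (n ^ 3)) (f : X → U) :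
    Timed (Table U n Δ) :=
  (Timed.foldl (Table.insertPoint S f) ⟨[], fun _ => #[], fun _ => none⟩
    ((List.finRange n).map π.symm)).bind fun T =>
  Timed.foldl (Table.addSketch K.t (K.cτ * lg n) ψ) T T.keys

/-- Build the data structure from the sampled hash functions, the random permutation (`π p` is
the rank of `p`) and the sampled hash functions of the sketches. Sampling each function, and
each entry of the permutation and of its inverse, is also charged. -/
def build {X U : Type*} {n L Δ : ℕ} (K : Constants) (S : Fin n ↪ X) (f : Fin L → X → U)
    (π : Equiv.Perm (Fin n)) (ψ : Fin Δ → Fin n → Fin (n ^ 3)) : Timed (Index X U n L Δ) :=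
  .charge (3 * n + L + Δ) <|
    (Timed.tabulate fun i => buildTable K S π ψ (f i)).bind fun T =>
      .pure ⟨S, π, f, ψ, T⟩

/-! ### Query -/

/-- Binary search: the first position in `[i, j)` of a bucket whose point has a rank `ϱ` with
`a ≤ ϱ * k`, and `j` if there is none. -/
def binarySearch {n : ℕ} (rank : Fin n → Fin n) (A : Array (Fin n)) (a k : ℕ) (i j : ℕ)
    (hj : j ≤ A.size) : Timed ℕ :=
  if hij : i < j then
    .charge 3 <|
      if a ≤ (rank (A[(i + j) / 2]'(by omega)) : ℕ) * k then
        binarySearch rank A a k i ((i + j) / 2) (by omega)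
      else binarySearch rank A a k ((i + j) / 2 + 1) j hj
  else .charge 1 (.pure i)
termination_by j - i

open Classical in
/-- Read a bucket from position `i` on, while the rank `ϱ` satisfies `ϱ * k < b`, and add those
points at distance at most `r` from `q` to the set `acc`. Each point read costs a loop step, a
comparison of ranks, a distance evaluation, and a write to the bit array that represents `acc`. -/
def scan {X : Type*} [MetricSpace X] {n : ℕ} (pts : Fin n → X) (rank : Fin n → Fin n)
    (q : X) (r : ℝ) (A : Array (Fin n)) (b k : ℕ) (i : ℕ) (acc : Finset (Fin n)) :
    Timed (Finset (Fin n)) :=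
  if hi : i < A.size then
    .charge 2 <|
      if (rank A[i] : ℕ) * k < b then
        .charge 2 <|
          scan pts rank q r A b k (i + 1)
            (if dist (pts A[i]) q ≤ r then insert A[i] acc else acc)
      else .pure acc
  else .charge 1 (.pure acc)
termination_by A.size - i

section Query

variable {X U : Type*} [MetricSpace X] {n L Δ : ℕ}

/-- Look up the buckets of `q`: per table an evaluation of the hash function, an access to the
dictionary, and the computation of the sketch if it is not stored. -/
def lookup (K : Constants) (D : Index X U n L Δ) (q : X) :
    Timed (Fin L → Array (Fin n) × Sketch Δ) :=
  Timed.tabulate fun i => .charge 2 <|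
    match (D.table i).sketch (D.hash i q) with
    | some s => .pure ((D.table i).bucket (D.hash i q), s)
    | none =>
      (Sketch.ofPoints K.t D.sketchHash ((D.table i).bucket (D.hash i q)).toList).bind fun s =>
        .pure ((D.table i).bucket (D.hash i q), s)

/-- Merge the sketches of the buckets and estimate the number of points colliding with `q`. -/
def estimateCollisions (K : Constants) (b : Fin L → Array (Fin n) × Sketch Δ) : Timed ℚ :=
  (Timed.foldl (fun s i => Sketch.merge K.t s (b i).2) (fun _ => []) (List.finRange L)).bind
    fun s => Sketch.estimate n K.t s

/-- The set of colliding points at distance at most `r` from `q` with rank in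
`[h * n / k, (h + 1) * n / k)`. -/
def collect (D : Index X U n L Δ) (q : X) (r : ℝ) (b : Fin L → Array (Fin n) × Sketch Δ)
    (k h : ℕ) : Timed (Finset (Fin n)) :=
  (Timed.foldl (fun acc i =>
      (binarySearch D.rank (b i).1 (h * n) k 0 (b i).1.size le_rfl).bind fun j =>
        scan D.pts D.rank q r (b i).1 ((h + 1) * n) k j acc)
    ∅ (List.finRange L)).bind fun s =>
  -- clear the bit array
  .charge s.card (.pure s)

/-- At most `m` rounds with `2 ^ e` segments: choose a segment, collect the near neighbours in
it, and accept with probability (their number) `/ lam`. If a round is accepted, return a uniform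
element (with the current number of segments); if none is, continue with `next`. -/
def rounds (D : Index X U n L Δ) (q : X) (r : ℝ) (b : Fin L → Array (Fin n) × Sketch Δ)
    (lam : ℕ) (e : ℕ) (next : RandTimed (Option (Fin n) × ℕ)) :
    ℕ → RandTimed (Option (Fin n) × ℕ)
  | 0 => next
  | m + 1 =>
    RandTimed.bind (.draw (PMF.uniformOfFintype (Fin (2 ^ e)))) fun h =>
    RandTimed.bind (.ofTimed (collect D q r b (2 ^ e) h)) fun s =>
    RandTimed.bind (.draw (coin ((s.card : ℝ≥0) / lam))) fun success =>
    if success then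
      if hs : s.Nonempty then
        RandTimed.bind (.draw (PMF.uniformOfFinset s hs)) fun p =>
          .ofTimed (.pure (some p, 2 ^ e))
      else .ofTimed (.pure (none, 2 ^ e))
    else rounds D q r b lam e next m

/-- The main loop, from `2 ^ e` segments on: `sig` rounds, then halve the number of segments;
give up when fewer than two segments are left. -/
def search (D : Index X U n L Δ) (q : X) (r : ℝ) (b : Fin L → Array (Fin n) × Sketch Δ)
    (lam sig : ℕ) : ℕ → RandTimed (Option (Fin n) × ℕ)
  | 0 => .ofTimed (.charge 1 (.pure (none, 1)))
  | e + 1 => rounds D q r b lam (e + 1)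
      (.bind (.ofTimed (.charge 1 (.pure ()))) fun _ => search D q r b lam sig e) sig

/-- What a query reveals: the returned point (`none` stands for `⊥`), the number of segments when
the loop ended, and the number of operations. -/
@[ext] structure Result (n : ℕ) where
  out : Option (Fin n)
  segments : ℕ
  time : ℕ

/-- The query algorithm. Its initial number of segments is the smallest power of two that is at
least twice the estimate. -/
def query (K : Constants) (D : Index X U n L Δ) (r : ℝ) (q : X) : PMF (Result n) :=
  (RandTimed.bind (.ofTimed (lookup K D q)) fun b =>
    RandTimed.bind (.ofTimed (estimateCollisions K b)) fun est =>
    RandTimed.bind (.ofTimed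
      (.charge (Nat.clog 2 ⌈2 * est⌉₊ + 1) (.pure (Nat.clog 2 ⌈2 * est⌉₊)))) fun e =>
    search D q r b (K.cl * lg n) (K.cσ * lg n ^ 2) e).map fun a => ⟨a.1.1, a.1.2, a.2⟩

/-- Answer a sequence of queries one after the other, with fresh random choices. -/
def runQueries (K : Constants) (D : Index X U n L Δ) (r : ℝ) :
    List X → PMF (List (Result n))
  | [] => PMF.pure []
  | q :: qs => (query K D r q).bind fun a => (runQueries K D r qs).bind fun l =>
      PMF.pure (a :: l)

end Query

/-! ### The random choices of the construction -/

instance permMeasurableSpace (n : ℕ) : MeasurableSpace (Equiv.Perm (Fin n)) := ⊤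

/-- The random choices of the construction: the hash functions of the tables (given by elements
of the sample space of the LSH family), the permutation, the hash functions of the sketches. -/
abbrev Seed (Ω : Type*) (n L Δ : ℕ) :=
  (Fin L → Ω) × Equiv.Perm (Fin n) × (Fin Δ → Fin n → Fin (n ^ 3))

/-- All choices are independent, and the permutation is uniform. -/
def seedMeasure {Ω : Type*} [MeasurableSpace Ω] (μ : Measure Ω) (n L Δ : ℕ)
    (law : PMF (Fin n → Fin (n ^ 3))) : Measure (Seed Ω n L Δ) :=
  (Measure.pi fun _ : Fin L => μ).prod
    ((PMF.uniformOfFintype (Equiv.Perm (Fin n))).toMeasure.prod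
      (Measure.pi fun _ : Fin Δ => law.toMeasure))

/-- The construction as a function of its random choices. -/
def buildSeed {X U Ω : Type*} {n L Δ : ℕ} (K : Constants) (S : Fin n ↪ X) (h : Ω → X → U)
    (ω : Seed Ω n L Δ) : Timed (Index X U n L Δ) :=
  build K S (fun i => h (ω.1 i)) ω.2.1 ω.2.2

/-! ## Near neighbour independent sampling -/

section Problem

variable {X Θ : Type*} [MetricSpace X] [MeasurableSpace Θ] {n : ℕ}

/-- The probability of an event on the random choices `θ` of the construction (with law `P`) and
the results `l` of a sequence of queries (with law `run θ` given `θ`). -/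
def jointProb (P : Measure Θ) (run : Θ → PMF (List (Result n)))
    (A : Set (Θ × List (Result n))) : ℝ≥0∞ :=
  ∫⁻ θ, (run θ).toOuterMeasure {l | (θ, l) ∈ A} ∂P

/-- The `i`-th query returns `o`. -/
def outIs (i : ℕ) (o : Option (Fin n)) : Set (List (Result n)) :=
  {l | (l.map Result.out)[i]? = some o}

/-- The sequence of the points returned by the first `i` queries is `past`. -/
def pastIs (i : ℕ) (past : List (Option (Fin n))) : Set (List (Result n)) :=
  {l | (l.map Result.out).take i = past}

/-- The randomized data structure with construction randomness `P` and query procedure `run`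
solves the `r`-near neighbour independent sampling problem for `S` with probability at least
`1 - δ`: for every sequence of at most `n` queries there is an event `E` (no failure) of
probability at least `1 - δ` conditionally on which each query with a near neighbour returns a
uniform near neighbour, independently of the previous results. A conditional probability
`Pr[A | B] = 1 / b` is written as `Pr[A ∩ B] = Pr[B] / b`. -/
def Solves (P : Measure Θ) (run : Θ → List X → PMF (List (Result n))) (S : Fin n ↪ X)
    (r δ : ℝ) : Prop :=
  ∀ qs : List X, qs.length ≤ n →
    ∃ E : Set (Θ × List (Result n)),
      (∀ l, MeasurableSet {θ | (θ, l) ∈ E}) ∧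
      ENNReal.ofReal (1 - δ) ≤ jointProb P (fun θ => run θ qs) E ∧
      ∀ (i : ℕ) (q : X), qs[i]? = some q →
        -- each output is uniform on the ball
        (∀ p ∈ ball S q r,
          jointProb P (fun θ => run θ qs) (E ∩ {x | x.2 ∈ outIs i (some p)}) =
            jointProb P (fun θ => run θ qs) E / ballCard S q r) ∧
        -- each output is uniform on the ball given the previous outputs
        (∀ p ∈ ball S q r, ∀ past : List (Option (Fin n)),
          jointProb P (fun θ => run θ qs)
              (E ∩ {x | x.2 ∈ pastIs i past} ∩ {x | x.2 ∈ outIs i (some p)}) =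
            jointProb P (fun θ => run θ qs) (E ∩ {x | x.2 ∈ pastIs i past}) /
              ballCard S q r) ∧
        -- the same, given also the random choices of the construction
        (∀ θ, ∀ p ∈ ball S q r, ∀ past : List (Option (Fin n)),
          (run θ qs).toOuterMeasure
              ({l | (θ, l) ∈ E} ∩ pastIs i past ∩ outIs i (some p)) =
            (run θ qs).toOuterMeasure ({l | (θ, l) ∈ E} ∩ pastIs i past) /
              ballCard S q r) ∧
        -- a query without near neighbours is answered by `⊥`
        (ball S q r = ∅ → ∀ θ, (run θ qs).toOuterMeasure (outIs i none) = 1)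

end Problem

/-- The expected number of operations of the query `q`, over the random choices of the
construction and of the query. -/
def expectedQueryTime {X U Ω : Type*} [MetricSpace X] [MeasurableSpace Ω] {n : ℕ} (L Δ : ℕ)
    (K : Constants) (μ : Measure Ω) (h : Ω → X → U) (law : PMF (Fin n → Fin (n ^ 3)))
    (S : Fin n ↪ X) (r : ℝ) (q : X) : ℝ≥0∞ :=
  ∫⁻ ω, ∑' a, query K (buildSeed K S h ω).val r q a * (a.time : ℝ≥0∞)
    ∂(seedMeasure μ n L Δ law)

end NNIS

end

/-!
A query repeats rounds of rejection sampling. In a round with `2 ^ e` segments of ranks, a segment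
that holds `m ≤ λ` near neighbours of the query is accepted with probability `m / λ`, and then each
of them is returned with probability `1 / m`. So if no segment of the level `e` is overloaded
(`Balanced`), a round returns each near neighbour with probability exactly `1 / (2 ^ e λ)`,
wherever the points lie (`accept_of_balanced`). Whatever happened in earlier rounds, the output is
therefore uniform, given that the query succeeds at a balanced level (`expect_search_congr`,
`mean_query_uniform`). The random choices of different queries are independent, so this extends to
sequences of queries (`runQueries_uniform`), and it holds for each fixed construction.

The construction behaves as needed for a query (`goodSeeds`) if each near neighbour collides with
the query in some table, if the rank permutation overloads no segment of a level whose number of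
segments is at least a constant fraction of the number `b` of near neighbours, and if the sketches
do not underestimate `b` by more than a constant factor. Each of the three fails with probability
at most `n⁻⁴`. For the tables this is `(1 - p₁) ^ L ≤ exp (-p₁ L)`. For the permutation it is a
union bound over the sets of `λ + 1` near neighbours, since a set `W` of points is mapped into a
set `I` of ranks with probability at most `(|I| / n) ^ |W|` (`permMeasure_real_le`). For the
sketches it suffices to keep the least value of each list: by Chebyshev's inequality a single list
underestimates with probability at most `1 / 16` (`measure_badHash_le`), and so rarely do half of
the independent lists that the median is reliable (`measure_compl_goodLists_le`). No upper bound
for the estimate is needed beyond `n³`, because a search that starts with too many segments only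
passes through more levels, of which there are `O(log n)`.

For a good construction the search starts above or at a level with `Θ(b)` segments
(`exists_level`). There a round is accepted with probability at least `1 / (2λ)`, so that all `Σ`
rounds fail with probability at most `n⁻⁴` (`rejectProb_pow_le`). The event `E` of the sampling
problem is that the construction is good for all queries and that no query fails
(`solves`).

A round scans the entries of one random segment in all buckets of the query, on average a fraction
`2⁻ᵉ` of their total size. The search rarely descends below the level with `Θ(b)` segments, and
its worst case is weighted by `n⁻⁴` (`cost_search_le_of_le`, `mean_query_time_le`). The expected
total size of the buckets is at most `L (b_S(q, r) + p₁ b_S(q, c r) + p₂ n)`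
(`lintegral_bucketsSize_le`), where `L p₁ = O(log n)` and `p₂ n = O(1)`. Finally
`1 / p₁ = (1 / p₂) ^ ρ` yields `L = Θ(n ^ ρ log n)` (`numTables_le`, `le_numTables`).
-/

noncomputable section

namespace NNIS

/-! ### Expectations of discrete random variables -/

/-- The expectation of a nonnegative function `g` under a discrete law `p`. -/
def mean {α : Type*} (p : PMF α) (g : α → ℝ≥0∞) : ℝ≥0∞ := ∑' a, p a * g a

section Mean

variable {α β : Type*}

theorem mean_pure (a : α) (g : α → ℝ≥0∞) : mean (PMF.pure a) g = g a := by
  unfold mean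
  rw [tsum_eq_single a]
  · simp
  · intro b hb
    simp [PMF.pure_apply, hb]

theorem mean_bind (p : PMF α) (f : α → PMF β) (g : β → ℝ≥0∞) :
    mean (p.bind f) g = mean p fun a => mean (f a) g := by
  unfold mean
  simp_rw [PMF.bind_apply, ← ENNReal.tsum_mul_right, ← ENNReal.tsum_mul_left]
  rw [ENNReal.tsum_comm]
  simp_rw [mul_assoc]

theorem mean_map (p : PMF α) (f : α → β) (g : β → ℝ≥0∞) :
    mean (p.map f) g = mean p fun a => g (f a) := by
  rw [PMF.map, mean_bind]
  simp only [Function.comp, mean_pure]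

theorem mean_add (p : PMF α) (g g' : α → ℝ≥0∞) :
    mean p (fun a => g a + g' a) = mean p g + mean p g' := by
  unfold mean
  simp_rw [mul_add]
  exact ENNReal.tsum_add

theorem mean_const (p : PMF α) (x : ℝ≥0∞) : mean p (fun _ => x) = x := by
  unfold mean
  rw [ENNReal.tsum_mul_right, p.tsum_coe, one_mul]

theorem mean_mul_right (p : PMF α) (g : α → ℝ≥0∞) (x : ℝ≥0∞) :
    mean p (fun a => g a * x) = mean p g * x := by
  unfold mean
  simp_rw [← mul_assoc]
  exact ENNReal.tsum_mul_right

theorem mean_mono (p : PMF α) {g g' : α → ℝ≥0∞} (h : ∀ a, p a ≠ 0 → g a ≤ g' a) :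
    mean p g ≤ mean p g' := by
  refine ENNReal.tsum_le_tsum fun a => ?_
  by_cases ha : p a = 0
  · simp [ha]
  · exact mul_le_mul_right (h a ha) _

theorem mean_congr (p : PMF α) {g g' : α → ℝ≥0∞} (h : ∀ a, p a ≠ 0 → g a = g' a) :
    mean p g = mean p g' :=
  le_antisymm (mean_mono p fun a ha => (h a ha).le) (mean_mono p fun a ha => (h a ha).ge)

theorem mean_finset_sum {ι : Type*} (p : PMF α) (s : Finset ι) (g : ι → α → ℝ≥0∞) :
    mean p (fun a => ∑ i ∈ s, g i a) = ∑ i ∈ s, mean p (g i) := by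
  unfold mean
  simp_rw [Finset.mul_sum]
  exact Summable.tsum_finsetSum fun _ _ => ENNReal.summable

theorem toOuterMeasure_eq_mean (p : PMF α) (s : Set α) :
    p.toOuterMeasure s = mean p (s.indicator 1) := by
  unfold mean
  rw [PMF.toOuterMeasure_apply]
  refine tsum_congr fun a => ?_
  by_cases ha : a ∈ s <;> simp [ha]

theorem mean_eq_zero (p : PMF α) {g : α → ℝ≥0∞} (h : ∀ a, p a ≠ 0 → g a = 0) :
    mean p g = 0 := by
  rw [mean_congr p h, mean_const]

theorem mean_uniformOfFintype [Fintype α] [Nonempty α] (g : α → ℝ≥0∞) :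
    mean (PMF.uniformOfFintype α) g = (∑ a, g a) / Fintype.card α := by
  unfold mean
  rw [tsum_fintype]
  simp_rw [PMF.uniformOfFintype_apply]
  rw [← Finset.mul_sum, mul_comm, ENNReal.div_eq_inv_mul, mul_comm]

theorem mean_uniformOfFinset (s : Finset α) (hs : s.Nonempty) (g : α → ℝ≥0∞) :
    mean (PMF.uniformOfFinset s hs) g = (∑ a ∈ s, g a) / s.card := by
  unfold mean
  rw [tsum_eq_sum (s := s) fun b hb => by rw [PMF.uniformOfFinset_apply_of_notMem _ hb, zero_mul],
    Finset.sum_congr rfl fun a ha => by rw [PMF.uniformOfFinset_apply_of_mem hs ha],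
    ← Finset.mul_sum, ENNReal.div_eq_inv_mul]

theorem mean_coin (x : ℝ≥0) (g : Bool → ℝ≥0∞) :
    mean (coin x) g = (min 1 x : ℝ≥0) * g true + (1 - min 1 x : ℝ≥0) * g false := by
  unfold mean
  rw [tsum_fintype, Fintype.sum_bool]
  rfl

end Mean

namespace RandTimed

variable {α β : Type*}

/-- The expectation of a function of the result of a randomized computation. -/
def expect (x : RandTimed α) (g : α → ℝ≥0∞) : ℝ≥0∞ := mean x fun a => g a.1

/-- The expected number of operations of a randomized computation. -/
def cost (x : RandTimed α) : ℝ≥0∞ := mean x fun a => (a.2 : ℝ≥0∞)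

theorem expect_ofTimed (x : Timed α) (g : α → ℝ≥0∞) : expect (ofTimed x) g = g x.val := by
  simp [expect, ofTimed, mean_pure]

theorem expect_draw (p : PMF α) (g : α → ℝ≥0∞) : expect (draw p) g = mean p g := by
  simp [expect, draw, mean_map]

theorem expect_bind (x : RandTimed α) (f : α → RandTimed β) (g : β → ℝ≥0∞) :
    expect (bind x f) g = expect x fun a => expect (f a) g := by
  simp [expect, bind, mean_bind, mean_map]

theorem expect_ofTimed_bind (x : Timed α) (f : α → RandTimed β) (g : β → ℝ≥0∞) :
    expect (bind (ofTimed x) f) g = expect (f x.val) g := by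
  rw [expect_bind, expect_ofTimed]

theorem expect_draw_bind (p : PMF α) (f : α → RandTimed β) (g : β → ℝ≥0∞) :
    expect (bind (draw p) f) g = mean p fun a => expect (f a) g := by
  rw [expect_bind, expect_draw]

theorem cost_ofTimed (x : Timed α) : cost (ofTimed x) = x.time := by
  simp [cost, ofTimed, mean_pure]

theorem cost_draw (p : PMF α) : cost (draw p) = 1 := by
  simp [cost, draw, mean_map, mean_const]

theorem cost_bind (x : RandTimed α) (f : α → RandTimed β) :
    cost (bind x f) = cost x + expect x fun a => cost (f a) := by
  simp only [expect, cost, bind, mean_bind, mean_map, Nat.cast_add]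
  rw [← mean_add]
  refine mean_congr _ fun a _ => ?_
  rw [mean_add, mean_const]

theorem cost_ofTimed_bind (x : Timed α) (f : α → RandTimed β) :
    cost (bind (ofTimed x) f) = x.time + cost (f x.val) := by
  rw [cost_bind, cost_ofTimed, expect_ofTimed]

theorem cost_draw_bind (p : PMF α) (f : α → RandTimed β) :
    cost (bind (draw p) f) = 1 + mean p fun a => cost (f a) := by
  rw [cost_bind, cost_draw, expect_draw]

end RandTimed

/-! ### Sketches -/

namespace Timed

variable {α β : Type*}

theorem foldl_val (f : β → α → Timed β) (b : β) (l : List α) :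
    (foldl f b l).val = l.foldl (fun b a => (f b a).val) b := by
  induction l generalizing b with
  | nil => rfl
  | cons a l ih => exact ih _

/-- A bound for the duration of a loop, given an invariant `I` of its state. -/
theorem foldl_time_le {f : β → α → Timed β} {c : α → ℕ} (I : β → Prop) {l : List α}
    (hI : ∀ b, ∀ a ∈ l, I b → I (f b a).val)
    (hc : ∀ b, ∀ a ∈ l, I b → (f b a).time ≤ c a) {b : β} (hb : I b) :
    (foldl f b l).time ≤ (l.map fun a => 1 + c a).sum := by
  induction l generalizing b with
  | nil => simp [foldl, pure]
  | cons a l ih =>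
    have h1 := hc b a (by simp) hb
    have h2 := ih (fun b a ha => hI b a (by simp [ha])) (fun b a ha => hc b a (by simp [ha]))
      (hI b a (by simp) hb)
    simp only [foldl, charge, bind, List.map_cons, List.sum_cons]
    omega

theorem foldl_time_le_const {f : β → α → Timed β} {c : ℕ} (I : β → Prop) {l : List α}
    (hI : ∀ b, ∀ a ∈ l, I b → I (f b a).val)
    (hc : ∀ b, ∀ a ∈ l, I b → (f b a).time ≤ c) {b : β} (hb : I b) :
    (foldl f b l).time ≤ l.length * (1 + c) := by
  refine (foldl_time_le I hI hc hb).trans ?_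
  simp

theorem tabulate_time_le {m : ℕ} {f : Fin m → Timed α} {c : ℕ} (h : ∀ w, (f w).time ≤ c) :
    (tabulate f).time ≤ m * (1 + c) := by
  refine (Finset.sum_le_card_nsmul Finset.univ (fun w => 1 + (f w).time) (1 + c)
    fun w _ => Nat.add_le_add_left (h w) 1).trans ?_
  simp

end Timed

/-- An invariant of a loop. -/
theorem foldl_invariant {α β : Type*} (I : β → Prop) (f : β → α → β) {l : List α}
    (hI : ∀ b, ∀ a ∈ l, I b → I (f b a)) {b : β} (hb : I b) : I (l.foldl f b) := by
  induction l generalizing b with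
  | nil => exact hb
  | cons a l ih => exact ih (fun b a ha => hI b a (by simp [ha])) (hI b a (by simp) hb)

theorem insertSmallest_time_le (v t : ℕ) (l : List ℕ) : (insertSmallest v t l).time ≤ 2 * t := by
  induction t generalizing l with
  | zero => simp [insertSmallest, Timed.pure]
  | succ t ih =>
    cases l with
    | nil => simp [insertSmallest, Timed.pure, Timed.charge]; omega
    | cons a l =>
      have := ih l
      simp only [insertSmallest, Timed.charge]
      split_ifs <;> simp [Timed.pure, Timed.bind] <;> omega

theorem insertSmallest_length_le (v t : ℕ) (l : List ℕ) (hl : l.length ≤ t) :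
    (insertSmallest v t l).val.length ≤ t := by
  induction t generalizing l with
  | zero => simp [insertSmallest, Timed.pure]
  | succ t ih =>
    cases l with
    | nil => simp [insertSmallest, Timed.pure, Timed.charge]
    | cons a l =>
      have := ih l (by simpa using hl)
      simp only [insertSmallest, Timed.charge]
      split_ifs
      · simp [Timed.pure]
      · simpa [Timed.pure] using hl
      · simpa [Timed.pure, Timed.bind] using this

/-- The list `l` consists of the least element of the set `V`, or is empty if `V` is. -/
def ListsMin (l : List ℕ) (V : Set ℕ) : Prop :=
  (V = ∅ ∧ l = []) ∨ ∃ v, IsLeast V v ∧ l = [v]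

theorem ListsMin.insertSmallest {l : List ℕ} {V : Set ℕ} (h : ListsMin l V) (v : ℕ) :
    ListsMin (insertSmallest v 1 l).val (insert v V) := by
  right
  rcases h with ⟨rfl, rfl⟩ | ⟨a, ha, rfl⟩
  · exact ⟨v, by simp, rfl⟩
  · refine ⟨min v a, ha.insert v, ?_⟩
    simp only [NNIS.insertSmallest, Timed.charge]
    split_ifs with h1 h2
    · simp [Timed.pure, min_eq_left h1.le]
    · simp [Timed.pure, h2]
    · simp [Timed.pure, Timed.bind, min_eq_right (not_lt.1 h1)]

namespace Sketch

variable {n Δ : ℕ}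

theorem length_insert_le {t : ℕ} {ψ : Fin Δ → Fin n → Fin (n ^ 3)} {s : Sketch Δ}
    (hs : ∀ w, (s w).length ≤ t) (p : Fin n) (w : Fin Δ) :
    ((insert t ψ s p).val w).length ≤ t :=
  insertSmallest_length_le _ _ _ (hs w)

theorem length_ofPoints_le (t : ℕ) (ψ : Fin Δ → Fin n → Fin (n ^ 3)) (l : List (Fin n)) :
    ∀ w, ((ofPoints t ψ l).val w).length ≤ t := by
  change ∀ w, ((Timed.foldl (insert t ψ) (fun _ => []) l).val w).length ≤ t
  rw [Timed.foldl_val]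
  exact foldl_invariant (fun s : Sketch Δ => ∀ w, (s w).length ≤ t) _
    (fun s p _ hs w => length_insert_le hs p w) (by simp)

theorem words_ofPoints_le (t : ℕ) (ψ : Fin Δ → Fin n → Fin (n ^ 3)) (l : List (Fin n)) :
    words (ofPoints t ψ l).val ≤ Δ * (1 + t) := by
  refine (Finset.sum_le_card_nsmul _ _ (1 + t)
    fun w _ => Nat.add_le_add_left (length_ofPoints_le t ψ l w) 1).trans ?_
  simp

theorem ofPoints_time_le (t : ℕ) (ψ : Fin Δ → Fin n → Fin (n ^ 3)) (l : List (Fin n)) :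
    (ofPoints t ψ l).time ≤ Δ + l.length * (1 + Δ * (2 + 2 * t)) := by
  refine Nat.add_le_add_left (Timed.foldl_time_le_const (fun _ => True) (fun _ _ _ _ => trivial)
    (fun s p _ _ => ?_) trivial) Δ
  refine (Timed.tabulate_time_le (c := 1 + 2 * t) fun w => ?_).trans (le_of_eq (by ring))
  exact Nat.add_le_add_left (insertSmallest_time_le _ _ _) 1

theorem listsMin_ofPoints (ψ : Fin Δ → Fin n → Fin (n ^ 3)) (l : List (Fin n)) (w : Fin Δ) :
    ListsMin ((ofPoints 1 ψ l).val w) {v | ∃ p ∈ l, (ψ w p : ℕ) + 1 = v} := by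
  change ListsMin ((Timed.foldl (insert 1 ψ) (fun _ => []) l).val w) _
  rw [Timed.foldl_val]
  suffices h : ∀ (s : Sketch Δ) (V : Set ℕ), ListsMin (s w) V →
      ListsMin (l.foldl (fun s p => (insert 1 ψ s p).val) s w)
        (V ∪ {v | ∃ p ∈ l, (ψ w p : ℕ) + 1 = v}) by
    simpa using h (fun _ => []) ∅ (Or.inl ⟨rfl, rfl⟩)
  induction l with
  | nil => intro s V h; simpa using h
  | cons p l ih =>
    intro s V h
    have := ih (insert 1 ψ s p).val _ (h.insertSmallest ((ψ w p : ℕ) + 1))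
    rw [List.foldl_cons]
    convert this using 1
    ext v
    simp only [List.mem_cons, Set.mem_union, Set.mem_ofPred_eq, Set.mem_insert_iff]
    constructor
    · rintro (h | ⟨x, rfl | hx, rfl⟩)
      · exact Or.inl (Or.inr h)
      · exact Or.inl (Or.inl rfl)
      · exact Or.inr ⟨x, hx, rfl⟩
    · rintro ((rfl | h) | ⟨x, hx, rfl⟩)
      · exact Or.inr ⟨p, Or.inl rfl, rfl⟩
      · exact Or.inl h
      · exact Or.inr ⟨x, Or.inr hx, rfl⟩

theorem listsMin_merge {s s' : Sketch Δ} {V V' : Set ℕ} {w : Fin Δ} (h : ListsMin (s w) V)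
    (h' : ListsMin (s' w) V') : ListsMin ((merge 1 s s').val w) (V ∪ V') := by
  change ListsMin (Timed.foldl (fun l v => insertSmallest v 1 l) (s w) (s' w)).val _
  rcases h' with ⟨rfl, h'⟩ | ⟨v, hv, h'⟩
  · rw [h', Set.union_empty]; exact h
  · rw [h']
    right
    have := h.insertSmallest v
    rcases this with ⟨h0, -⟩ | ⟨x, hx, hl⟩
    · exact absurd h0 (Set.insert_nonempty _ _).ne_empty
    · refine ⟨x, ?_, hl⟩
      constructor
      · rcases hx.1 with rfl | hx
        · exact Or.inr hv.1
        · exact Or.inl hx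
      · rintro y (hy | hy)
        · exact hx.2 (Or.inr hy)
        · exact (hx.2 (Or.inl rfl)).trans (hv.2 hy)

theorem merge_time_le {t m : ℕ} {s s' : Sketch Δ} (h : ∀ w, (s' w).length ≤ m) :
    (merge t s s').time ≤ Δ * (1 + m * (1 + 2 * t)) :=
  Timed.tabulate_time_le fun w =>
    (Timed.foldl_time_le_const (fun _ => True) (fun _ _ _ _ => trivial)
      (fun _ _ _ _ => insertSmallest_time_le _ _ _) trivial).trans
      (Nat.mul_le_mul_right _ (h w))

/-! ### The median of the estimates -/

theorem insertSorted_time_le (x : ℚ) (l : List ℚ) : (insertSorted x l).time ≤ l.length + 1 := by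
  induction l with
  | nil => simp [insertSorted, Timed.charge, Timed.pure]
  | cons a l ih =>
    simp only [insertSorted, Timed.charge]
    split_ifs
    · simp [Timed.pure]
    · simp [Timed.pure, Timed.bind]; omega

theorem insertSorted_val (x : ℚ) (l : List ℚ) :
    (insertSorted x l).val = l.orderedInsert (· ≤ ·) x := by
  induction l with
  | nil => rfl
  | cons a l ih =>
    simp only [insertSorted, Timed.charge, List.orderedInsert]
    split_ifs <;> simp [Timed.pure, Timed.bind, ih]

theorem estimate_val (n t : ℕ) (s : Sketch Δ) :
    ∃ l : List ℚ, l.Pairwise (· ≤ ·) ∧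
      l.Perm ((List.finRange Δ).map fun w => listEstimate n t (s w)) ∧
      (estimate n t s).val = l.getD (Δ / 2) 0 := by
  refine ⟨_, ?_, ?_, rfl⟩
  · rw [Timed.foldl_val]
    refine foldl_invariant (fun l : List ℚ => l.Pairwise (· ≤ ·)) _ (fun l w _ hl => ?_) (by simp)
    change (insertSorted _ l).val.Pairwise _
    rw [insertSorted_val]
    exact List.Pairwise.orderedInsert _ _ hl
  · rw [Timed.foldl_val]
    suffices h : ∀ (L : List (Fin Δ)) (l : List ℚ),
        (L.foldl (fun l w => (Timed.charge (t + 1)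
          (insertSorted (listEstimate n t (s w)) l)).val) l).Perm
          (L.map (fun w => listEstimate n t (s w)) ++ l) by
      simpa using h (List.finRange Δ) []
    intro L
    induction L with
    | nil => intro l; simp
    | cons w L ih =>
      intro l
      refine (ih _).trans ?_
      change List.Perm (_ ++ (insertSorted _ l).val) _
      rw [insertSorted_val]
      refine ((List.perm_orderedInsert _ _ _).append_left _).trans ?_
      simp [List.perm_middle]

theorem estimate_time_le (n t : ℕ) (s : Sketch Δ) :
    (estimate n t s).time ≤ Δ * (Δ + t + 4) := by
  have h : ∀ (L : List (Fin Δ)) (l : List ℚ),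
      (Timed.foldl (fun l w => Timed.charge (t + 1)
        (insertSorted (listEstimate n t (s w)) l)) l L).time ≤
        L.length * (l.length + L.length + t + 2) := by
    intro L
    induction L with
    | nil => intro l; simp [Timed.foldl, Timed.pure]
    | cons w L ih =>
      intro l
      have h1 := insertSorted_time_le (listEstimate n t (s w)) l
      have h2 := ih (insertSorted (listEstimate n t (s w)) l).val
      rw [insertSorted_val, List.orderedInsert_length] at h2
      simp only [Timed.foldl, Timed.charge, Timed.bind, List.length_cons]
      simp only [Timed.charge] at h2
      rw [insertSorted_val]
      nlinarith
  have := h (List.finRange Δ) []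
  simp only [List.length_finRange, List.length_nil] at this
  simp only [estimate, Timed.bind, Timed.charge, Timed.pure]
  simp only [Timed.charge] at this
  nlinarith

/-- The median is at least `x` if at most half of the lists give an estimate below `x`. -/
theorem le_estimate {t : ℕ} {s : Sketch Δ} {x : ℚ} (hΔ : 0 < Δ)
    (h : 2 * (Finset.univ.filter fun w => listEstimate n t (s w) < x).card ≤ Δ) :
    x ≤ (estimate n t s).val := by
  obtain ⟨l, hsort, hperm, hval⟩ := estimate_val n t s
  have hlen : l.length = Δ := by simpa using hperm.length_eq
  have hlt : Δ / 2 < l.length := by omega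
  rw [hval, List.getD_eq_getElem _ _ hlt]
  by_contra! hx
  have h1 : l.countP (· < x) = (Finset.univ.filter fun w => listEstimate n t (s w) < x).card := by
    rw [hperm.countP_eq, List.countP_map, List.countP_eq_length_filter]
    rw [← List.toFinset_card_of_nodup ((List.nodup_finRange _).filter _)]
    congr 1
    ext w
    simp
  have h2 : (l.take (Δ / 2 + 1)).countP (· < x) = Δ / 2 + 1 := by
    have : (l.take (Δ / 2 + 1)).countP (· < x) = (l.take (Δ / 2 + 1)).length := by
      rw [List.countP_eq_length]
      intro y hy
      obtain ⟨i, hi, rfl⟩ := List.mem_iff_getElem.1 hy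
      rw [List.length_take] at hi
      rw [List.getElem_take]
      have : l[i] ≤ l[Δ / 2] := by
        rcases Nat.lt_or_ge i (Δ / 2) with h | h
        · exact List.pairwise_iff_getElem.1 hsort _ _ _ _ h
        · have : i = Δ / 2 := by omega
          subst this; exact le_rfl
      simpa using this.trans_lt hx
    rw [this, List.length_take]
    omega
  have h3 := (List.take_sublist (Δ / 2 + 1) l).countP_le (p := (· < x))
  omega

theorem estimate_le {t : ℕ} {s : Sketch Δ} {x : ℚ} (h0 : 0 ≤ x)
    (h : ∀ w, listEstimate n t (s w) ≤ x) : (estimate n t s).val ≤ x := by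
  obtain ⟨l, -, hperm, hval⟩ := estimate_val n t s
  rw [hval]
  rcases Nat.lt_or_ge (Δ / 2) l.length with hlt | hlt
  · rw [List.getD_eq_getElem _ _ hlt]
    have := hperm.mem_iff.1 (List.getElem_mem hlt)
    obtain ⟨w, -, hw⟩ := List.mem_map.1 this
    rw [← hw]; exact h w
  · rw [List.getD_eq_default _ _ hlt]; exact h0

theorem listEstimate_le (hn : 0 < n) {t : ℕ} (l : List ℕ) :
    listEstimate n t l ≤ t * (n : ℚ) ^ 3 := by
  have h1 : (1 : ℚ) ≤ (n : ℚ) ^ 3 := one_le_pow₀ (by exact_mod_cast hn)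
  unfold listEstimate
  split_ifs with h
  · have : (l.length : ℚ) ≤ t := by exact_mod_cast h.le
    nlinarith [(Nat.cast_nonneg t : (0 : ℚ) ≤ t)]
  · rcases Nat.eq_zero_or_pos (l.getD (t - 1) 0) with h0 | h0
    · rw [h0]; simp; positivity
    · exact div_le_self (by positivity) (by exact_mod_cast h0)

/-- With lists of length one, the estimate is large if the least hash value is small. -/
theorem le_listEstimate {l : List ℕ} {V : Set ℕ} (hl : ListsMin l V) {v : ℕ}
    (hv : v ∈ V) (h0 : 0 ∉ V) : (n : ℚ) ^ 3 / v ≤ listEstimate n 1 l := by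
  rcases hl with ⟨rfl, -⟩ | ⟨a, ha, rfl⟩
  · simp at hv
  · have ha0 : 0 < a := Nat.pos_of_ne_zero fun h => h0 (h ▸ ha.1)
    have hav : (a : ℚ) ≤ v := by exact_mod_cast ha.2 hv
    have : (0 : ℚ) < a := by exact_mod_cast ha0
    simp only [listEstimate]
    simp
    gcongr

end Sketch

/-! ### Hash tables -/

/-- The points in the order of their ranks. -/
def byRank {n : ℕ} (π : Equiv.Perm (Fin n)) : List (Fin n) := (List.finRange n).map π.symm

theorem byRank_sorted {n : ℕ} (π : Equiv.Perm (Fin n)) :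
    (byRank π).Pairwise fun p p' => π p < π p' := by
  rw [byRank, List.pairwise_map]
  simpa using List.pairwise_lt_finRange n

theorem mem_byRank {n : ℕ} (π : Equiv.Perm (Fin n)) (p : Fin n) : p ∈ byRank π := by
  simp only [byRank, List.mem_map]
  exact ⟨π p, List.mem_finRange _, by simp⟩

theorem nodup_byRank {n : ℕ} (π : Equiv.Perm (Fin n)) : (byRank π).Nodup :=
  (List.nodup_finRange n).map π.symm.injective

theorem length_byRank {n : ℕ} (π : Equiv.Perm (Fin n)) : (byRank π).length = n := by
  simp [byRank]

section Tables

variable {X U : Type*} {n Δ : ℕ}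

theorem Table.insertPoint_bucket (S : Fin n ↪ X) (f : X → U) (T : Table U n Δ) (p : Fin n)
    (u : U) [Decidable (f (S p) = u)] :
    ((T.insertPoint S f p).val.bucket u).toList =
      (T.bucket u).toList ++ if f (S p) = u then [p] else [] := by
  classical
  simp only [insertPoint, Timed.charge, Timed.pure]
  split_ifs with h
  · subst h; simp
  · rw [Function.update_of_ne (Ne.symm h)]; simp

theorem Table.insertPoint_keys (S : Fin n ↪ X) (f : X → U) (T : Table U n Δ) (p : Fin n)
    (h : T.keys.Nodup ∧ ∀ u, u ∈ T.keys ↔ (T.bucket u).toList ≠ []) :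
    (T.insertPoint S f p).val.keys.Nodup ∧ ∀ u, u ∈ (T.insertPoint S f p).val.keys ↔
      ((T.insertPoint S f p).val.bucket u).toList ≠ [] := by
  classical
  have hk : (T.insertPoint S f p).val.keys =
      if (T.bucket (f (S p))).isEmpty then f (S p) :: T.keys else T.keys := rfl
  have he : (T.bucket (f (S p))).isEmpty = true ↔ f (S p) ∉ T.keys := by
    rw [h.2, Array.isEmpty_iff]; simp
  constructor
  · rw [hk]
    split_ifs with h0
    · exact List.nodup_cons.2 ⟨he.1 h0, h.1⟩
    · exact h.1
  · intro u
    rw [insertPoint_bucket, hk]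
    by_cases hu : f (S p) = u
    · subst hu
      rw [if_pos (rfl : f (S p) = f (S p))]
      split_ifs with h0
      · simp
      · rw [he, not_not] at h0; simp [h0]
    · rw [if_neg hu, List.append_nil, ← h.2]
      split_ifs
      · simp [Ne.symm hu]
      · rfl

open Classical in
theorem Table.foldl_insertPoint (S : Fin n ↪ X) (f : X → U) (l : List (Fin n))
    (T : Table U n Δ) (h : T.keys.Nodup ∧ ∀ u, u ∈ T.keys ↔ (T.bucket u).toList ≠ []) :
    let T' := (Timed.foldl (Table.insertPoint S f) T l).val
    (T'.keys.Nodup ∧ ∀ u, u ∈ T'.keys ↔ (T'.bucket u).toList ≠ []) ∧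
      (∀ u, (T'.bucket u).toList = (T.bucket u).toList ++ l.filter fun p => f (S p) = u) ∧
      T'.sketch = T.sketch := by
  induction l generalizing T with
  | nil => exact ⟨h, by simp [Timed.foldl, Timed.pure], rfl⟩
  | cons p l ih =>
    obtain ⟨h1, h2, h3⟩ := ih (T.insertPoint S f p).val (T.insertPoint_keys S f p h)
    refine ⟨h1, fun u => (h2 u).trans ?_, h3.trans rfl⟩
    rw [insertPoint_bucket, List.filter_cons, List.append_assoc]
    by_cases hu : f (S p) = u <;> simp [hu]

open Classical in
theorem Table.foldl_addSketch (t τ : ℕ) (ψ : Fin Δ → Fin n → Fin (n ^ 3)) (l : List U)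
    (T : Table U n Δ) :
    let T' := (Timed.foldl (Table.addSketch t τ ψ) T l).val
    T'.keys = T.keys ∧ T'.bucket = T.bucket ∧
      ∀ u, T'.sketch u = if u ∈ l ∧ τ ≤ (T.bucket u).size
        then some (Sketch.ofPoints t ψ (T.bucket u).toList).val else T.sketch u := by
  induction l generalizing T with
  | nil => exact ⟨rfl, rfl, by simp [Timed.foldl, Timed.pure]⟩
  | cons v l ih =>
    have hT : (T.addSketch t τ ψ v).val.keys = T.keys ∧ (T.addSketch t τ ψ v).val.bucket = T.bucket ∧
        ∀ u, (T.addSketch t τ ψ v).val.sketch u = if u = v ∧ τ ≤ (T.bucket u).size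
          then some (Sketch.ofPoints t ψ (T.bucket u).toList).val else T.sketch u := by
      simp only [addSketch, Timed.charge]
      split_ifs with h
      · refine ⟨rfl, rfl, fun u => ?_⟩
        rw [if_neg]
        · rfl
        · rintro ⟨rfl, h'⟩; omega
      · refine ⟨rfl, rfl, fun u => ?_⟩
        simp only [Timed.bind, Timed.pure]
        by_cases hu : u = v
        · subst hu; simp [not_lt.1 h]
        · simp [hu]
    obtain ⟨h1, h2, h3⟩ := ih (T.addSketch t τ ψ v).val
    refine ⟨h1.trans hT.1, h2.trans hT.2.1, fun u => (h3 u).trans ?_⟩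
    rw [hT.2.1, hT.2.2]
    by_cases h4 : τ ≤ (T.bucket u).size
    · by_cases h5 : u ∈ l <;> by_cases h6 : u = v <;> simp_all
    · simp only [h4, and_false, if_false]

/-- The points inserted into a table, before the sketches are computed. -/
def insertAll (S : Fin n ↪ X) (π : Equiv.Perm (Fin n)) (f : X → U) : Timed (Table U n Δ) :=
  Timed.foldl (Table.insertPoint S f) ⟨[], fun _ => #[], fun _ => none⟩ (byRank π)

open Classical in
theorem insertAll_spec (S : Fin n ↪ X) (π : Equiv.Perm (Fin n)) (f : X → U) :
    let T := (insertAll (Δ := Δ) S π f).val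
    (T.keys.Nodup ∧ ∀ u, u ∈ T.keys ↔ (T.bucket u).toList ≠ []) ∧
      (∀ u, (T.bucket u).toList = (byRank π).filter fun p => f (S p) = u) ∧
      T.sketch = fun _ => none := by
  obtain ⟨h1, h2, h3⟩ := Table.foldl_insertPoint (Δ := Δ) S f (byRank π)
    ⟨[], fun _ => #[], fun _ => none⟩ ⟨by simp, by simp⟩
  exact ⟨h1, fun u => (h2 u).trans (by simp), h3⟩

variable (K : Constants) (S : Fin n ↪ X) (π : Equiv.Perm (Fin n))
  (ψ : Fin Δ → Fin n → Fin (n ^ 3)) (f : X → U)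

theorem buildTable_eq : buildTable K S π ψ f = (insertAll S π f).bind fun T =>
    Timed.foldl (Table.addSketch K.t (K.cτ * lg n) ψ) T T.keys := rfl

open Classical in
theorem buildTable_bucket (u : U) :
    ((buildTable K S π ψ f).val.bucket u).toList = (byRank π).filter fun p => f (S p) = u := by
  rw [buildTable_eq]
  simp only [Timed.bind]
  rw [(Table.foldl_addSketch _ _ _ _ _).2.1]
  exact (insertAll_spec S π f).2.1 u

theorem buildTable_keys :
    (buildTable K S π ψ f).val.keys.Nodup ∧ ∀ u, u ∈ (buildTable K S π ψ f).val.keys ↔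
      ((buildTable K S π ψ f).val.bucket u).toList ≠ [] := by
  rw [buildTable_eq]
  simp only [Timed.bind]
  rw [(Table.foldl_addSketch _ _ _ _ _).2.1, (Table.foldl_addSketch _ _ _ _ _).1]
  exact (insertAll_spec S π f).1

theorem lg_pos (hn : 2 ≤ n) : 0 < lg n := Nat.clog_pos one_lt_two hn

open Classical in
theorem buildTable_sketch (hn : 2 ≤ n) (u : U) :
    (buildTable K S π ψ f).val.sketch u =
      if K.cτ * lg n ≤ ((buildTable K S π ψ f).val.bucket u).size
        then some (Sketch.ofPoints K.t ψ ((buildTable K S π ψ f).val.bucket u).toList).val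
        else none := by
  rw [buildTable_eq]
  simp only [Timed.bind]
  simp only [(Table.foldl_addSketch _ _ _ _ _).2.1, (Table.foldl_addSketch _ _ _ _ _).2.2]
  have hs := insertAll_spec (Δ := Δ) S π f
  set T := (insertAll (Δ := Δ) S π f).val
  rw [hs.2.2]
  have hτ : 0 < K.cτ * lg n := Nat.mul_pos K.cτ_pos (lg_pos hn)
  by_cases h : K.cτ * lg n ≤ (T.bucket u).size
  · have : u ∈ T.keys := by
      rw [hs.1.2, Ne, ← List.length_eq_zero_iff, Array.length_toList]; omega
    simp [h, this]
  · simp [h]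

/-- The buckets of a table partition the points. -/
theorem sum_bucket_size :
    ((buildTable K S π ψ f).val.keys.map fun u =>
      ((buildTable K S π ψ f).val.bucket u).size).sum = n := by
  classical
  have hk := buildTable_keys K S π ψ f
  have hb := buildTable_bucket K S π ψ f
  set T := (buildTable K S π ψ f).val
  rw [← List.sum_toFinset _ hk.1]
  have hsize : ∀ u, (T.bucket u).size = (Finset.univ.filter fun p => f (S p) = u).card := by
    intro u
    rw [← Array.length_toList, hb, ← List.toFinset_card_of_nodup ((nodup_byRank π).filter _)]
    congr 1
    ext p
    simp [mem_byRank]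
  simp_rw [hsize]
  refine (Finset.card_eq_sum_card_fiberwise (f := fun p => f (S p)) (s := Finset.univ)
    fun p _ => ?_).symm.trans (Finset.card_fin n)
  simp only [List.coe_toFinset, Set.mem_ofPred_eq]
  rw [hk.2, hb, Ne, List.filter_eq_nil_iff]
  simp only [not_forall]
  exact ⟨p, mem_byRank π p, by simp⟩

theorem length_keys_le : (buildTable K S π ψ f).val.keys.length ≤ n := by
  have hk := buildTable_keys K S π ψ f
  have hb := sum_bucket_size K S π ψ f
  set T := (buildTable K S π ψ f).val
  calc T.keys.length = (T.keys.map fun _ => 1).sum := by simp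
    _ ≤ (T.keys.map fun u => (T.bucket u).size).sum := by
      refine List.sum_le_sum fun u hu => ?_
      rw [hk.2, Ne, ← List.length_eq_zero_iff, Array.length_toList] at hu
      omega
    _ = n := hb

/-! ### Space and construction time -/

theorem sketchWords_le (hn : 2 ≤ n) (u : U) (hΔ : Δ = numLists K n) :
    (((buildTable K S π ψ f).val.sketch u).map Sketch.words).getD 0 ≤
      K.cΔ * (1 + K.t) * ((buildTable K S π ψ f).val.bucket u).size := by
  rw [buildTable_sketch K S π ψ f hn]
  split_ifs with h
  · simp only [Option.map_some, Option.getD_some]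
    refine (Sketch.words_ofPoints_le _ _ _).trans ?_
    have h1 : lg n ≤ K.cτ * lg n := Nat.le_mul_of_pos_left _ K.cτ_pos
    calc Δ * (1 + K.t) = K.cΔ * (1 + K.t) * lg n := by rw [hΔ, numLists]; ring
      _ ≤ _ := Nat.mul_le_mul_left _ (h1.trans h)
  · simp

theorem le_tableWords : n ≤ (buildTable K S π ψ f).val.words := by
  have h := sum_bucket_size K S π ψ f
  rw [Table.words]
  refine h.symm.le.trans (le_trans (List.sum_le_sum fun u _ => ?_) (Nat.le_add_left _ 1))
  omega

theorem tableWords_le (hn : 2 ≤ n) (hΔ : Δ = numLists K n) :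
    (buildTable K S π ψ f).val.words ≤ 1 + n * (3 + K.cΔ * (1 + K.t)) := by
  have h := sum_bucket_size K S π ψ f
  have hl := length_keys_le K S π ψ f
  have hw := fun u => sketchWords_le K S π ψ f hn u hΔ
  set T := (buildTable K S π ψ f).val
  rw [Table.words]
  refine Nat.add_le_add_left ?_ 1
  calc (T.keys.map fun u => 2 + (T.bucket u).size + ((T.sketch u).map Sketch.words).getD 0).sum
      ≤ (T.keys.map fun u => 2 + (1 + K.cΔ * (1 + K.t)) * (T.bucket u).size).sum := by
        refine List.sum_le_sum fun u _ => ?_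
        have := hw u
        linarith
    _ = T.keys.length * 2 + (1 + K.cΔ * (1 + K.t)) * n := by
        rw [List.sum_map_add, List.sum_map_mul_left, h]; simp
    _ ≤ _ := by nlinarith

/-- The sketch computations dominate: each point enters the sketch of one bucket. -/
theorem buildTable_time_le :
    (buildTable K S π ψ f).time ≤ n * (8 + Δ * (3 + 2 * K.t)) := by
  have hl := length_keys_le K S π ψ f
  have h := sum_bucket_size K S π ψ f
  rw [buildTable_eq] at h hl ⊢
  simp only [Timed.bind] at h hl ⊢
  rw [(Table.foldl_addSketch _ _ _ _ _).2.1, (Table.foldl_addSketch _ _ _ _ _).1] at h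
  rw [(Table.foldl_addSketch _ _ _ _ _).1] at hl
  have hk := (insertAll_spec (Δ := Δ) S π f).1
  have h1 : (insertAll (Δ := Δ) S π f).time ≤ n * (1 + 3) := by
    have := Timed.foldl_time_le_const (f := Table.insertPoint (Δ := Δ) S f) (c := 3)
      (fun _ => True) (l := byRank π) (fun _ _ _ _ => trivial) (fun _ _ _ _ => le_rfl)
      (b := ⟨[], fun _ => #[], fun _ => none⟩) trivial
    rwa [length_byRank] at this
  set T := (insertAll (Δ := Δ) S π f).val
  have h2 : (Timed.foldl (Table.addSketch K.t (K.cτ * lg n) ψ) T T.keys).time ≤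
      (T.keys.map fun u => 1 + (2 + (T.bucket u).size * (1 + Δ * (3 + 2 * K.t)))).sum := by
    refine Timed.foldl_time_le (fun T' : Table U n Δ => T'.bucket = T.bucket) ?_ ?_ rfl
    · intro T' u _ hT'
      simp only [Table.addSketch, Timed.charge]
      split_ifs
      · exact hT'
      · exact hT'
    · intro T' u hu hT'
      have h3 := Sketch.ofPoints_time_le K.t ψ (T.bucket u).toList
      rw [Array.length_toList] at h3
      rw [hk.2, Ne, ← List.length_eq_zero_iff, Array.length_toList] at hu
      simp only [Table.addSketch, Timed.charge, hT']
      split_ifs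
      · simp [Timed.pure]
      · simp only [Timed.bind, Timed.pure]
        have : 1 ≤ (T.bucket u).size := by omega
        nlinarith
  have h4 : (T.keys.map fun u => 1 + (2 + (T.bucket u).size * (1 + Δ * (3 + 2 * K.t)))).sum =
      T.keys.length * 3 + n * (1 + Δ * (3 + 2 * K.t)) := by
    simp_rw [← add_assoc]
    rw [List.sum_map_add, List.sum_map_mul_right, h]; simp
  nlinarith

end Tables

section Build

variable {X U : Type*} {n L Δ : ℕ} (K : Constants) (S : Fin n ↪ X) (f : Fin L → X → U)
  (π : Equiv.Perm (Fin n)) (ψ : Fin Δ → Fin n → Fin (n ^ 3))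

theorem le_buildWords : L * n ≤ (build K S f π ψ).val.words := by
  have : L * n ≤ ∑ i, (buildTable K S π ψ (f i)).val.words := by
    refine le_trans ?_ (Finset.card_nsmul_le_sum _ _ n fun i _ => le_tableWords K S π ψ (f i))
    simp
  exact this.trans (Nat.le_add_left _ _)

theorem buildWords_le (hn : 2 ≤ n) (hΔ : Δ = numLists K n) :
    (build K S f π ψ).val.words ≤ 3 * n + L + Δ + L * (1 + n * (3 + K.cΔ * (1 + K.t))) := by
  refine Nat.add_le_add_left ?_ _
  refine (Finset.sum_le_card_nsmul _ _ _
    fun i _ => tableWords_le K S π ψ (f i) hn hΔ).trans ?_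
  simp

theorem build_time_le :
    (build K S f π ψ).time ≤ 3 * n + L + Δ + L * (1 + n * (8 + Δ * (3 + 2 * K.t))) := by
  exact Nat.add_le_add_left (Timed.tabulate_time_le fun i => buildTable_time_le K S π ψ (f i)) _

end Build

/-! ### Retrieving a segment of ranks -/

/-- The segment that contains the rank of `p` when the ranks are cut into `k` segments. -/
def segment {n : ℕ} (rank : Fin n → Fin n) (k : ℕ) (p : Fin n) : ℕ := (rank p : ℕ) * k / n

theorem segment_eq_iff {n : ℕ} (rank : Fin n → Fin n) (k h : ℕ) (p : Fin n) :
    segment rank k p = h ↔ h * n ≤ (rank p : ℕ) * k ∧ (rank p : ℕ) * k < (h + 1) * n := by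
  have hn : 0 < n := p.pos
  rw [segment, Nat.div_eq_iff hn]
  have := Nat.succ_mul h n
  rw [Nat.succ_eq_add_one] at this
  constructor <;> rintro ⟨h1, h2⟩ <;> constructor <;> omega

theorem segment_lt {n : ℕ} (rank : Fin n → Fin n) {k : ℕ} (hk : 0 < k) (p : Fin n) :
    segment rank k p < k := by
  rw [segment, Nat.div_lt_iff_lt_mul p.pos, mul_comm]
  exact Nat.mul_lt_mul_of_pos_left (rank p).2 hk

section Scan

variable {n : ℕ} (rank : Fin n → Fin n) (A : Array (Fin n)) (a k : ℕ)

/-- The loop invariant of the binary search: the answer lies between `i` and `j`. -/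
theorem binarySearch_spec (hs : A.toList.Pairwise fun p p' => rank p < rank p') (i j : ℕ)
    (hij : i ≤ j) (hj : j ≤ A.size) (hlow : ∀ x (hx : x < A.size), x < i → (rank A[x] : ℕ) * k < a)
    (hhigh : ∀ x (hx : x < A.size), j ≤ x → a ≤ (rank A[x] : ℕ) * k) :
    ∀ x (hx : x < A.size), (x < (binarySearch rank A a k i j hj).val → (rank A[x] : ℕ) * k < a) ∧
      ((binarySearch rank A a k i j hj).val ≤ x → a ≤ (rank A[x] : ℕ) * k) := by
  have mono : ∀ x y (hx : x < A.size) (hy : y < A.size), x ≤ y →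
      (rank A[x] : ℕ) * k ≤ (rank A[y] : ℕ) * k := by
    intro x y hx hy hxy
    rcases hxy.lt_or_eq with h | rfl
    · have := List.pairwise_iff_getElem.1 hs x y (by simpa using hx) (by simpa using hy) h
      simp only [Array.getElem_toList] at this
      exact Nat.mul_le_mul_right _ this.le
    · exact le_rfl
  induction hd : j - i using Nat.strong_induction_on generalizing i j with
  | _ d ih =>
    rw [binarySearch]
    split_ifs with h1 h2
    · exact ih ((i + j) / 2 - i) (by omega) i ((i + j) / 2) (by omega) (by omega) hlow
        (fun x hx hjx => h2.trans (mono _ _ _ hx hjx)) rfl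
    · refine ih (j - ((i + j) / 2 + 1)) (by omega) ((i + j) / 2 + 1) j (by omega) hj
        (fun x hx hxi => ?_) hhigh rfl
      exact lt_of_le_of_lt (mono x ((i + j) / 2) hx (by omega) (by omega)) (not_le.1 h2)
    · intro x hx
      exact ⟨fun h => hlow x hx h, fun h => hhigh x hx (le_trans (not_lt.1 h1) h)⟩

/-- Binary search splits a sorted bucket at the first point with a large enough rank. -/
theorem binarySearch_split (hs : A.toList.Pairwise fun p p' => rank p < rank p') :
    (∀ p ∈ A.toList.take (binarySearch rank A a k 0 A.size le_rfl).val, (rank p : ℕ) * k < a) ∧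
      ∀ p ∈ A.toList.drop (binarySearch rank A a k 0 A.size le_rfl).val, a ≤ (rank p : ℕ) * k := by
  have h := binarySearch_spec rank A a k hs 0 A.size (Nat.zero_le _) le_rfl (by omega)
    (fun x hx h => absurd hx (by omega))
  set v := (binarySearch rank A a k 0 A.size le_rfl).val
  constructor
  · intro p hp
    obtain ⟨x, hx, rfl⟩ := List.mem_iff_getElem.1 hp
    rw [List.length_take, Array.length_toList] at hx
    rw [List.getElem_take, Array.getElem_toList]
    exact (h x (by omega)).1 (by omega)
  · intro p hp
    obtain ⟨x, hx, rfl⟩ := List.mem_iff_getElem.1 hp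
    rw [List.length_drop, Array.length_toList] at hx
    rw [List.getElem_drop, Array.getElem_toList]
    exact (h (v + x) (by omega)).2 (by omega)

theorem binarySearch_time_le (i j : ℕ) (hj : j ≤ A.size) :
    (binarySearch rank A a k i j hj).time ≤ 3 * Nat.clog 2 (j - i + 1) + 1 := by
  have hclog : ∀ m, 0 < m → Nat.clog 2 (m + 1) = Nat.clog 2 (m / 2 + 1) + 1 := by
    intro m hm
    rw [Nat.clog_of_two_le one_lt_two (by omega)]
    congr 2
    omega
  induction hd : j - i using Nat.strong_induction_on generalizing i j with
  | _ d ih =>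
    rw [binarySearch]
    split_ifs with h1 h2
    · have := ih ((i + j) / 2 - i) (by omega) i ((i + j) / 2) (by omega) rfl
      have h3 : Nat.clog 2 ((i + j) / 2 - i + 1) ≤ Nat.clog 2 (d / 2 + 1) :=
        Nat.clog_mono_right 2 (by omega)
      rw [hclog d (by omega)]
      simp only [Timed.charge]
      omega
    · have := ih (j - ((i + j) / 2 + 1)) (by omega) ((i + j) / 2 + 1) j hj rfl
      have h3 : Nat.clog 2 (j - ((i + j) / 2 + 1) + 1) ≤ Nat.clog 2 (d / 2 + 1) :=
        Nat.clog_mono_right 2 (by omega)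
      rw [hclog d (by omega)]
      simp only [Timed.charge]
      omega
    · simp [Timed.charge, Timed.pure]

variable {X : Type*} [MetricSpace X] (pts : Fin n → X) (q : X) (r : ℝ) (b : ℕ)

theorem mem_scan (hs : A.toList.Pairwise fun p p' => rank p < rank p') (i : ℕ)
    (acc : Finset (Fin n)) (p : Fin n) :
    p ∈ (scan pts rank q r A b k i acc).val ↔ p ∈ acc ∨
      (p ∈ A.toList.drop i ∧ dist (pts p) q ≤ r ∧ (rank p : ℕ) * k < b) := by
  induction hd : A.size - i using Nat.strong_induction_on generalizing i acc with
  | _ d ih =>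
    rw [scan]
    by_cases h1 : i < A.size
    swap
    · rw [dif_neg h1, List.drop_eq_nil_of_le (by simpa using h1)]
      simp [Timed.charge, Timed.pure]
    rw [dif_pos h1]
    by_cases h2 : (rank A[i] : ℕ) * k < b
    · rw [if_pos h2]
      simp only [Timed.charge]
      rw [ih (A.size - (i + 1)) (by omega) (i + 1) _ rfl,
        List.drop_eq_getElem_cons (i := i) (by simpa using h1)]
      simp only [Array.getElem_toList, List.mem_cons]
      split_ifs with h3
      · rw [Finset.mem_insert]
        constructor
        · rintro ((rfl | h) | h)
          · exact Or.inr ⟨Or.inl rfl, h3, h2⟩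
          · exact Or.inl h
          · exact Or.inr ⟨Or.inr h.1, h.2⟩
        · rintro (h | ⟨rfl | h, h'⟩)
          · exact Or.inl (Or.inr h)
          · exact Or.inl (Or.inl rfl)
          · exact Or.inr ⟨h, h'⟩
      · constructor
        · rintro (h | h)
          · exact Or.inl h
          · exact Or.inr ⟨Or.inr h.1, h.2⟩
        · rintro (h | ⟨rfl | h, h'⟩)
          · exact Or.inl h
          · exact absurd h'.1 h3
          · exact Or.inr ⟨h, h'⟩
    · rw [if_neg h2]
      simp only [Timed.charge, Timed.pure]
      constructor
      · exact Or.inl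
      · rintro (h | ⟨h, -, h'⟩)
        · exact h
        · -- the ranks of the later points are even larger
          exfalso
          obtain ⟨x, hx, rfl⟩ := List.mem_iff_getElem.1 h
          rw [List.length_drop, Array.length_toList] at hx
          rw [List.getElem_drop, Array.getElem_toList] at h'
          rcases Nat.eq_zero_or_pos x with rfl | hx0
          · exact h2 (by simpa using h')
          · have := List.pairwise_iff_getElem.1 hs i (i + x) (by simpa using h1)
              (by rw [Array.length_toList]; omega) (by omega)
            simp only [Array.getElem_toList] at this
            exact h2 (lt_of_le_of_lt (Nat.mul_le_mul_right k (Fin.le_def.1 this.le)) h')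

theorem scan_time_le (i : ℕ) (acc : Finset (Fin n)) :
    (scan pts rank q r A b k i acc).time ≤
      2 + 4 * (A.toList.drop i).countP fun p => (rank p : ℕ) * k < b := by
  induction hd : A.size - i using Nat.strong_induction_on generalizing i acc with
  | _ d ih =>
    rw [scan]
    by_cases h1 : i < A.size
    swap
    · rw [dif_neg h1]
      simp only [Timed.charge, Timed.pure]
      omega
    rw [dif_pos h1]
    by_cases h2 : (rank A[i] : ℕ) * k < b
    · rw [if_pos h2]
      simp only [Timed.charge]
      have := ih (A.size - (i + 1)) (by omega) (i + 1)
        (if dist (pts A[i]) q ≤ r then insert A[i] acc else acc) rfl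
      rw [List.drop_eq_getElem_cons (i := i) (by simpa using h1),
        List.countP_cons_of_pos (by simpa using h2)]
      omega
    · rw [if_neg h2]
      simp [Timed.charge, Timed.pure]

end Scan

section Collect

variable {X U : Type*} [MetricSpace X] {n L Δ : ℕ}

/-- The sorted buckets of a query. -/
def SortedBuckets (rank : Fin n → Fin n) (b : Fin L → Array (Fin n) × Sketch Δ) : Prop :=
  ∀ i, (b i).1.toList.Pairwise fun p p' => rank p < rank p'

theorem SortedBuckets.size_le {rank : Fin n → Fin n} {b : Fin L → Array (Fin n) × Sketch Δ}
    (hb : SortedBuckets rank b) (i : Fin L) : (b i).1.size ≤ n := by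
  have : (b i).1.toList.Nodup := (hb i).imp fun h => fun h' => absurd h (by rw [h']; simp)
  have := this.length_le_card
  simpa using this

variable (D : Index X U n L Δ) (q : X) (r : ℝ) {b : Fin L → Array (Fin n) × Sketch Δ}

theorem mem_collect (hb : SortedBuckets D.rank b) (k h : ℕ) (p : Fin n) :
    p ∈ (collect D q r b k h).val ↔ (∃ i, p ∈ (b i).1.toList) ∧ dist (D.pts p) q ≤ r ∧
      segment D.rank k p = h := by
  change p ∈ (Timed.foldl (fun acc i =>
      (binarySearch D.rank (b i).1 (h * n) k 0 (b i).1.size le_rfl).bind fun j =>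
        scan D.pts D.rank q r (b i).1 ((h + 1) * n) k j acc)
    ∅ (List.finRange L)).val ↔ _
  rw [Timed.foldl_val]
  suffices H : ∀ (l : List (Fin L)) (acc : Finset (Fin n)),
      p ∈ l.foldl (fun acc i =>
        ((binarySearch D.rank (b i).1 (h * n) k 0 (b i).1.size le_rfl).bind fun j =>
        scan D.pts D.rank q r (b i).1 ((h + 1) * n) k j acc).val) acc ↔
      p ∈ acc ∨ ((∃ i ∈ l, p ∈ (b i).1.toList) ∧ dist (D.pts p) q ≤ r ∧
        segment D.rank k p = h) by
    simpa using H (List.finRange L) ∅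
  intro l
  induction l with
  | nil => simp
  | cons i l ih =>
    intro acc
    rw [List.foldl_cons, ih]
    simp only [Timed.bind]
    rw [mem_scan _ _ _ _ _ _ _ (hb i)]
    have hsplit := binarySearch_split D.rank (b i).1 (h * n) k (hb i)
    set v := (binarySearch D.rank (b i).1 (h * n) k 0 (b i).1.size le_rfl).val
    have key : (p ∈ (b i).1.toList.drop v ∧ dist (D.pts p) q ≤ r ∧
        (D.rank p : ℕ) * k < (h + 1) * n) ↔
        (p ∈ (b i).1.toList ∧ dist (D.pts p) q ≤ r ∧ segment D.rank k p = h) := by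
      rw [segment_eq_iff]
      constructor
      · rintro ⟨h1, h2, h3⟩
        exact ⟨List.mem_of_mem_drop h1, h2, hsplit.2 p h1, h3⟩
      · rintro ⟨h1, h2, h3, h4⟩
        refine ⟨?_, h2, h4⟩
        rw [← List.take_append_drop v (b i).1.toList, List.mem_append] at h1
        rcases h1 with h1 | h1
        · exact absurd (hsplit.1 p h1) (not_lt.2 h3)
        · exact h1
    rw [key]
    simp only [List.mem_cons, exists_eq_or_imp]
    tauto

/-- The number of entries in the buckets of a query with rank in the segment `h`. -/
def segmentSize (rank : Fin n → Fin n) (b : Fin L → Array (Fin n) × Sketch Δ) (k h : ℕ) : ℕ :=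
  ∑ i, (b i).1.toList.countP fun p => segment rank k p = h

/-- The total size of the buckets of a query. -/
def totalSize (b : Fin L → Array (Fin n) × Sketch Δ) : ℕ := ∑ i, (b i).1.size

theorem sum_segmentSize (rank : Fin n → Fin n) (b : Fin L → Array (Fin n) × Sketch Δ) {k : ℕ}
    (hk : 0 < k) : ∑ h : Fin k, segmentSize rank b k h = totalSize b := by
  unfold segmentSize totalSize
  rw [Finset.sum_comm]
  refine Finset.sum_congr rfl fun i _ => ?_
  rw [← Array.length_toList]
  induction (b i).1.toList with
  | nil => simp
  | cons p l ih =>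
    simp only [List.countP_cons, List.length_cons, Finset.sum_add_distrib, ih]
    congr 1
    rw [Finset.sum_eq_single (⟨segment rank k p, segment_lt rank hk p⟩ : Fin k)]
    · simp
    · intro h _ hne
      have : ¬ segment rank k p = h := fun h' => hne (Fin.ext h'.symm)
      simp [this]
    · simp

/-- Per table a binary search and a scan that stops one entry after the segment, then the clearing
of the bit array. -/
theorem collect_time_le (hn : 2 ≤ n) (hb : SortedBuckets D.rank b) (k h : ℕ) :
    (collect D q r b k h).time ≤ L * (3 * lg n + 7) + 5 * segmentSize D.rank b k h := by
  classical
  have hcard : (collect D q r b k h).val.card ≤ segmentSize D.rank b k h := by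
    calc _ ≤ (Finset.univ.biUnion fun i => ((b i).1.toList.filter
            fun p => segment D.rank k p = h).toFinset).card := by
          refine Finset.card_le_card fun p hp => ?_
          obtain ⟨⟨i, hi⟩, -, h2⟩ := (mem_collect D q r hb k h p).1 hp
          simp only [Finset.mem_biUnion, Finset.mem_univ, true_and, List.mem_toFinset,
            List.mem_filter, decide_eq_true_eq]
          exact ⟨i, hi, h2⟩
      _ ≤ ∑ i, ((b i).1.toList.filter fun p => segment D.rank k p = h).toFinset.card :=
          Finset.card_biUnion_le
      _ ≤ _ := by
          refine Finset.sum_le_sum fun i _ => ?_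
          rw [List.countP_eq_length_filter]
          exact List.toFinset_card_le _
  have hfold : (Timed.foldl (fun acc i =>
      (binarySearch D.rank (b i).1 (h * n) k 0 (b i).1.size le_rfl).bind fun j =>
        scan D.pts D.rank q r (b i).1 ((h + 1) * n) k j acc)
    ∅ (List.finRange L)).time ≤ ((List.finRange L).map fun i => 1 + (3 * lg n + 6 + 4 *
      (b i).1.toList.countP fun p => segment D.rank k p = h)).sum := by
    refine Timed.foldl_time_le (fun _ => True) (fun _ _ _ _ => trivial) (fun acc i _ _ => ?_)
      trivial
    have h1 := binarySearch_time_le D.rank (b i).1 (h * n) k 0 (b i).1.size le_rfl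
    have hsplit := binarySearch_split D.rank (b i).1 (h * n) k (hb i)
    simp only [Timed.bind]
    set v := (binarySearch D.rank (b i).1 (h * n) k 0 (b i).1.size le_rfl).val
    have h2 := scan_time_le D.rank (b i).1 k D.pts q r ((h + 1) * n) v acc
    have h3 : ((b i).1.toList.drop v).countP (fun p => (D.rank p : ℕ) * k < (h + 1) * n) ≤
        (b i).1.toList.countP fun p => segment D.rank k p = h := by
      refine le_trans (List.countP_mono_left fun p hp hlt => ?_)
        ((List.drop_sublist v (b i).1.toList).countP_le)
      simp only [decide_eq_true_eq] at hlt ⊢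
      exact (segment_eq_iff _ _ _ _).2 ⟨hsplit.2 p hp, hlt⟩
    have h4 : Nat.clog 2 ((b i).1.size - 0 + 1) ≤ lg n + 1 := by
      have := hb.size_le i
      calc Nat.clog 2 ((b i).1.size - 0 + 1) ≤ Nat.clog 2 (2 ^ (lg n + 1)) := by
            refine Nat.clog_mono_right 2 ?_
            have := Nat.le_pow_clog one_lt_two n
            rw [pow_succ, lg]
            omega
        _ = lg n + 1 := Nat.clog_pow 2 _ one_lt_two
    omega
  rw [← Fin.sum_univ_def] at hfold
  have : ∑ i : Fin L, (1 + (3 * lg n + 6 + 4 *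
      (b i).1.toList.countP fun p => segment D.rank k p = h)) =
      L * (3 * lg n + 7) + 4 * segmentSize D.rank b k h := by
    rw [segmentSize, Finset.mul_sum]
    simp only [Finset.sum_add_distrib, Finset.sum_const, Finset.card_univ, Fintype.card_fin,
      smul_eq_mul]
    ring
  rw [this] at hfold
  have htime : (collect D q r b k h).time = (Timed.foldl (fun acc i =>
      (binarySearch D.rank (b i).1 (h * n) k 0 (b i).1.size le_rfl).bind fun j =>
        scan D.pts D.rank q r (b i).1 ((h + 1) * n) k j acc)
    ∅ (List.finRange L)).time + ((collect D q r b k h).val.card + 0) := rfl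
  omega

end Collect

/-! ### The buckets of a query and the estimate of their union -/

section Lookup

variable {X U : Type*} {n L Δ : ℕ} (K : Constants) (S : Fin n ↪ X)
  (f : Fin L → X → U) (π : Equiv.Perm (Fin n)) (ψ : Fin Δ → Fin n → Fin (n ^ 3)) (q : X)

open Classical in
theorem lookup_bucket (i : Fin L) :
    ((lookup K (build K S f π ψ).val q).val i).1.toList =
      (byRank π).filter fun p => f i (S p) = f i q := by
  rw [← buildTable_bucket K S π ψ (f i) (f i q)]
  simp only [lookup, build, Timed.tabulate, Timed.charge, Timed.bind, Timed.pure]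
  split <;> rfl

theorem lookup_sketch (hn : 2 ≤ n) (i : Fin L) :
    ((lookup K (build K S f π ψ).val q).val i).2 = (Sketch.ofPoints K.t ψ
      ((lookup K (build K S f π ψ).val q).val i).1.toList).val := by
  simp only [lookup, build, Timed.tabulate, Timed.charge, Timed.bind, Timed.pure]
  split
  · next s hs =>
    rw [buildTable_sketch K S π ψ (f i) hn] at hs
    split_ifs at hs
    exact (Option.some.inj hs).symm
  · rfl

theorem lookup_sorted : SortedBuckets π (lookup K (build K S f π ψ).val q).val := by
  intro i
  rw [lookup_bucket]
  exact (byRank_sorted π).filter _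

theorem mem_lookup (p : Fin n) : (∃ i, p ∈ ((lookup K (build K S f π ψ).val q).val i).1.toList) ↔
    ∃ i, f i (S p) = f i q := by
  refine exists_congr fun i => ?_
  rw [lookup_bucket]
  simp [mem_byRank]

theorem lookup_time_le (hn : 2 ≤ n) :
    (lookup K (build K S f π ψ).val q).time ≤
      L * (3 + Δ + K.cτ * lg n * (1 + Δ * (2 + 2 * K.t))) := by
  refine (Timed.tabulate_time_le (c := 2 + (Δ + K.cτ * lg n * (1 + Δ * (2 + 2 * K.t))))
    fun i => ?_).trans (le_of_eq (by ring))
  refine Nat.add_le_add_left ?_ 2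
  split
  · simp [Timed.pure]
  · next hs =>
    simp only [Timed.bind, Timed.pure, add_zero]
    refine (Sketch.ofPoints_time_le _ _ _).trans (Nat.add_le_add_left (Nat.mul_le_mul_right _ ?_) _)
    simp only [build, Timed.tabulate, Timed.charge, Timed.bind, Timed.pure] at hs ⊢
    rw [buildTable_sketch K S π ψ (f i) hn] at hs
    split_ifs at hs with h
    rw [Array.length_toList]
    omega

theorem estimateCollisions_time_le {b : Fin L → Array (Fin n) × Sketch Δ}
    (hb : ∀ i w, ((b i).2 w).length ≤ K.t) :
    (estimateCollisions K b).time ≤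
      L * (1 + Δ * (1 + K.t * (1 + 2 * K.t))) + Δ * (Δ + K.t + 4) := by
  refine Nat.add_le_add ?_ (Sketch.estimate_time_le _ _ _)
  have := Timed.foldl_time_le_const (f := fun s i => Sketch.merge K.t s (b i).2)
    (c := Δ * (1 + K.t * (1 + 2 * K.t))) (fun _ => True) (l := List.finRange L)
    (fun _ _ _ _ => trivial) (fun _ i _ _ => Sketch.merge_time_le (hb i))
    (b := fun _ => []) trivial
  rwa [List.length_finRange] at this

theorem estimateCollisions_le (hn : 2 ≤ n) (b : Fin L → Array (Fin n) × Sketch Δ) :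
    (estimateCollisions K b).val ≤ K.t * (n : ℚ) ^ 3 :=
  Sketch.estimate_le (by positivity) fun _ => Sketch.listEstimate_le (by omega) _

theorem listsMin_foldl_merge (b : Fin L → Array (Fin n) × Sketch Δ) (w : Fin Δ)
    (V : Fin L → Set ℕ) (hb : ∀ i, ListsMin ((b i).2 w) (V i)) :
    ListsMin ((Timed.foldl (fun s i => Sketch.merge 1 s (b i).2) (fun _ => [])
      (List.finRange L)).val w) (⋃ i, V i) := by
  rw [Timed.foldl_val]
  suffices H : ∀ (l : List (Fin L)) (s : Sketch Δ) (V₀ : Set ℕ), ListsMin (s w) V₀ →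
      ListsMin (l.foldl (fun s i => (Sketch.merge 1 s (b i).2).val) s w)
        (V₀ ∪ ⋃ i ∈ l, V i) by
    simpa using H (List.finRange L) (fun _ => []) ∅ (Or.inl ⟨rfl, rfl⟩)
  intro l
  induction l with
  | nil => intro s V₀ h; simpa using h
  | cons i l ih =>
    intro s V₀ h
    have := ih _ _ (Sketch.listsMin_merge h (hb i))
    rw [List.foldl_cons]
    convert this using 1
    simp [Set.union_assoc]

/-- If all points of a nonempty set `B` collide with the query, and for at least half of the
lists the least hash value on `B` is at most `32 n³ / |B|`, then the estimate is at least
`|B| / 32`. It is at least `1` in any case. -/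
theorem le_estimateCollisions (hn : 2 ≤ n) (hΔ : 0 < Δ) (hK : K.t = 1) (B : Finset (Fin n))
    (hne : B.Nonempty) (hB : ∀ p ∈ B, ∃ i, f i (S p) = f i q)
    (hψ : 2 * (Finset.univ.filter fun w => ∀ p ∈ B,
      32 * n ^ 3 < ((ψ w p : ℕ) + 1) * B.card).card ≤ Δ) :
    1 ≤ (estimateCollisions K (lookup K (build K S f π ψ).val q).val).val ∧
      (B.card : ℚ) / 32 ≤
        (estimateCollisions K (lookup K (build K S f π ψ).val q).val).val := by
  have hn3 : (0 : ℚ) < (n : ℚ) ^ 3 := by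
    have : (0 : ℚ) < n := by exact_mod_cast (by omega : 0 < n)
    positivity
  set b := (lookup K (build K S f π ψ).val q).val with hbdef
  have hval : (estimateCollisions K b).val = (Sketch.estimate n 1
      (Timed.foldl (fun s i => Sketch.merge 1 s (b i).2) (fun _ => []) (List.finRange L)).val).val :=
    by rw [← hK]; rfl
  rw [hval]
  set s := (Timed.foldl (fun s i => Sketch.merge 1 s (b i).2) (fun _ => []) (List.finRange L)).val
  have hlist : ∀ w, ∀ p ∈ B, (n : ℚ) ^ 3 / ((ψ w p : ℕ) + 1 : ℕ) ≤
      Sketch.listEstimate n 1 (s w) := by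
    intro w p hp
    have := listsMin_foldl_merge b w
      (fun i => {v | ∃ p ∈ (b i).1.toList, (ψ w p : ℕ) + 1 = v}) (fun i => by
        rw [hbdef, lookup_sketch K S f π ψ q hn i, hK]
        exact Sketch.listsMin_ofPoints _ _ _)
    refine Sketch.le_listEstimate this ?_ (by simp)
    obtain ⟨i, hi⟩ := (mem_lookup K S f π ψ q p).2 (hB p hp)
    exact Set.mem_iUnion.2 ⟨i, p, hi, rfl⟩
  constructor
  · refine Sketch.le_estimate hΔ ?_
    rw [Finset.filter_false_of_mem]
    · simp
    · intro w _
      obtain ⟨p, hp⟩ := hne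
      refine not_lt.2 (le_trans ?_ (hlist w p hp))
      rw [le_div_iff₀ (by positivity), one_mul]
      exact_mod_cast (ψ w p).2
  · refine Sketch.le_estimate hΔ (le_trans ?_ hψ)
    refine Nat.mul_le_mul_left 2 (Finset.card_le_card fun w hw => ?_)
    simp only [Finset.mem_filter, Finset.mem_univ, true_and] at hw ⊢
    intro p hp
    have h1 := (hlist w p hp).trans_lt hw
    rw [div_lt_div_iff₀ (by positivity) (by norm_num)] at h1
    have h2 : n ^ 3 * 32 < B.card * ((ψ w p : ℕ) + 1) := by exact_mod_cast h1
    linarith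

end Lookup

/-! ### One round of the query algorithm -/

section Rounds

variable {X U : Type*} [MetricSpace X] {n L Δ : ℕ} (D : Index X U n L Δ) (q : X) (r : ℝ)
  (b : Fin L → Array (Fin n) × Sketch Δ) (lam : ℕ)

/-- The points collected in segment `h`. -/
abbrev collected (k h : ℕ) : Finset (Fin n) := (collect D q r b k h).val

/-- The probability to accept the points collected in segment `h`. -/
def acceptProb (k h : ℕ) : ℝ≥0 := min 1 (((collected D q r b k h).card : ℝ≥0) / lam)

/-- The probability that a round is not accepted. -/
def rejectProb (e : ℕ) : ℝ≥0∞ :=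
  mean (PMF.uniformOfFintype (Fin (2 ^ e))) fun h =>
    ((1 - acceptProb D q r b lam (2 ^ e) h : ℝ≥0) : ℝ≥0∞)

/-- The expectation of `g` over a uniform element of `s`, or its value at `⊥` if `s` is empty. -/
def meanOn (k : ℕ) (s : Finset (Fin n)) (g : Option (Fin n) × ℕ → ℝ≥0∞) : ℝ≥0∞ :=
  if s.Nonempty then (∑ p ∈ s, g (some p, k)) / s.card else g (none, k)

/-- A first step analysis of the rounds: either the first round is accepted and decides, or it is
rejected and the remaining rounds follow. -/
theorem expect_rounds_succ (e m : ℕ) (next : RandTimed (Option (Fin n) × ℕ))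
    (g : Option (Fin n) × ℕ → ℝ≥0∞) :
    (rounds D q r b lam e next (m + 1)).expect g =
      mean (PMF.uniformOfFintype (Fin (2 ^ e))) (fun h =>
        acceptProb D q r b lam (2 ^ e) h * meanOn (2 ^ e) (collected D q r b (2 ^ e) h) g) +
      rejectProb D q r b lam e * (rounds D q r b lam e next m).expect g := by
  rw [rejectProb, ← mean_mul_right, ← mean_add, rounds, RandTimed.expect_draw_bind]
  refine mean_congr _ fun h _ => ?_
  rw [RandTimed.expect_ofTimed_bind, RandTimed.expect_draw_bind, mean_coin]
  simp only [if_true, Bool.false_eq_true, if_false, acceptProb]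
  congr 2
  rw [meanOn]
  split_ifs with hs
  · rw [RandTimed.expect_draw_bind, mean_uniformOfFinset]
    simp [RandTimed.expect_ofTimed, Timed.pure]
  · simp [RandTimed.expect_ofTimed, Timed.pure]

theorem rejectProb_le_one (e : ℕ) : rejectProb D q r b lam e ≤ 1 := by
  refine (mean_mono _ (g' := fun _ => 1) fun h _ => ?_).trans (mean_const _ _).le
  exact_mod_cast tsub_le_self

variable {D q r b lam}

/-- Rounds in which a non-accepting outcome is certain to have `g = 0` only scale `g`. -/
theorem expect_rounds_of_vanish (e m : ℕ) (next : RandTimed (Option (Fin n) × ℕ))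
    {g : Option (Fin n) × ℕ → ℝ≥0∞}
    (hg : ∀ h : Fin (2 ^ e), acceptProb D q r b lam (2 ^ e) h *
      meanOn (2 ^ e) (collected D q r b (2 ^ e) h) g = 0) :
    (rounds D q r b lam e next m).expect g = rejectProb D q r b lam e ^ m * next.expect g := by
  induction m with
  | zero => simp [rounds]
  | succ m ih =>
    rw [expect_rounds_succ, mean_eq_zero _ fun h _ => hg h, ih, zero_add, pow_succ]
    ring

section Near

variable {N : Finset (Fin n)}
  (hN : ∀ k h p, p ∈ collected D q r b k h ↔ p ∈ N ∧ segment D.rank k p = h)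

include hN in
theorem sum_collected {k : ℕ} (hk : 0 < k) (g : Fin n → ℝ≥0∞) :
    ∑ h : Fin k, ∑ p ∈ collected D q r b k h, g p = ∑ p ∈ N, g p := by
  have h1 : ∀ h : Fin k, collected D q r b k h =
      N.filter fun p => (⟨segment D.rank k p, segment_lt D.rank hk p⟩ : Fin k) = h := by
    intro h
    ext p
    rw [hN, Finset.mem_filter, Fin.ext_iff]
  simp_rw [h1]
  exact Finset.sum_fiberwise _ _ _

variable (lam) in
/-- Each segment of the level `e` contains at most `lam` of the points that may be collected. -/
def Balanced (N : Finset (Fin n)) (rank : Fin n → Fin n) (e : ℕ) : Prop :=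
  ∀ h < 2 ^ e, (N.filter fun p => segment rank (2 ^ e) p = h).card ≤ lam

include hN in
theorem acceptProb_of_balanced {e : ℕ} (he : Balanced lam N D.rank e) (h : Fin (2 ^ e)) :
    (acceptProb D q r b lam (2 ^ e) h : ℝ≥0∞) =
      ((collected D q r b (2 ^ e) h).card : ℝ≥0∞) / lam := by
  have h1 : (collected D q r b (2 ^ e) h).card ≤ lam := by
    refine le_trans (Finset.card_le_card fun p hp => ?_) (he h h.2)
    rw [Finset.mem_filter]
    exact (hN _ _ _).1 hp
  rcases Nat.eq_zero_or_pos lam with h0 | h0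
  · have : (collected D q r b (2 ^ e) h).card = 0 := by omega
    simp [acceptProb, this]
  · rw [acceptProb, min_eq_right, ENNReal.coe_div (by exact_mod_cast h0.ne')]
    · simp
    · rw [div_le_one (by exact_mod_cast h0)]
      exact_mod_cast h1

include hN in
/-- In a balanced level, a round returns each point with the same probability. -/
theorem accept_of_balanced {e : ℕ} (he : Balanced lam N D.rank e)
    (g : Option (Fin n) × ℕ → ℝ≥0∞) :
    mean (PMF.uniformOfFintype (Fin (2 ^ e))) (fun h => acceptProb D q r b lam (2 ^ e) h *
      meanOn (2 ^ e) (collected D q r b (2 ^ e) h) g) =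
      (∑ p ∈ N, g (some p, 2 ^ e)) / lam / (2 ^ e : ℕ) := by
  rw [mean_uniformOfFintype, Fintype.card_fin, ← sum_collected hN (Nat.two_pow_pos e)]
  congr 1
  rw [ENNReal.div_eq_inv_mul, Finset.mul_sum]
  refine Finset.sum_congr rfl fun h _ => ?_
  rw [acceptProb_of_balanced hN he, meanOn]
  split_ifs with hs
  · have hc : ((collected D q r b (2 ^ e) h).card : ℝ≥0∞) ≠ 0 := by
      exact_mod_cast hs.card_pos.ne'
    simp only [ENNReal.div_eq_inv_mul]
    rw [mul_mul_mul_comm, mul_comm, mul_comm ((lam : ℝ≥0∞)⁻¹), mul_mul_mul_comm,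
      ENNReal.mul_inv_cancel hc (ENNReal.natCast_ne_top _), one_mul, mul_comm]
  · rw [Finset.not_nonempty_iff_eq_empty.1 hs]; simp

include hN in
theorem rejectProb_add {e : ℕ} (he : Balanced lam N D.rank e) :
    rejectProb D q r b lam e + (N.card : ℝ≥0∞) / lam / (2 ^ e : ℕ) = 1 := by
  have h1 := accept_of_balanced hN he fun _ => 1
  simp only [Finset.sum_const, nsmul_eq_mul, mul_one] at h1
  rw [← h1, rejectProb, ← mean_add]
  refine (mean_congr _ fun h _ => ?_).trans (mean_const _ 1)
  have h2 : meanOn (2 ^ e) (collected D q r b (2 ^ e) h) (fun _ => 1) = 1 := by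
    rw [meanOn]
    split_ifs with hs
    · rw [Finset.sum_const, nsmul_eq_mul, mul_one]
      exact ENNReal.div_self (by exact_mod_cast hs.card_pos.ne') (by simp)
    · rfl
  have h3 : acceptProb D q r b lam (2 ^ e) h ≤ 1 := min_le_left _ _
  rw [h2, mul_one, ← ENNReal.coe_add, tsub_add_cancel_of_le h3, ENNReal.coe_one]

include hN in
/-- If all the levels in which `g` or `g'` does not vanish are balanced, and there `g` and `g'`
have the same sum over the points that may be collected, then their expectations agree. -/
theorem expect_search_congr (sig : ℕ) {g g' : Option (Fin n) × ℕ → ℝ≥0∞}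
    (h0 : ∀ k, g (none, k) = 0) (h0' : ∀ k, g' (none, k) = 0)
    (h : ∀ e, ((∀ p, g (some p, 2 ^ e) = 0) ∧ ∀ p, g' (some p, 2 ^ e) = 0) ∨
      (Balanced lam N D.rank e ∧ ∑ p ∈ N, g (some p, 2 ^ e) = ∑ p ∈ N, g' (some p, 2 ^ e)))
    (e : ℕ) : (search D q r b lam sig e).expect g = (search D q r b lam sig e).expect g' := by
  induction e with
  | zero => simp [search, RandTimed.expect_ofTimed, Timed.pure, Timed.charge, h0, h0']
  | succ e ih =>
    rw [search]
    generalize sig = m at *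
    have hnext : ((RandTimed.ofTimed (.charge 1 (.pure ()))).bind fun _ =>
        search D q r b lam m e).expect g = ((RandTimed.ofTimed (.charge 1 (.pure ()))).bind fun _ =>
        search D q r b lam m e).expect g' := by
      rw [RandTimed.expect_ofTimed_bind, RandTimed.expect_ofTimed_bind, ih]
    generalize ((RandTimed.ofTimed (.charge 1 (.pure ()))).bind fun _ =>
        search D q r b lam m e) = next at hnext
    clear ih
    induction m with
    | zero => exact hnext
    | succ m ihm =>
      rw [expect_rounds_succ, expect_rounds_succ, ihm]
      congr 1
      rcases h (e + 1) with ⟨hg, hg'⟩ | ⟨hb, hsum⟩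
      · refine mean_congr _ fun x _ => ?_
        simp [meanOn, hg, hg', h0, h0']
      · rw [accept_of_balanced hN hb, accept_of_balanced hN hb, hsum]

include hN in
/-- Only points of `N` are returned. -/
theorem expect_search_eq_zero (sig : ℕ) {g : Option (Fin n) × ℕ → ℝ≥0∞}
    (h0 : ∀ k, g (none, k) = 0) (h : ∀ p ∈ N, ∀ k, g (some p, k) = 0) (e : ℕ) :
    (search D q r b lam sig e).expect g = 0 := by
  induction e with
  | zero => simp [search, RandTimed.expect_ofTimed, Timed.pure, Timed.charge, h0]
  | succ e ih =>
    rw [search, expect_rounds_of_vanish, RandTimed.expect_ofTimed_bind, ih, mul_zero]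
    intro x
    rw [meanOn]
    split_ifs
    · rw [Finset.sum_eq_zero fun p hp => h p ((hN _ _ _).1 hp).1 _]; simp
    · simp [h0]

/-- An empty set is never accepted, so the value of `g` at `⊥` does not matter. -/
theorem accept_mul_meanOn_eq_zero {k h : ℕ} {g : Option (Fin n) × ℕ → ℝ≥0∞}
    (hg : ∀ p, g (some p, k) = 0) : (acceptProb D q r b lam k h : ℝ≥0∞) *
      meanOn k (collected D q r b k h) g = 0 := by
  rw [meanOn]
  split_ifs with hs
  · simp [hg]
  · rw [Finset.not_nonempty_iff_eq_empty] at hs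
    simp [acceptProb, hs]

/-- The probability not to succeed in the levels in which `g` vanishes on all points. -/
theorem expect_search_le (sig : ℕ) {g : Option (Fin n) × ℕ → ℝ≥0∞} (hg1 : ∀ x, g x ≤ 1)
    {e₀ : ℕ} (h0 : 0 < e₀) (hg : ∀ e ≥ e₀, ∀ p, g (some p, 2 ^ e) = 0) {e : ℕ} (he : e₀ ≤ e) :
    (search D q r b lam sig e).expect g ≤ rejectProb D q r b lam e₀ ^ sig := by
  induction e, he using Nat.le_induction with
  | base =>
    obtain ⟨e, rfl⟩ := Nat.exists_eq_succ_of_ne_zero h0.ne'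
    rw [search, expect_rounds_of_vanish _ _ _ fun h => accept_mul_meanOn_eq_zero (hg _ le_rfl)]
    refine mul_le_of_le_one_right' ?_
    exact (mean_mono _ fun a _ => hg1 _).trans (mean_const _ 1).le
  | succ e he ih =>
    rw [search, expect_rounds_of_vanish _ _ _
      fun h => accept_mul_meanOn_eq_zero (hg _ (he.trans e.le_succ)),
      RandTimed.expect_ofTimed_bind]
    exact (mul_le_of_le_one_left' (pow_le_one' (rejectProb_le_one ..) _)).trans ih

end Near

/-! ### The expected number of operations of the search -/

/-- A bound for the expected number of operations of a round with `2 ^ e` segments. -/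
def roundCost (b : Fin L → Array (Fin n) × Sketch Δ) (e : ℕ) : ℝ≥0∞ :=
  (L * (3 * lg n + 7) + 3 : ℕ) + 5 * (totalSize b : ℝ≥0∞) / (2 ^ e : ℕ)

theorem cost_rounds_succ_le (hn : 2 ≤ n) (hb : SortedBuckets D.rank b) (e m : ℕ)
    (next : RandTimed (Option (Fin n) × ℕ)) :
    (rounds D q r b lam e next (m + 1)).cost ≤
      roundCost b e + rejectProb D q r b lam e * (rounds D q r b lam e next m).cost := by
  have h1 : mean (PMF.uniformOfFintype (Fin (2 ^ e)))
      (fun h => 5 * (segmentSize D.rank b (2 ^ e) h : ℝ≥0∞)) =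
      5 * (totalSize b : ℝ≥0∞) / (2 ^ e : ℕ) := by
    rw [mean_uniformOfFintype, ← Finset.mul_sum, Fintype.card_fin,
      ← sum_segmentSize D.rank b (Nat.two_pow_pos e)]
    push_cast
    rfl
  rw [roundCost, ← h1, rejectProb, ← mean_mul_right, ← mean_const
    (PMF.uniformOfFintype (Fin (2 ^ e))) ((L * (3 * lg n + 7) + 3 : ℕ) : ℝ≥0∞), ← mean_add,
    ← mean_add, rounds, RandTimed.cost_draw_bind, ← mean_const
    (PMF.uniformOfFintype (Fin (2 ^ e))) 1, ← mean_add]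
  refine mean_mono _ fun h _ => ?_
  rw [RandTimed.cost_ofTimed_bind, RandTimed.cost_draw_bind, mean_coin]
  simp only [if_true, Bool.false_eq_true, if_false, acceptProb]
  have h2 : ∀ s : Finset (Fin n), (if hs : s.Nonempty then
        RandTimed.bind (.draw (PMF.uniformOfFinset s hs)) fun p =>
          .ofTimed (.pure (some p, 2 ^ e))
      else RandTimed.ofTimed (.pure (none, 2 ^ e))).cost ≤ 1 := by
    intro s
    split_ifs with hs
    · rw [RandTimed.cost_draw_bind]
      simp [RandTimed.cost_ofTimed, Timed.pure, mean_const]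
    · simp [RandTimed.cost_ofTimed, Timed.pure]
  have h3 := collect_time_le D q r hn hb (2 ^ e) h
  have h4 : ((collect D q r b (2 ^ e) h).time : ℝ≥0∞) ≤
      (L * (3 * lg n + 7) : ℕ) + 5 * (segmentSize D.rank b (2 ^ e) h : ℝ≥0∞) := by
    exact_mod_cast h3
  have h5 : ((min 1 (((collected D q r b (2 ^ e) h).card : ℝ≥0) / lam) : ℝ≥0) : ℝ≥0∞) ≤ 1 := by
    exact_mod_cast min_le_left _ _
  have h6 := mul_le_mul' h5 (h2 (collected D q r b (2 ^ e) h))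
  rw [mul_one] at h6
  refine (add_le_add_right (add_le_add h4 (add_le_add_right (add_le_add_left h6 _) _)) _).trans
    (le_of_eq ?_)
  push_cast
  ring

theorem cost_rounds_le (hn : 2 ≤ n) (hb : SortedBuckets D.rank b) (e m : ℕ)
    (next : RandTimed (Option (Fin n) × ℕ)) :
    (rounds D q r b lam e next m).cost ≤
      m * roundCost b e + rejectProb D q r b lam e ^ m * next.cost := by
  induction m with
  | zero => simp [rounds]
  | succ m ih =>
    refine (cost_rounds_succ_le hn hb e m next).trans ?_
    refine (add_le_add_right (mul_le_mul_right ih _) _).trans ?_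
    have h1 : rejectProb D q r b lam e * (m * roundCost b e) ≤ m * roundCost b e :=
      mul_le_of_le_one_left' (rejectProb_le_one ..)
    rw [mul_add, ← mul_assoc _ (_ ^ m), ← pow_succ', Nat.cast_succ, add_mul, one_mul,
      ← add_assoc, add_comm (roundCost b e)]
    exact add_le_add_left (add_le_add_left h1 _) _

theorem cost_search_succ_le (hn : 2 ≤ n) (hb : SortedBuckets D.rank b) (sig e : ℕ) :
    (search D q r b lam sig (e + 1)).cost ≤ sig * roundCost b (e + 1) +
      rejectProb D q r b lam (e + 1) ^ sig * (1 + (search D q r b lam sig e).cost) := by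
  rw [search]
  refine (cost_rounds_le hn hb _ _ _).trans (le_of_eq ?_)
  rw [RandTimed.cost_ofTimed_bind]
  simp [Timed.charge, Timed.pure]

theorem cost_search_zero (sig : ℕ) : (search D q r b lam sig 0).cost = 1 := by
  simp [search, RandTimed.cost_ofTimed, Timed.charge, Timed.pure]

/-- The bound for the search that holds in any case. -/
theorem cost_search_le (hn : 2 ≤ n) (hb : SortedBuckets D.rank b) (sig e : ℕ) :
    (search D q r b lam sig e).cost ≤ (e + 1) * (sig * roundCost b 0 + 1) := by
  induction e with
  | zero => rw [cost_search_zero]; simp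
  | succ e ih =>
    refine (cost_search_succ_le hn hb _ _).trans ?_
    have h1 : roundCost b (e + 1) ≤ roundCost b 0 := by
      refine add_le_add_right (ENNReal.div_le_div_left ?_ _) _
      exact_mod_cast Nat.pow_le_pow_right two_pos (Nat.zero_le _)
    have h2 : rejectProb D q r b lam (e + 1) ^ sig * (1 + (search D q r b lam sig e).cost) ≤
        1 + (e + 1) * (sig * roundCost b 0 + 1) :=
      (mul_le_of_le_one_left' (pow_le_one' (rejectProb_le_one ..) _)).trans
        (add_le_add_right ih _)
    refine (add_le_add (mul_le_mul_right h1 _) h2).trans (le_of_eq ?_)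
    push_cast
    ring

/-- If level `e₀` is likely to succeed, then the levels below `e₀` contribute little. -/
theorem cost_search_le_of_le (hn : 2 ≤ n) (hb : SortedBuckets D.rank b) (sig : ℕ) {e₀ e : ℕ}
    (h0 : 0 < e₀) (he : e₀ ≤ e) :
    (search D q r b lam sig e).cost ≤ (e + 1) * (sig * roundCost b e₀ + 1) +
      rejectProb D q r b lam e₀ ^ sig * ((e₀ + 1) * (sig * roundCost b 0 + 1)) := by
  induction e, he using Nat.le_induction with
  | base =>
    obtain ⟨e, rfl⟩ := Nat.exists_eq_succ_of_ne_zero h0.ne'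
    refine (cost_search_succ_le hn hb _ _).trans ?_
    refine add_le_add ?_ (mul_le_mul_right ?_ _)
    · refine le_trans le_self_add (le_mul_of_one_le_left' ?_)
      exact le_add_self
    · refine (add_le_add_right (cost_search_le hn hb _ _) _).trans ?_
      calc (1 : ℝ≥0∞) + (e + 1) * (sig * roundCost b 0 + 1)
          ≤ (sig * roundCost b 0 + 1) + (e + 1) * (sig * roundCost b 0 + 1) :=
            add_le_add_left le_add_self _
        _ = _ := by push_cast; ring
  | succ e he ih =>
    refine (cost_search_succ_le hn hb _ _).trans ?_
    have h1 : roundCost b (e + 1) ≤ roundCost b e₀ := by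
      refine add_le_add_right (ENNReal.div_le_div_left ?_ _) _
      exact_mod_cast Nat.pow_le_pow_right two_pos (by omega)
    refine (add_le_add (mul_le_mul_right h1 _) ((mul_le_of_le_one_left'
      (pow_le_one' (rejectProb_le_one ..) _)).trans (add_le_add_right ih _))).trans (le_of_eq ?_)
    push_cast
    ring

end Rounds

/-! ### Queries -/

section Query

variable {X U : Type*} [MetricSpace X] {n L Δ : ℕ} (K : Constants) (D : Index X U n L Δ) (r : ℝ)
  (q : X)

/-- The logarithm of the initial number of segments. -/
def startLevel : ℕ := Nat.clog 2 ⌈2 * (estimateCollisions K (lookup K D q).val).val⌉₊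

theorem mean_query (g : Option (Fin n) × ℕ → ℝ≥0∞) :
    mean (query K D r q) (fun a => g (a.out, a.segments)) =
      (search D q r (lookup K D q).val (K.cl * lg n) (K.cσ * lg n ^ 2)
        (startLevel K D q)).expect g := by
  rw [query, mean_map]
  change RandTimed.expect _ g = _
  rw [RandTimed.expect_ofTimed_bind, RandTimed.expect_ofTimed_bind, RandTimed.expect_ofTimed_bind]
  rfl

theorem mean_query_time :
    mean (query K D r q) (fun a => (a.time : ℝ≥0∞)) =
      (lookup K D q).time + ((estimateCollisions K (lookup K D q).val).time +
        ((startLevel K D q + 1 : ℕ) + (search D q r (lookup K D q).val (K.cl * lg n)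
          (K.cσ * lg n ^ 2) (startLevel K D q)).cost)) := by
  rw [query, mean_map]
  change RandTimed.cost _ = _
  rw [RandTimed.cost_ofTimed_bind, RandTimed.cost_ofTimed_bind, RandTimed.cost_ofTimed_bind]
  rfl

end Query

/-! ### Random permutations -/

section Perm

variable {n : ℕ}

/-- The permutations that map `W` into `I`. -/
def permsInto (W I : Finset (Fin n)) : Finset (Equiv.Perm (Fin n)) :=
  Finset.univ.filter fun π => ∀ p ∈ W, π p ∈ I

theorem card_permsInto_insert_eq (W I : Finset (Fin n)) {w w' : Fin n} (hw : w ∉ W)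
    (hw' : w' ∉ W) : (permsInto (insert w W) I).card = (permsInto (insert w' W) I).card := by
  refine Finset.card_equiv (Equiv.mulRight (Equiv.swap w w')) fun π => ?_
  have hfix : ∀ p ∈ W, Equiv.swap w w' p = p := fun p hp =>
    Equiv.swap_apply_of_ne_of_ne (fun h => hw (h ▸ hp)) (fun h => hw' (h ▸ hp))
  simp only [permsInto, Finset.mem_filter, Finset.mem_univ, true_and, Finset.forall_mem_insert,
    Equiv.coe_mulRight, Equiv.Perm.mul_apply, Equiv.swap_apply_right]
  refine and_congr_right fun _ => forall₂_congr fun p hp => ?_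
  rw [hfix p hp]

/-- Double counting of the pairs of a permutation in `permsInto W I` and a further point that it
maps into `I`. -/
theorem card_permsInto_insert (W I : Finset (Fin n)) {w : Fin n} (hw : w ∉ W) :
    (n - W.card) * (permsInto (insert w W) I).card =
      (permsInto W I).card * (I.card - W.card) := by
  have h1 : ∑ w' ∈ Wᶜ, (permsInto (insert w' W) I).card =
      (n - W.card) * (permsInto (insert w W) I).card := by
    rw [Finset.sum_congr rfl fun w' hw' =>
      card_permsInto_insert_eq W I (Finset.mem_compl.1 hw') hw]
    simp [Finset.card_compl]
  have h2 : ∑ w' ∈ Wᶜ, (permsInto (insert w' W) I).card =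
      ∑ π ∈ permsInto W I, (Wᶜ.filter fun w' => π w' ∈ I).card := by
    simp_rw [Finset.card_eq_sum_ones, Finset.sum_filter]
    rw [Finset.sum_comm]
    refine Finset.sum_congr rfl fun w' _ => ?_
    rw [← Finset.sum_filter]
    refine Finset.sum_congr ?_ fun _ _ => rfl
    ext π
    simp [permsInto, and_comm]
  have h3 : ∀ π ∈ permsInto W I, (Wᶜ.filter fun w' => π w' ∈ I).card = I.card - W.card := by
    intro π hπ
    simp only [permsInto, Finset.mem_filter, Finset.mem_univ, true_and] at hπ
    have : (Wᶜ.filter fun w' => π w' ∈ I).map π.toEmbedding = I \ W.map π.toEmbedding := by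
      ext x
      simp only [Finset.mem_map_equiv, Finset.mem_filter, Finset.mem_compl, Finset.mem_sdiff,
        Equiv.apply_symm_apply]
      tauto
    rw [← Finset.card_map π.toEmbedding, this, Finset.card_sdiff_of_subset, Finset.card_map]
    intro x hx
    obtain ⟨p, hp, rfl⟩ := Finset.mem_map.1 hx
    exact hπ p hp
  rw [← h1, h2, Finset.sum_congr rfl h3, Finset.sum_const, smul_eq_mul]

theorem card_permsInto_le (W I : Finset (Fin n)) :
    (permsInto W I).card * n ^ W.card ≤ n.factorial * I.card ^ W.card := by
  induction W using Finset.induction_on with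
  | empty => simp [permsInto, Finset.card_univ, Fintype.card_perm]
  | insert w W hw ih =>
    rw [Finset.card_insert_of_notMem hw, pow_succ, pow_succ]
    have h := card_permsInto_insert W I hw
    have hWn : W.card < n := by
      have := Finset.card_lt_univ_of_notMem hw
      rwa [Fintype.card_fin] at this
    have hIn : I.card ≤ n := by simpa using I.card_le_univ
    have key : (permsInto (insert w W) I).card * n ≤ (permsInto W I).card * I.card := by
      rcases Nat.lt_or_ge I.card W.card with hlt | hge
      · rw [Nat.sub_eq_zero_of_le hlt.le, mul_zero, mul_eq_zero] at h
        rcases h with h | h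
        · omega
        · rw [h]; simp
      · refine Nat.le_of_mul_le_mul_left (c := n - W.card) ?_ (by omega)
        obtain ⟨x, hx⟩ := Nat.exists_eq_add_of_le hge
        obtain ⟨y, hy⟩ := Nat.exists_eq_add_of_le hWn.le
        rw [← mul_assoc, h]
        have e1 : I.card - W.card = x := by omega
        have e2 : n - W.card = y := by omega
        rw [e1, e2]
        have hxy : x ≤ y := by omega
        have : x * n ≤ y * I.card := by rw [hx]; nlinarith
        nlinarith [Nat.mul_le_mul_left (permsInto W I).card this]
    calc (permsInto (insert w W) I).card * (n ^ W.card * n)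
        = ((permsInto (insert w W) I).card * n) * n ^ W.card := by ring
      _ ≤ ((permsInto W I).card * I.card) * n ^ W.card := Nat.mul_le_mul_right _ key
      _ = ((permsInto W I).card * n ^ W.card) * I.card := by ring
      _ ≤ (n.factorial * I.card ^ W.card) * I.card := Nat.mul_le_mul_right _ ih
      _ = _ := by ring

/-- The uniform distribution on permutations. -/
abbrev permMeasure (n : ℕ) : Measure (Equiv.Perm (Fin n)) :=
  (PMF.uniformOfFintype (Equiv.Perm (Fin n))).toMeasure

theorem permMeasure_real_le (hn : 0 < n) (W I : Finset (Fin n)) :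
    (permMeasure n).real {π | ∀ p ∈ W, π p ∈ I} ≤ ((I.card : ℝ) / n) ^ W.card := by
  classical
  have hset : {π : Equiv.Perm (Fin n) | ∀ p ∈ W, π p ∈ I} = ↑(permsInto W I) := by
    ext π; simp [permsInto]
  have hn' : (0 : ℝ) < n := by exact_mod_cast hn
  rw [Measure.real, hset, PMF.toMeasure_uniformOfFintype_apply, ENNReal.toReal_div,
    div_pow, div_le_div_iff₀ _ (by positivity)]
  · have := card_permsInto_le W I
    simp only [ENNReal.toReal_natCast, Finset.coe_sort_coe, Fintype.card_coe, Fintype.card_perm,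
      Fintype.card_fin]
    rw [mul_comm ((I.card : ℝ) ^ W.card)]
    exact_mod_cast this
  · simp only [ENNReal.toReal_natCast, Fintype.card_perm]
    exact_mod_cast Nat.factorial_pos _
  · trivial

/-- A set `I` that expects at most `64` points of `N` rarely receives more than `lam` of them: a
union bound over the subsets of `N` with `lam + 1` elements, and `x ^ m / m! ≤ exp x`. -/
theorem permMeasure_overload_le (hn : 0 < n) (N I : Finset (Fin n)) (lam : ℕ)
    (h : N.card * I.card ≤ 64 * n) :
    (permMeasure n).real {π | lam < (N.filter fun p => π p ∈ I).card} ≤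
      Real.exp 128 * (1 / 2) ^ (lam + 1) := by
  have hn' : (0 : ℝ) < n := by exact_mod_cast hn
  have hsub : {π : Equiv.Perm (Fin n) | lam < (N.filter fun p => π p ∈ I).card} ⊆
      ⋃ W ∈ N.powersetCard (lam + 1), {π | ∀ p ∈ W, π p ∈ I} := by
    intro π hπ
    obtain ⟨W, hW, hcard⟩ := Finset.exists_subset_card_eq (Nat.succ_le_of_lt hπ)
    simp only [Set.mem_iUnion, Finset.mem_powersetCard]
    exact ⟨W, ⟨hW.trans (Finset.filter_subset _ _), hcard⟩,
      fun p hp => (Finset.mem_filter.1 (hW hp)).2⟩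
  calc (permMeasure n).real {π | lam < (N.filter fun p => π p ∈ I).card}
      ≤ (permMeasure n).real (⋃ W ∈ N.powersetCard (lam + 1), {π | ∀ p ∈ W, π p ∈ I}) :=
        measureReal_mono hsub (measure_ne_top _ _)
    _ ≤ ∑ W ∈ N.powersetCard (lam + 1), (permMeasure n).real {π | ∀ p ∈ W, π p ∈ I} :=
        measureReal_biUnion_finset_le _ _
    _ ≤ ∑ W ∈ N.powersetCard (lam + 1), ((I.card : ℝ) / n) ^ (lam + 1) := by
        refine Finset.sum_le_sum fun W hW => ?_
        rw [← (Finset.mem_powersetCard.1 hW).2]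
        exact permMeasure_real_le hn W I
    _ = (N.card.choose (lam + 1) : ℝ) * ((I.card : ℝ) / n) ^ (lam + 1) := by
        rw [Finset.sum_const, Finset.card_powersetCard, nsmul_eq_mul]
    _ ≤ ((N.card : ℝ) ^ (lam + 1) / (lam + 1).factorial) * ((I.card : ℝ) / n) ^ (lam + 1) := by
        gcongr
        exact Nat.choose_le_pow_div _ _
    _ = ((N.card : ℝ) * I.card / n) ^ (lam + 1) / (lam + 1).factorial := by
        rw [div_pow, div_pow, mul_pow]; ring
    _ ≤ 64 ^ (lam + 1) / (lam + 1).factorial := by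
        gcongr
        rw [div_le_iff₀ hn']
        exact_mod_cast h
    _ = (128 ^ (lam + 1) / (lam + 1).factorial) * (1 / 2) ^ (lam + 1) := by
        rw [div_mul_eq_mul_div, ← mul_pow]; norm_num
    _ ≤ Real.exp 128 * (1 / 2) ^ (lam + 1) := by
        gcongr
        exact Real.pow_div_factorial_le_exp _ (by norm_num) _

/-- A segment contains at most `⌊n / k⌋ + 1` ranks. -/
theorem card_segment_le {k : ℕ} (hk : 0 < k) (h : ℕ) :
    (Finset.univ.filter fun ϱ : Fin n => (ϱ : ℕ) * k / n = h).card ≤ n / k + 1 := by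
  rcases (Finset.univ.filter fun ϱ : Fin n => (ϱ : ℕ) * k / n = h).eq_empty_or_nonempty with
    h0 | h0
  · rw [h0]; simp
  · set I := Finset.univ.filter fun ϱ : Fin n => (ϱ : ℕ) * k / n = h
    set a := I.min' h0
    have hmem : ∀ ϱ ∈ I, h * n ≤ (ϱ : ℕ) * k ∧ (ϱ : ℕ) * k < (h + 1) * n := by
      intro ϱ hϱ
      exact (segment_eq_iff id k h ϱ).1 (Finset.mem_filter.1 hϱ).2
    have ha := hmem a (I.min'_mem h0)
    have hsub : I.map Fin.valEmbedding ⊆ Finset.Ico (a : ℕ) (a + (n / k + 1)) := by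
      intro x hx
      obtain ⟨ϱ, hϱ, rfl⟩ := Finset.mem_map.1 hx
      have h1 : a ≤ ϱ := I.min'_le ϱ hϱ
      have h2 := (hmem ϱ hϱ).2
      simp only [Fin.valEmbedding_apply, Finset.mem_Ico]
      refine ⟨h1, ?_⟩
      obtain ⟨d, hd⟩ := Nat.exists_eq_add_of_le (Fin.le_def.1 h1)
      have h3 : d * k ≤ n := by rw [hd] at h2; nlinarith [ha.1]
      have := (Nat.le_div_iff_mul_le hk).2 h3
      omega
    have := Finset.card_le_card hsub
    simpa using this

/-- The permutations for which all segments of all levels with at least `|N| / 32` segments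
contain at most `lam` points of `N`. -/
def goodPerms (lam : ℕ) (N : Finset (Fin n)) : Set (Equiv.Perm (Fin n)) :=
  {π | ∀ e, N.card ≤ 32 * 2 ^ e → Balanced lam N π e}

theorem permMeasure_compl_goodPerms_le (hn : 2 ≤ n) {lam : ℕ} (hlam : 0 < lam)
    (N : Finset (Fin n)) :
    (permMeasure n).real (goodPerms lam N)ᶜ ≤ n ^ 2 * (Real.exp 128 * (1 / 2) ^ (lam + 1)) := by
  classical
  set I : ℕ → ℕ → Finset (Fin n) :=
    fun e h => Finset.univ.filter fun ϱ : Fin n => (ϱ : ℕ) * 2 ^ e / n = h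
  set J : Finset ℕ := (Finset.range n).filter fun e => 2 ^ e ≤ n ∧ N.card ≤ 32 * 2 ^ e
  have hsub : (goodPerms lam N)ᶜ ⊆ ⋃ e ∈ J, ⋃ h ∈ Finset.range n,
      {π : Equiv.Perm (Fin n) | lam < (N.filter fun p => π p ∈ I e h).card} := by
    intro π hπ
    simp only [goodPerms, Set.mem_compl_iff, Set.mem_ofPred_eq, Balanced, not_forall,
      not_le] at hπ
    obtain ⟨e, he, h, hh, hlt⟩ := hπ
    have hfil : (N.filter fun p => segment (⇑π) (2 ^ e) p = h) =
        N.filter fun p => π p ∈ I e h := by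
      ext p
      rw [Finset.mem_filter, Finset.mem_filter]
      simp [segment, I]
    rw [hfil] at hlt
    -- a level with more than `n` segments has at most one rank in each segment
    have hle : 2 ^ e ≤ n := by
      by_contra! hgt
      have h1 : (N.filter fun p => π p ∈ I e h).card ≤ (I e h).card :=
        Finset.card_le_card_of_injOn π (fun p hp => (Finset.mem_filter.1 hp).2)
          π.injective.injOn
      have h2 : (I e h).card ≤ n / 2 ^ e + 1 := card_segment_le (Nat.two_pow_pos e) h
      rw [Nat.div_eq_of_lt hgt] at h2
      omega
    simp only [Set.mem_iUnion, Set.mem_ofPred_eq]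
    refine ⟨e, ?_, h, Finset.mem_range.2 (hh.trans_le hle), hlt⟩
    exact Finset.mem_filter.2 ⟨Finset.mem_range.2 (Nat.lt_two_pow_self.trans_le hle), hle, he⟩
  have hbound : ∀ e ∈ J, ∀ h, (permMeasure n).real
      {π : Equiv.Perm (Fin n) | lam < (N.filter fun p => π p ∈ I e h).card} ≤
        Real.exp 128 * (1 / 2) ^ (lam + 1) := by
    intro e he h
    obtain ⟨-, hle, hN⟩ := Finset.mem_filter.1 he
    refine permMeasure_overload_le (by omega) N _ lam ?_
    have h2 : (I e h).card ≤ n / 2 ^ e + 1 := card_segment_le (Nat.two_pow_pos e) h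
    have h3 : 2 ^ e * (n / 2 ^ e) ≤ n := Nat.mul_div_le n _
    calc N.card * (I e h).card ≤ (32 * 2 ^ e) * (n / 2 ^ e + 1) := Nat.mul_le_mul hN h2
      _ = 32 * (2 ^ e * (n / 2 ^ e)) + 32 * 2 ^ e := by ring
      _ ≤ 64 * n := by omega
  calc (permMeasure n).real (goodPerms lam N)ᶜ
      ≤ _ := measureReal_mono hsub (measure_ne_top _ _)
    _ ≤ ∑ e ∈ J, (permMeasure n).real (⋃ h ∈ Finset.range n,
        {π : Equiv.Perm (Fin n) | lam < (N.filter fun p => π p ∈ I e h).card}) :=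
        measureReal_biUnion_finset_le _ _
    _ ≤ ∑ e ∈ J, ∑ h ∈ Finset.range n, (permMeasure n).real
        {π : Equiv.Perm (Fin n) | lam < (N.filter fun p => π p ∈ I e h).card} :=
        Finset.sum_le_sum fun e _ => measureReal_biUnion_finset_le _ _
    _ ≤ ∑ e ∈ J, ∑ h ∈ Finset.range n, Real.exp 128 * (1 / 2) ^ (lam + 1) :=
        Finset.sum_le_sum fun e he => Finset.sum_le_sum fun h _ => hbound e he h
    _ = J.card * (n * (Real.exp 128 * (1 / 2) ^ (lam + 1))) := by simp
    _ ≤ n * (n * (Real.exp 128 * (1 / 2) ^ (lam + 1))) := by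
        gcongr
        simpa using Finset.card_filter_le (Finset.range n)
          fun e => 2 ^ e ≤ n ∧ N.card ≤ 32 * 2 ^ e
    _ = _ := by ring

end Perm

/-! ### Pairwise independent hash functions -/

section Pairwise

variable {n : ℕ} {law : PMF (Fin n → Fin (n ^ 3))}

theorem PairwiseIndep.pair (hlaw : PairwiseIndep law) {i j : Fin n} (hij : i ≠ j)
    (A A' : Finset (Fin (n ^ 3))) :
    ∑ f, (law f).toReal * (if f i ∈ A ∧ f j ∈ A' then 1 else 0) =
      (A.card : ℝ) * A'.card / ((n : ℝ) ^ 3) ^ 2 := by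
  have h1 : ∀ a b, ∑ f, (law f).toReal * (if f i = a ∧ f j = b then 1 else 0) =
      (((n : ℝ) ^ 3) ^ 2)⁻¹ := by
    intro a b
    have h := congrArg ENNReal.toReal (hlaw i j hij a b)
    rw [PMF.toOuterMeasure_apply_fintype, ENNReal.toReal_sum] at h
    · rw [ENNReal.toReal_pow, ENNReal.toReal_inv, ENNReal.toReal_natCast] at h
      push_cast at h
      rw [← inv_pow, ← h]
      refine Finset.sum_congr rfl fun f _ => ?_
      by_cases hf : f i = a ∧ f j = b <;> simp [Set.indicator, hf]
    · intro f _
      by_cases hf : f i = a ∧ f j = b <;> simp [Set.indicator, hf, PMF.apply_ne_top]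
  have h2 : ∀ f : Fin n → Fin (n ^ 3), (if f i ∈ A ∧ f j ∈ A' then (1 : ℝ) else 0) =
      ∑ a ∈ A, ∑ b ∈ A', if f i = a ∧ f j = b then 1 else 0 := by
    intro f
    simp_rw [ite_and]
    simp
  simp_rw [h2, Finset.mul_sum]
  rw [Finset.sum_comm]
  simp_rw [Finset.sum_comm (s := Finset.univ), h1]
  simp
  ring

theorem PairwiseIndep.single (hlaw : PairwiseIndep law) (hn : 2 ≤ n) (i : Fin n)
    (A : Finset (Fin (n ^ 3))) :
    ∑ f, (law f).toReal * (if f i ∈ A then 1 else 0) = (A.card : ℝ) / (n : ℝ) ^ 3 := by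
  have : Nontrivial (Fin n) := Fin.nontrivial_iff_two_le.2 hn
  obtain ⟨j, hj⟩ := exists_ne i
  have := hlaw.pair hj.symm A Finset.univ
  simp only [Finset.mem_univ, and_true, Finset.card_univ, Fintype.card_fin] at this
  rw [this]
  have hn' : (0 : ℝ) < n := by exact_mod_cast (by omega : 0 < n)
  push_cast
  field_simp

theorem sum_law_eq_one (law : PMF (Fin n → Fin (n ^ 3))) : ∑ f, (law f).toReal = 1 := by
  rw [← ENNReal.toReal_sum fun f _ => law.apply_ne_top f,
    ← tsum_fintype (L := .unconditional _), law.tsum_coe, ENNReal.toReal_one]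

/-- Chebyshev's inequality for the number of points of `N` with a hash value in `A`. -/
theorem PairwiseIndep.avoid_le (hlaw : PairwiseIndep law) (hn : 2 ≤ n) (N : Finset (Fin n))
    (A : Finset (Fin (n ^ 3))) :
    (∑ f, (law f).toReal * (if ∀ p ∈ N, f p ∉ A then 1 else 0)) *
      ((N.card : ℝ) * (A.card / (n : ℝ) ^ 3)) ≤ 1 := by
  classical
  set x : ℝ := (A.card : ℝ) / (n : ℝ) ^ 3 with hx
  set m : ℝ := (N.card : ℝ) with hm
  have hx0 : 0 ≤ x := by positivity
  have hm0 : 0 ≤ m := by positivity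
  set Z : (Fin n → Fin (n ^ 3)) → ℝ := fun f => ∑ p ∈ N, if f p ∈ A then 1 else 0
  have hZ : ∑ f, (law f).toReal * Z f = m * x := by
    simp only [Z, Finset.mul_sum]
    rw [Finset.sum_comm]
    simp_rw [hlaw.single hn]
    simp [hm, hx]
  have hZ2 : ∑ f, (law f).toReal * Z f ^ 2 ≤ m * x + m ^ 2 * x ^ 2 := by
    have h1 : ∀ f, Z f ^ 2 = ∑ p ∈ N, ∑ p' ∈ N, if f p ∈ A ∧ f p' ∈ A then 1 else 0 := by
      intro f
      simp only [Z, sq]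
      rw [Finset.sum_mul_sum]
      refine Finset.sum_congr rfl fun p _ => Finset.sum_congr rfl fun p' _ => ?_
      by_cases h : f p ∈ A <;> by_cases h' : f p' ∈ A <;> simp [h, h']
    simp_rw [h1, Finset.mul_sum]
    rw [Finset.sum_comm]
    simp_rw [Finset.sum_comm (s := Finset.univ)]
    have h2 : ∀ p p' : Fin n, ∑ f, (law f).toReal * (if f p ∈ A ∧ f p' ∈ A then 1 else 0) ≤
        (if p = p' then x else 0) + x ^ 2 := by
      intro p p'
      split_ifs with h
      · subst h
        simp only [and_self]
        rw [hlaw.single hn]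
        nlinarith [sq_nonneg x]
      · rw [hlaw.pair h, hx, div_pow, sq ((A.card : ℝ)), zero_add]
    calc _ ≤ ∑ p ∈ N, ∑ p' ∈ N, ((if p = p' then x else 0) + x ^ 2) :=
          Finset.sum_le_sum fun p _ => Finset.sum_le_sum fun p' _ => h2 p p'
      _ = m * x + m ^ 2 * x ^ 2 := by
          simp only [Finset.sum_add_distrib, Finset.sum_const, Finset.sum_ite_eq, nsmul_eq_mul]
          rw [Finset.sum_ite_mem, Finset.inter_self, Finset.sum_const, nsmul_eq_mul]
          ring
  have hvar : (∑ f, (law f).toReal * (if ∀ p ∈ N, f p ∉ A then 1 else 0)) * (m * x) ^ 2 ≤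
      m * x := by
    calc _ ≤ ∑ f, (law f).toReal * (Z f - m * x) ^ 2 := by
          rw [Finset.sum_mul]
          refine Finset.sum_le_sum fun f _ => ?_
          rw [mul_assoc]
          refine mul_le_mul_of_nonneg_left ?_ ENNReal.toReal_nonneg
          split_ifs with h
          · have : Z f = 0 := Finset.sum_eq_zero fun p hp => by simp [h p hp]
            rw [this]; nlinarith
          · rw [zero_mul]; positivity
      _ = ∑ f, (law f).toReal * Z f ^ 2 - 2 * (m * x) * (∑ f, (law f).toReal * Z f) +
          (m * x) ^ 2 * ∑ f, (law f).toReal := by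
          simp only [Finset.mul_sum, ← Finset.sum_sub_distrib, ← Finset.sum_add_distrib]
          exact Finset.sum_congr rfl fun f _ => by ring
      _ ≤ m * x := by rw [hZ, sum_law_eq_one]; nlinarith
  rcases (mul_nonneg hm0 hx0).eq_or_lt with h0 | h0
  · rw [← h0]; simp
  · refine le_of_mul_le_mul_right ?_ h0
    rw [one_mul]
    refine le_trans (le_of_eq ?_) hvar
    ring

/-- The hash functions whose least value on `N` is larger than `32 n³ / |N|`. -/
def badHash (N : Finset (Fin n)) : Set (Fin n → Fin (n ^ 3)) :=
  {f | ∀ p ∈ N, 32 * n ^ 3 < ((f p : ℕ) + 1) * N.card}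

/-- If `|N| > 32`, then at least `31` points of `N` are expected to have a hash value of at most
`32 n³ / |N|`; otherwise every hash value is that small. -/
theorem measure_badHash_le (hlaw : PairwiseIndep law) (hn : 2 ≤ n) (N : Finset (Fin n))
    (hne : N.Nonempty) : law.toMeasure.real (badHash N) ≤ 1 / 16 := by
  classical
  rcases Nat.lt_or_ge 32 N.card with hcard | hcard
  · set T := 32 * n ^ 3 / N.card
    have hNn : N.card ≤ n := by simpa using N.card_le_univ
    have hn3 : n ≤ n ^ 3 := Nat.le_self_pow (by norm_num) n
    have hTlt : T ≤ n ^ 3 := by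
      refine Nat.div_le_of_le_mul ?_
      exact Nat.mul_le_mul_right _ hcard.le
    have hT : 31 * n ^ 3 ≤ N.card * T := by
      have := Nat.lt_mul_div_succ (32 * n ^ 3) (by omega : 0 < N.card)
      change 32 * n ^ 3 < N.card * (T + 1) at this
      rw [Nat.mul_succ] at this
      omega
    set A : Finset (Fin (n ^ 3)) := Finset.univ.filter fun v => (v : ℕ) < T
    have hA : A.card = T := by
      have : A.card = ((Finset.range T).card) := by
        refine Finset.card_bij (fun v _ => (v : ℕ)) (fun v hv => ?_) (fun v _ v' _ h => Fin.ext h)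
          (fun x hx => ?_)
        · exact Finset.mem_range.2 (Finset.mem_filter.1 hv).2
        · rw [Finset.mem_range] at hx
          exact ⟨⟨x, hx.trans_le hTlt⟩, Finset.mem_filter.2 ⟨Finset.mem_univ _, hx⟩, rfl⟩
      rw [this, Finset.card_range]
    have hset : ∀ f, f ∈ badHash N ↔ ∀ p ∈ N, f p ∉ A := by
      intro f
      refine forall₂_congr fun p _ => ?_
      simp only [A, Finset.mem_filter, Finset.mem_univ, true_and, not_lt]
      rw [← Nat.div_lt_iff_lt_mul (by omega : 0 < N.card)]
      exact Nat.lt_succ_iff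
    have hreal : law.toMeasure.real (badHash N) =
        ∑ f, (law f).toReal * (if ∀ p ∈ N, f p ∉ A then 1 else 0) := by
      rw [Measure.real, PMF.toMeasure_apply_fintype,
        ENNReal.toReal_sum]
      · refine Finset.sum_congr rfl fun f _ => ?_
        by_cases hf : f ∈ badHash N
        · rw [if_pos ((hset f).1 hf), Set.indicator_of_mem hf, mul_one]
        · rw [if_neg (fun h => hf ((hset f).2 h))]
          simp [Set.indicator, hf]
      · intro f _
        by_cases hf : f ∈ badHash N <;> simp [Set.indicator, hf, PMF.apply_ne_top]
    have h := hlaw.avoid_le hn N A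
    rw [← hreal, hA] at h
    have hn' : (0 : ℝ) < (n : ℝ) ^ 3 := by
      have : (0 : ℝ) < n := by exact_mod_cast (by omega : 0 < n)
      positivity
    have h31 : (31 : ℝ) ≤ N.card * (T / (n : ℝ) ^ 3) := by
      rw [← mul_div_assoc, le_div_iff₀ hn']
      exact_mod_cast hT
    have h0 : 0 ≤ law.toMeasure.real (badHash N) := measureReal_nonneg
    nlinarith
  · have : badHash N = (∅ : Set (Fin n → Fin (n ^ 3))) := by
      rw [Set.eq_empty_iff_forall_notMem]
      intro f hf
      obtain ⟨p, hp⟩ := hne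
      have h1 := hf p hp
      have h2 : ((f p : ℕ) + 1) * N.card ≤ n ^ 3 * 32 := Nat.mul_le_mul (f p).2 hcard
      omega
    rw [this]; simp

/-- The hash functions of a sketch for which at most half of the lists underestimate `|N|` by
more than the factor `32`. -/
def goodLists (Δ : ℕ) (N : Finset (Fin n)) : Set (Fin Δ → Fin n → Fin (n ^ 3)) :=
  {ψ | 2 * (Finset.univ.filter fun w => ∀ p ∈ N,
    32 * n ^ 3 < ((ψ w p : ℕ) + 1) * N.card).card ≤ Δ}

/-- A union bound over the sets of at least half of the lists, each of which is bad with
probability at most `16 ^ (-Δ / 2)`. -/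
theorem measure_compl_goodLists_le (hlaw : PairwiseIndep law) (hn : 2 ≤ n) (Δ : ℕ)
    (N : Finset (Fin n)) (hne : N.Nonempty) :
    (Measure.pi fun _ : Fin Δ => law.toMeasure).real (goodLists Δ N)ᶜ ≤ (1 / 2) ^ Δ := by
  classical
  set ν := Measure.pi fun _ : Fin Δ => law.toMeasure
  set J : Finset (Finset (Fin Δ)) := Finset.univ.filter fun W => Δ ≤ 2 * W.card
  have hsub : (goodLists Δ N)ᶜ ⊆ ⋃ W ∈ J, {ψ | ∀ w ∈ W, ψ w ∈ badHash N} := by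
    intro ψ hψ
    simp only [goodLists, Set.mem_compl_iff, Set.mem_ofPred_eq, not_le] at hψ
    simp only [Set.mem_iUnion]
    refine ⟨_, Finset.mem_filter.2 ⟨Finset.mem_univ _, hψ.le⟩, fun w hw => ?_⟩
    exact (Finset.mem_filter.1 hw).2
  have hW : ∀ W ∈ J, ν.real {ψ | ∀ w ∈ W, ψ w ∈ badHash N} ≤ (1 / 4) ^ Δ := by
    intro W hWJ
    have hpi : {ψ : Fin Δ → Fin n → Fin (n ^ 3) | ∀ w ∈ W, ψ w ∈ badHash N} =
        Set.univ.pi fun w => if w ∈ W then badHash N else Set.univ := by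
      ext ψ
      simp only [Set.mem_ofPred_eq, Set.mem_pi, Set.mem_univ, true_imp_iff]
      refine forall_congr' fun w => ?_
      by_cases hw : w ∈ W <;> simp [hw]
    rw [Measure.real, hpi, Measure.pi_pi, ENNReal.toReal_prod]
    calc ∏ w, (law.toMeasure (if w ∈ W then badHash N else Set.univ)).toReal
        = ∏ w, if w ∈ W then law.toMeasure.real (badHash N) else 1 := by
          refine Finset.prod_congr rfl fun w _ => ?_
          split_ifs
          · rfl
          · simp
      _ = law.toMeasure.real (badHash N) ^ W.card := by
          rw [Finset.prod_ite_mem, Finset.univ_inter, Finset.prod_const]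
      _ ≤ (1 / 16) ^ W.card := by
          gcongr
          exact measure_badHash_le hlaw hn N hne
      _ = (1 / 4) ^ (2 * W.card) := by rw [pow_mul]; norm_num
      _ ≤ (1 / 4) ^ Δ :=
          pow_le_pow_of_le_one (by norm_num) (by norm_num) (Finset.mem_filter.1 hWJ).2
  calc ν.real (goodLists Δ N)ᶜ ≤ _ := measureReal_mono hsub (measure_ne_top _ _)
    _ ≤ ∑ W ∈ J, ν.real {ψ | ∀ w ∈ W, ψ w ∈ badHash N} := measureReal_biUnion_finset_le _ _
    _ ≤ ∑ W ∈ J, (1 / 4) ^ Δ := Finset.sum_le_sum hW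
    _ = J.card * (1 / 4) ^ Δ := by simp
    _ ≤ 2 ^ Δ * (1 / 4) ^ Δ := by
        gcongr
        have : J.card ≤ 2 ^ Δ := by
          refine (Finset.card_le_univ J).trans (le_of_eq ?_)
          simp
        exact_mod_cast this
    _ = (1 / 2) ^ Δ := by rw [← mul_pow]; norm_num

end Pairwise

/-! ### Parameters and good random choices -/

/-- A choice of the constants. Sketches keep only the least hash value of each list. The constant
of `Σ` is eight times that of `λ`, so that a level with at most twice as many segments as there
are near neighbours fails with probability at most `exp (-4 ⌈log₂ n⌉)`. -/
def params : Constants where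
  cL := 5
  cΔ := 4
  t := 1
  cτ := 1
  cl := 200
  cσ := 1600
  cL_pos := by norm_num
  cΔ_pos := by norm_num
  t_pos := by norm_num
  cτ_pos := by norm_num
  cl_pos := by norm_num
  cσ_pos := by norm_num

theorem le_two_pow_lg (n : ℕ) : (n : ℝ) ≤ 2 ^ lg n := by
  exact_mod_cast Nat.le_pow_clog one_lt_two n

theorem half_pow_le {n : ℕ} (hn : 0 < n) (c : ℕ) :
    (1 / 2 : ℝ) ^ (c * lg n) ≤ ((n : ℝ) ^ c)⁻¹ := by
  have hn' : (0 : ℝ) < n := by exact_mod_cast hn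
  rw [one_div, inv_pow, mul_comm, pow_mul]
  gcongr
  exact le_two_pow_lg n

theorem exp_neg_le {n : ℕ} (hn : 0 < n) (c : ℕ) {x : ℝ} (hx : (c * lg n : ℕ) ≤ x) :
    Real.exp (-x) ≤ ((n : ℝ) ^ c)⁻¹ := by
  refine le_trans ?_ (half_pow_le hn c)
  calc Real.exp (-x) ≤ Real.exp (-((c * lg n : ℕ) : ℝ)) := Real.exp_le_exp.2 (neg_le_neg hx)
    _ = Real.exp (-1) ^ (c * lg n) := by rw [← Real.exp_nat_mul]; congr 1; ring
    _ ≤ (1 / 2) ^ (c * lg n) := by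
      gcongr
      rw [Real.exp_neg, one_div]
      gcongr
      linarith [Real.add_one_le_exp (1 : ℝ)]

section Good

variable {X U Ω : Type*} [MetricSpace X] {n : ℕ} (S : Fin n ↪ X) (r : ℝ) (q : X)

open Classical in
/-- The near neighbours of `q` as a finite set. -/
def near : Finset (Fin n) := Finset.univ.filter fun p => dist (S p) q ≤ r

theorem mem_near (p : Fin n) : p ∈ near S r q ↔ dist (S p) q ≤ r := by
  classical simp [near]

theorem mem_ball_iff (p : Fin n) : p ∈ ball S q r ↔ p ∈ near S r q := by
  rw [mem_near]; rfl

theorem ballCard_eq : ballCard S q r = (near S r q).card := by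
  rw [ballCard, ← Set.ncard_coe_finset]
  congr 1
  ext p
  rw [mem_ball_iff]; rfl

/-- The hash functions under which each near neighbour collides with `q` in some table. -/
def goodHashes (h : Ω → X → U) (L : ℕ) : Set (Fin L → Ω) :=
  {ω | ∀ p ∈ near S r q, ∃ i, h (ω i) (S p) = h (ω i) q}

/-- The random choices of the construction for which the query `q` behaves as intended. -/
def goodSeeds (h : Ω → X → U) (L Δ : ℕ) : Set (Seed Ω n L Δ) :=
  {ω | ω.1 ∈ goodHashes S r q h L ∧ ω.2.1 ∈ goodPerms (params.cl * lg n) (near S r q) ∧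
    ((near S r q).Nonempty → ω.2.2 ∈ goodLists Δ (near S r q))}

variable [MeasurableSpace Ω] {μ : Measure Ω} [IsProbabilityMeasure μ] {h : Ω → X → U}
  {R p₁ p₂ : ℝ} {law : PMF (Fin n → Fin (n ^ 3))}

omit [IsProbabilityMeasure μ] in
theorem measurableSet_goodHashes (hμ : IsSensitive μ h r R p₁ p₂) (L : ℕ) :
    MeasurableSet (goodHashes S r q h L) := by
  have : goodHashes S r q h L =
      ⋂ p ∈ near S r q, ⋃ i : Fin L, (fun ω => ω i) ⁻¹' {ω | h ω (S p) = h ω q} := by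
    ext ω; simp [goodHashes]
  rw [this]
  refine Finset.measurableSet_biInter _ fun p _ => MeasurableSet.iUnion fun i => ?_
  exact measurable_pi_apply i (hμ.measurable_collision _ _)

theorem IsSensitive.le_one (hμ : IsSensitive μ h r R p₁ p₂) (hr : 0 < r) (x : X) : p₁ ≤ 1 :=
  (hμ.near x x (by simpa using hr.le)).trans measureReal_le_one

theorem measure_compl_goodHashes_le (hn : 2 ≤ n) (hr : 0 < r) (hp : 0 < p₁)
    (hμ : IsSensitive μ h r R p₁ p₂) :
    (Measure.pi fun _ : Fin (numTables params n p₁) => μ).real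
      (goodHashes S r q h (numTables params n p₁))ᶜ ≤ ((n : ℝ) ^ 4)⁻¹ := by
  have hp1 : p₁ ≤ 1 := hμ.le_one r hr q
  set L := numTables params n p₁ with hL
  set ν := Measure.pi fun _ : Fin L => μ
  have hsub : (goodHashes S r q h L)ᶜ ⊆ ⋃ p ∈ near S r q,
      Set.univ.pi fun _ : Fin L => {ω | h ω (S p) = h ω q}ᶜ := by
    intro ω hω
    simp only [goodHashes, Set.mem_compl_iff, Set.mem_ofPred_eq, not_forall, not_exists] at hω
    obtain ⟨p, hp, hne⟩ := hω
    simp only [Set.mem_iUnion]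
    exact ⟨p, hp, fun i _ => hne i⟩
  have hpoint : ∀ p ∈ near S r q,
      ν.real (Set.univ.pi fun _ : Fin L => {ω | h ω (S p) = h ω q}ᶜ) ≤ ((n : ℝ) ^ 5)⁻¹ := by
    intro p hp'
    rw [Measure.real, Measure.pi_pi, ENNReal.toReal_prod, Finset.prod_const, Finset.card_univ,
      Fintype.card_fin]
    change μ.real _ ^ L ≤ _
    have h1 : μ.real {ω | h ω (S p) = h ω q}ᶜ ≤ Real.exp (-p₁) := by
      rw [probReal_compl_eq_one_sub (hμ.measurable_collision _ _)]
      linarith [hμ.near _ _ ((mem_near S r q p).1 hp'), Real.one_sub_le_exp_neg p₁]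
    calc μ.real {ω | h ω (S p) = h ω q}ᶜ ^ L ≤ Real.exp (-p₁) ^ L := by gcongr
      _ = Real.exp (-(L * p₁)) := by rw [← Real.exp_nat_mul]; congr 1; ring
      _ ≤ ((n : ℝ) ^ 5)⁻¹ := by
        refine exp_neg_le (by omega) 5 ?_
        have : (params.cL * lg n / p₁ : ℝ) ≤ L := Nat.le_ceil _
        rw [div_le_iff₀ hp] at this
        simpa [params] using this
  calc ν.real (goodHashes S r q h L)ᶜ ≤ _ := measureReal_mono hsub (measure_ne_top _ _)
    _ ≤ ∑ p ∈ near S r q, ν.real (Set.univ.pi fun _ : Fin L => {ω | h ω (S p) = h ω q}ᶜ) :=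
        measureReal_biUnion_finset_le _ _
    _ ≤ ∑ p ∈ near S r q, ((n : ℝ) ^ 5)⁻¹ := Finset.sum_le_sum hpoint
    _ = (near S r q).card * ((n : ℝ) ^ 5)⁻¹ := by simp
    _ ≤ n * ((n : ℝ) ^ 5)⁻¹ := by
        gcongr
        simpa using (near S r q).card_le_univ
    _ = ((n : ℝ) ^ 4)⁻¹ := by
        have hn' : (0 : ℝ) < n := by exact_mod_cast (by omega : 0 < n)
        field_simp

/-- Of the factor `200` in `λ`, a part of `192` outweighs `exp 128`, and the remaining `8` gives
a power of `1 / n`. -/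
theorem measure_compl_goodPerms_le (hn : 2 ≤ n) (N : Finset (Fin n)) :
    (permMeasure n).real (goodPerms (params.cl * lg n) N)ᶜ ≤ ((n : ℝ) ^ 4)⁻¹ := by
  have hlg : 0 < lg n := lg_pos hn
  have hn' : (0 : ℝ) < n := by exact_mod_cast (by omega : 0 < n)
  have he : Real.exp 128 ≤ 2 ^ 192 := by
    have h1 : Real.exp 2 ≤ 2 ^ 3 := by
      have := Real.exp_one_lt_d9
      have h2 : Real.exp 2 = Real.exp 1 ^ 2 := by rw [← Real.exp_nat_mul]; norm_num
      rw [h2]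
      nlinarith [Real.exp_pos 1]
    calc Real.exp 128 = Real.exp 2 ^ 64 := by rw [← Real.exp_nat_mul]; norm_num
      _ ≤ (2 ^ 3) ^ 64 := by gcongr
      _ = 2 ^ 192 := by norm_num
  refine (permMeasure_compl_goodPerms_le hn (Nat.mul_pos params.cl_pos hlg) N).trans ?_
  calc (n : ℝ) ^ 2 * (Real.exp 128 * (1 / 2) ^ (params.cl * lg n + 1))
      ≤ (n : ℝ) ^ 2 * (2 ^ 192 * (1 / 2) ^ (192 + 8 * lg n)) := by
        refine mul_le_mul_of_nonneg_left (mul_le_mul he (pow_le_pow_of_le_one (by norm_num)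
          (by norm_num) ?_) (by positivity) (by positivity)) (by positivity)
        simp only [params]
        omega
    _ = (n : ℝ) ^ 2 * (1 / 2) ^ (8 * lg n) := by
        rw [pow_add, ← mul_assoc (2 ^ 192 : ℝ), ← mul_pow]; norm_num
    _ ≤ (n : ℝ) ^ 2 * ((n : ℝ) ^ 8)⁻¹ := by
        gcongr
        exact half_pow_le (by omega) 8
    _ = ((n : ℝ) ^ 6)⁻¹ := by field_simp
    _ ≤ ((n : ℝ) ^ 4)⁻¹ := by
        gcongr
        · exact_mod_cast (by omega : 1 ≤ n)
        · norm_num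

omit [IsProbabilityMeasure μ] in
theorem measurableSet_goodSeeds (hμ : IsSensitive μ h r R p₁ p₂) (L Δ : ℕ) :
    MeasurableSet (goodSeeds S r q h L Δ) := by
  refine (measurable_fst (measurableSet_goodHashes S r q hμ L)).inter
    (MeasurableSet.inter (s₁ := {ω : Seed Ω n L Δ | ω.2.1 ∈ goodPerms _ _}) ?_
      (s₂ := {ω : Seed Ω n L Δ | _ → ω.2.2 ∈ goodLists _ _}) ?_)
  · exact measurable_fst.comp measurable_snd
      (show MeasurableSet (goodPerms (params.cl * lg n) (near S r q)) from trivial)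
  · by_cases hne : (near S r q).Nonempty
    · simp only [hne, true_imp_iff]
      exact measurable_snd.comp measurable_snd (Set.toFinite (goodLists Δ _)).measurableSet
    · simp [hne]

instance isProbabilityMeasure_seedMeasure (L Δ : ℕ) :
    IsProbabilityMeasure (seedMeasure μ n L Δ law) := by
  unfold seedMeasure; infer_instance

theorem measure_compl_goodSeeds_le (hn : 2 ≤ n) (hr : 0 < r) (hp : 0 < p₁)
    (hμ : IsSensitive μ h r R p₁ p₂) (hlaw : PairwiseIndep law) :
    (seedMeasure μ n (numTables params n p₁) (numLists params n) law).real
      (goodSeeds S r q h (numTables params n p₁) (numLists params n))ᶜ ≤ 3 * ((n : ℝ) ^ 4)⁻¹ := by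
  set L := numTables params n p₁
  set Δ := numLists params n with hΔ
  set P := seedMeasure μ n L Δ law with hP
  have h1 : P.real {ω | ω.1 ∈ (goodHashes S r q h L)ᶜ} ≤ ((n : ℝ) ^ 4)⁻¹ := by
    refine le_trans (le_of_eq ?_) (measure_compl_goodHashes_le S r q hn hr hp hμ)
    exact measurePreserving_fst.measureReal_preimage
      (measurableSet_goodHashes S r q hμ L).compl.nullMeasurableSet
  have h2 : P.real {ω | ω.2.1 ∈ (goodPerms (params.cl * lg n) (near S r q))ᶜ} ≤
      ((n : ℝ) ^ 4)⁻¹ := by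
    refine le_trans (le_of_eq ?_) (measure_compl_goodPerms_le hn (near S r q))
    exact (measurePreserving_fst.comp measurePreserving_snd).measureReal_preimage
      (show MeasurableSet (goodPerms (params.cl * lg n) (near S r q))ᶜ from
        trivial).nullMeasurableSet
  have h3 : P.real {ω | (near S r q).Nonempty ∧ ω.2.2 ∈ (goodLists Δ (near S r q))ᶜ} ≤
      ((n : ℝ) ^ 4)⁻¹ := by
    by_cases hne : (near S r q).Nonempty
    · simp only [hne, true_and]
      refine le_trans (le_of_eq ?_) ((measure_compl_goodLists_le hlaw hn Δ (near S r q) hne).trans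
        (half_pow_le (by omega) 4))
      exact (measurePreserving_snd.comp measurePreserving_snd).measureReal_preimage
        (Set.toFinite _).measurableSet.nullMeasurableSet
    · simp [hne]
  have hsub : (goodSeeds S r q h L Δ)ᶜ ⊆ {ω | ω.1 ∈ (goodHashes S r q h L)ᶜ} ∪
      ({ω | ω.2.1 ∈ (goodPerms (params.cl * lg n) (near S r q))ᶜ} ∪
        {ω | (near S r q).Nonempty ∧ ω.2.2 ∈ (goodLists Δ (near S r q))ᶜ}) := by
    intro ω hω
    simp only [goodSeeds, Set.mem_compl_iff, Set.mem_ofPred_eq, Set.mem_union] at hω ⊢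
    tauto
  refine (measureReal_mono hsub (measure_ne_top _ _)).trans ?_
  refine (measureReal_union_le _ _).trans ?_
  have := measureReal_union_le (μ := P)
    {ω | ω.2.1 ∈ (goodPerms (params.cl * lg n) (near S r q))ᶜ}
    {ω | (near S r q).Nonempty ∧ ω.2.2 ∈ (goodLists Δ (near S r q))ᶜ}
  linarith

end Good

/-! ### A single query -/

section SingleQuery

variable {X U Ω : Type*} [MetricSpace X] {n L Δ : ℕ} {S : Fin n ↪ X} {r : ℝ} {q : X}
  {h : Ω → X → U} {ω : Seed Ω n L Δ}

open Classical in
theorem mem_collected_iff (p : Fin n) (k x : ℕ) :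
    p ∈ collected (buildSeed params S h ω).val q r
        (lookup params (buildSeed params S h ω).val q).val k x ↔
      p ∈ (near S r q).filter (fun p => ∃ i, h (ω.1 i) (S p) = h (ω.1 i) q) ∧
        segment ω.2.1 k p = x := by
  rw [Finset.mem_filter, mem_near]
  refine (mem_collect _ q r (lookup_sorted params S _ ω.2.1 ω.2.2 q) k x p).trans ?_
  rw [buildSeed, mem_lookup]
  change _ ∧ dist (S p) q ≤ r ∧ segment ω.2.1 k p = x ↔ _
  tauto

theorem mem_collected_of_good (hω : ω ∈ goodSeeds S r q h L Δ) (p : Fin n) (k x : ℕ) :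
    p ∈ collected (buildSeed params S h ω).val q r
        (lookup params (buildSeed params S h ω).val q).val k x ↔
      p ∈ near S r q ∧ segment ω.2.1 k p = x := by
  classical rw [mem_collected_iff, Finset.filter_true_of_mem hω.1]

/-- The event that a query does not fail: if it has near neighbours, it returns a point, and it
does so at a level with sufficiently many segments. -/
def Succeeds (S : Fin n ↪ X) (r : ℝ) (q : X) (a : Result n) : Prop :=
  (near S r q).Nonempty → a.out.isSome ∧ (near S r q).card ≤ 32 * a.segments

open Classical in
/-- Only near neighbours are returned. -/
theorem mean_query_not_near (p : Fin n) (hp : p ∉ near S r q) :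
    mean (query params (buildSeed params S h ω).val r q)
      (fun a => if a.out = some p then 1 else 0) = 0 := by
  rw [mean_query _ _ _ _ fun x => if x.1 = some p then 1 else 0]
  refine expect_search_eq_zero (fun k x p => mem_collected_iff p k x) _ (by simp)
    (fun p' hp' k => ?_) _
  rw [if_neg]
  rintro h
  rw [Option.some.inj h] at hp'
  exact hp (Finset.mem_filter.1 hp').1

theorem query_mem_near {a : Result n} {p : Fin n}
    (ha : query params (buildSeed params S h ω).val r q a ≠ 0) (hp : a.out = some p) :
    p ∈ near S r q := by
  classical
  by_contra hn
  have h0 := mean_query_not_near (h := h) (ω := ω) p hn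
  rw [mean, ENNReal.tsum_eq_zero] at h0
  have := h0 a
  rw [if_pos hp, mul_one] at this
  exact ha this

open Classical in
/-- A near neighbour is returned as often as any other near neighbour. -/
theorem mean_query_succeeds_eq (hω : ω ∈ goodSeeds S r q h L Δ) {p p' : Fin n}
    (hp : p ∈ near S r q) (hp' : p' ∈ near S r q) :
    mean (query params (buildSeed params S h ω).val r q)
        (fun a => if Succeeds S r q a ∧ a.out = some p then 1 else 0) =
      mean (query params (buildSeed params S h ω).val r q)
        (fun a => if Succeeds S r q a ∧ a.out = some p' then 1 else 0) := by
  have hne : (near S r q).Nonempty := ⟨p, hp⟩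
  have key : ∀ x ∈ near S r q, mean (query params (buildSeed params S h ω).val r q)
        (fun a => if Succeeds S r q a ∧ a.out = some x then 1 else 0) =
      (search (buildSeed params S h ω).val q r
        (lookup params (buildSeed params S h ω).val q).val (params.cl * lg n)
        (params.cσ * lg n ^ 2) (startLevel params (buildSeed params S h ω).val q)).expect
        (fun y => if (near S r q).card ≤ 32 * y.2 ∧ y.1 = some x then 1 else 0) := by
    intro x _
    rw [← mean_query]
    refine mean_congr _ fun a _ => ?_
    congr 1
    simp only [Succeeds, hne, true_imp_iff, eq_iff_iff]
    constructor
    · rintro ⟨⟨-, h1⟩, h2⟩; exact ⟨h1, h2⟩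
    · rintro ⟨h1, h2⟩; exact ⟨⟨by simp [h2], h1⟩, h2⟩
  rw [key p hp, key p' hp']
  refine expect_search_congr (fun k x p => mem_collected_of_good hω p k x) _ (by simp) (by simp)
    (fun e => ?_) _
  by_cases he : (near S r q).card ≤ 32 * 2 ^ e
  · refine Or.inr ⟨hω.2.1 e he, ?_⟩
    simp [he, hp, hp']
  · left; simp [he]

open Classical in
/-- On good choices, a query that does not fail returns a uniform near neighbour. -/
theorem mean_query_uniform (hω : ω ∈ goodSeeds S r q h L Δ) {p : Fin n}
    (hp : p ∈ near S r q) :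
    mean (query params (buildSeed params S h ω).val r q)
        (fun a => if Succeeds S r q a ∧ a.out = some p then 1 else 0) =
      mean (query params (buildSeed params S h ω).val r q)
        (fun a => if Succeeds S r q a then 1 else 0) / (near S r q).card := by
  have hne : (near S r q).Nonempty := ⟨p, hp⟩
  have h1 : mean (query params (buildSeed params S h ω).val r q)
        (fun a => if Succeeds S r q a then (1 : ℝ≥0∞) else 0) =
      ∑ p' ∈ near S r q, mean (query params (buildSeed params S h ω).val r q)
        (fun a => if Succeeds S r q a ∧ a.out = some p' then 1 else 0) := by
    rw [← mean_finset_sum]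
    refine mean_congr _ fun a ha => ?_
    by_cases hs : Succeeds S r q a
    · obtain ⟨x, hx⟩ := Option.isSome_iff_exists.1 (hs hne).1
      simp [hs, hx, query_mem_near ha hx]
    · simp [hs]
  rw [h1, Finset.sum_congr rfl fun p' hp' => mean_query_succeeds_eq hω hp' hp, Finset.sum_const,
    nsmul_eq_mul, mul_comm, ENNReal.mul_div_cancel_right]
  · exact_mod_cast hne.card_pos.ne'
  · simp

/-- On good choices the search starts at a level with sufficiently many segments. -/
theorem startLevel_spec (hn : 2 ≤ n) (hΔ : 0 < Δ) (hω : ω ∈ goodSeeds S r q h L Δ)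
    (hne : (near S r q).Nonempty) :
    0 < startLevel params (buildSeed params S h ω).val q ∧
      (near S r q).card ≤ 16 * 2 ^ startLevel params (buildSeed params S h ω).val q := by
  obtain ⟨h1, h2⟩ := le_estimateCollisions params S (fun i => h (ω.1 i)) ω.2.1 ω.2.2 q hn hΔ rfl
    (near S r q) hne hω.1 (hω.2.2 hne)
  rw [startLevel]
  change 1 ≤ (estimateCollisions params
    (lookup params (buildSeed params S h ω).val q).val).val at h1
  change _ ≤ (estimateCollisions params
    (lookup params (buildSeed params S h ω).val q).val).val at h2
  set est := (estimateCollisions params (lookup params (buildSeed params S h ω).val q).val).val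
  have hceil : 2 * est ≤ (⌈2 * est⌉₊ : ℚ) := Nat.le_ceil _
  constructor
  · refine Nat.clog_pos one_lt_two ?_
    have : (2 : ℚ) ≤ ⌈2 * est⌉₊ := by linarith
    exact_mod_cast this
  · have h3 : (⌈2 * est⌉₊ : ℚ) ≤ (2 ^ Nat.clog 2 ⌈2 * est⌉₊ : ℕ) := by
      exact_mod_cast Nat.le_pow_clog one_lt_two _
    have h4 : ((near S r q).card : ℚ) ≤ (16 * 2 ^ Nat.clog 2 ⌈2 * est⌉₊ : ℕ) := by
      push_cast at h3 ⊢
      linarith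
    exact_mod_cast h4

/-- There is a level between one and the initial level whose number of segments is, up to
constant factors, the number of near neighbours. -/
theorem exists_level (hn : 2 ≤ n) (hΔ : 0 < Δ) (hω : ω ∈ goodSeeds S r q h L Δ)
    (hne : (near S r q).Nonempty) :
    ∃ e, 0 < e ∧ e ≤ startLevel params (buildSeed params S h ω).val q ∧
      (near S r q).card ≤ 32 * 2 ^ e ∧ 2 ^ e ≤ 2 * (near S r q).card := by
  obtain ⟨h1, h2⟩ := startLevel_spec hn hΔ hω hne
  set e₀ := startLevel params (buildSeed params S h ω).val q
  have h3 : (near S r q).card < 2 ^ (Nat.log 2 (near S r q).card + 1) :=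
    Nat.lt_pow_succ_log_self one_lt_two _
  have h4 : 2 ^ Nat.log 2 (near S r q).card ≤ (near S r q).card :=
    Nat.pow_log_le_self 2 hne.card_pos.ne'
  refine ⟨min e₀ (Nat.log 2 (near S r q).card + 1), by omega, min_le_left _ _, ?_, ?_⟩
  · rcases min_choice e₀ (Nat.log 2 (near S r q).card + 1) with h5 | h5 <;> rw [h5] <;> omega
  · refine (Nat.pow_le_pow_right two_pos (min_le_right _ _)).trans ?_
    rw [pow_succ]
    omega

/-- A level whose number of segments is close to the number of near neighbours rarely fails. -/
theorem rejectProb_pow_le (hn : 2 ≤ n) (hω : ω ∈ goodSeeds S r q h L Δ)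
    {e : ℕ} (h1 : (near S r q).card ≤ 32 * 2 ^ e) (h2 : 2 ^ e ≤ 2 * (near S r q).card) :
    rejectProb (buildSeed params S h ω).val q r
      (lookup params (buildSeed params S h ω).val q).val (params.cl * lg n) e ^
        (params.cσ * lg n ^ 2) ≤ ENNReal.ofReal (((n : ℝ) ^ 4)⁻¹) := by
  have hlg := lg_pos hn
  have hadd := rejectProb_add (fun k x p => mem_collected_of_good hω p k x) (hω.2.1 e h1)
  set lam := params.cl * lg n with hlam
  have hlampos : 0 < lam := Nat.mul_pos params.cl_pos hlg
  have hlam' : (0 : ℝ) < lam := by exact_mod_cast hlampos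
  set x : ℝ := 1 / (2 * lam) with hx
  have hx1 : 0 ≤ x := by positivity
  have hle : ENNReal.ofReal x ≤ ((near S r q).card : ℝ≥0∞) / lam / (2 ^ e : ℕ) := by
    have h3 : ((near S r q).card : ℝ≥0∞) / lam / (2 ^ e : ℕ) =
        ENNReal.ofReal (((near S r q).card : ℝ) / lam / (2 ^ e : ℕ)) := by
      rw [ENNReal.ofReal_div_of_pos (by positivity), ENNReal.ofReal_div_of_pos hlam',
        ENNReal.ofReal_natCast, ENNReal.ofReal_natCast, ENNReal.ofReal_natCast]
    rw [h3]
    refine ENNReal.ofReal_le_ofReal ?_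
    have h4 : ((2 ^ e : ℕ) : ℝ) ≤ 2 * (near S r q).card := by exact_mod_cast h2
    rw [hx, div_div, div_le_div_iff₀ (by positivity) (by positivity)]
    nlinarith
  have hrej : rejectProb (buildSeed params S h ω).val q r
      (lookup params (buildSeed params S h ω).val q).val lam e ≤ ENNReal.ofReal (1 - x) := by
    rw [ENNReal.ofReal_sub _ hx1, ENNReal.ofReal_one]
    refine ENNReal.le_sub_of_add_le_right ENNReal.ofReal_ne_top ?_
    exact (add_le_add_right hle _).trans hadd.le
  have hx2 : 0 ≤ 1 - x := by
    have : (1 : ℝ) ≤ lam := by exact_mod_cast hlampos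
    rw [hx, sub_nonneg, div_le_one (by positivity)]
    linarith
  calc _ ≤ ENNReal.ofReal (1 - x) ^ (params.cσ * lg n ^ 2) := pow_le_pow_left' hrej _
    _ = ENNReal.ofReal ((1 - x) ^ (params.cσ * lg n ^ 2)) := (ENNReal.ofReal_pow hx2 _).symm
    _ ≤ _ := by
      refine ENNReal.ofReal_le_ofReal ?_
      calc (1 - x) ^ (params.cσ * lg n ^ 2) ≤ Real.exp (-x) ^ (params.cσ * lg n ^ 2) := by
            gcongr
            exact Real.one_sub_le_exp_neg x
        _ = Real.exp (-((params.cσ * lg n ^ 2 : ℕ) * x)) := by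
            rw [← Real.exp_nat_mul]; congr 1; ring
        _ ≤ _ := by
            refine exp_neg_le (by omega) 4 (le_of_eq ?_)
            have hlg' : (0 : ℝ) < lg n := by exact_mod_cast hlg
            rw [hx, hlam]
            simp only [params]
            push_cast
            field_simp
            norm_num

open Classical in
theorem mean_query_not_succeeds_le (hn : 2 ≤ n) (hΔ : 0 < Δ) (hω : ω ∈ goodSeeds S r q h L Δ) :
    mean (query params (buildSeed params S h ω).val r q)
      (fun a => if Succeeds S r q a then 0 else 1) ≤ ENNReal.ofReal (((n : ℝ) ^ 4)⁻¹) := by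
  by_cases hne : (near S r q).Nonempty
  · obtain ⟨e, h1, h2, h3, h4⟩ := exists_level hn hΔ hω hne
    refine le_trans ?_ (rejectProb_pow_le hn hω h3 h4)
    have hq : (fun a : Result n => if Succeeds S r q a then (0 : ℝ≥0∞) else 1) =
        fun a => (fun y : Option (Fin n) × ℕ =>
          if y.1.isSome ∧ (near S r q).card ≤ 32 * y.2 then (0 : ℝ≥0∞) else 1)
            (a.out, a.segments) := by
      funext a
      simp [Succeeds, hne]
    rw [hq, mean_query params _ r q fun y : Option (Fin n) × ℕ =>
          if y.1.isSome ∧ (near S r q).card ≤ 32 * y.2 then (0 : ℝ≥0∞) else 1]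
    refine expect_search_le _ (fun y => ?_) h1 (fun e' he' p => ?_) h2
    · split_ifs <;> simp
    · have : 2 ^ e ≤ 2 ^ e' := Nat.pow_le_pow_right two_pos he'
      rw [if_pos ⟨rfl, by simp only; omega⟩]
  · rw [mean_eq_zero]
    · exact zero_le
    · intro a _
      simp [Succeeds, hne]

end SingleQuery

/-! ### Sequences of queries -/

section Sequence

variable {X U : Type*} [MetricSpace X] {n L Δ : ℕ} {K : Constants} {D : Index X U n L Δ} {r : ℝ}

theorem runQueries_cons (q : X) (qs : List X) (s : Set (List (Result n))) :
    (runQueries K D r (q :: qs)).toOuterMeasure s = mean (query K D r q) fun a =>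
      (runQueries K D r qs).toOuterMeasure {l | a :: l ∈ s} := by
  rw [toOuterMeasure_eq_mean, runQueries, mean_bind]
  refine mean_congr _ fun a _ => ?_
  rw [mean_bind, toOuterMeasure_eq_mean]
  refine mean_congr _ fun l _ => ?_
  rw [mean_pure]
  rfl

/-- If each query returns the near neighbours with equal probabilities, jointly with the event
that it does not fail, then the results of a sequence of queries are independent of each other. -/
theorem runQueries_uniform {R : X → Result n → Prop} {N : X → Finset (Fin n)}
    (qs : List X)
    (hR : ∀ q ∈ qs, ∀ p ∈ N q, (query K D r q).toOuterMeasure {a | R q a ∧ a.out = some p} =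
      (query K D r q).toOuterMeasure {a | R q a} / (N q).card)
    (i : ℕ) (q : X) (hq : qs[i]? = some q) (p : Fin n) (hp : p ∈ N q)
    (A : Set (List (Option (Fin n)))) :
    (runQueries K D r qs).toOuterMeasure {l | List.Forall₂ R qs l ∧
      (l.map Result.out).take i ∈ A ∧ (l.map Result.out)[i]? = some (some p)} =
    (runQueries K D r qs).toOuterMeasure {l | List.Forall₂ R qs l ∧
      (l.map Result.out).take i ∈ A} / (N q).card := by
  classical
  induction qs generalizing i A with
  | nil => simp at hq
  | cons q₀ qs ih =>
    rw [runQueries_cons, runQueries_cons, ENNReal.div_eq_inv_mul, mul_comm, ← mean_mul_right]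
    cases i with
    | zero =>
      obtain rfl : q₀ = q := by simpa using hq
      set x := (runQueries K D r qs).toOuterMeasure {l | List.Forall₂ R qs l ∧ [] ∈ A} with hx
      have h1 : ∀ a : Result n, (runQueries K D r qs).toOuterMeasure
          {l | a :: l ∈ {l : List (Result n) | List.Forall₂ R (q₀ :: qs) l ∧
            (l.map Result.out).take 0 ∈ A ∧ (l.map Result.out)[0]? = some (some p)}} =
          ({a | R q₀ a ∧ a.out = some p} : Set (Result n)).indicator 1 a * x := by
        intro a
        by_cases ha : R q₀ a ∧ a.out = some p
        · simp [Set.indicator, ha, hx]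
        · rw [Set.indicator_of_notMem (by exact ha), zero_mul]
          convert measure_empty (μ := (runQueries K D r qs).toOuterMeasure) using 2
          ext l
          simp only [List.forall₂_cons, Set.mem_ofPred_eq, Set.mem_empty_iff_false, iff_false]
          rintro ⟨⟨h1, -⟩, -, h2⟩
          exact ha ⟨h1, by simpa using h2⟩
      have h2 : ∀ a : Result n, (runQueries K D r qs).toOuterMeasure
          {l | a :: l ∈ {l : List (Result n) | List.Forall₂ R (q₀ :: qs) l ∧
            (l.map Result.out).take 0 ∈ A}} =
          ({a | R q₀ a} : Set (Result n)).indicator 1 a * x := by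
        intro a
        by_cases ha : R q₀ a
        · simp [Set.indicator, ha, hx]
        · rw [Set.indicator_of_notMem (by exact ha), zero_mul]
          convert measure_empty (μ := (runQueries K D r qs).toOuterMeasure) using 2
          ext l
          simp [ha]
      simp_rw [h1, h2, mean_mul_right]
      rw [← toOuterMeasure_eq_mean, ← toOuterMeasure_eq_mean, hR q₀ (by simp) p hp,
        ENNReal.div_eq_inv_mul]
      ring
    | succ i =>
      refine mean_congr _ fun a _ => ?_
      rw [List.getElem?_cons_succ] at hq
      have := ih (fun q hq => hR q (by simp [hq])) i hq {t | a.out :: t ∈ A}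
      by_cases ha : R q₀ a
      · rw [mul_comm, ← ENNReal.div_eq_inv_mul]
        simpa [ha] using this
      · have h0 : ∀ B : List (Result n) → Prop, (runQueries K D r qs).toOuterMeasure
            {l | a :: l ∈ {l : List (Result n) | List.Forall₂ R (q₀ :: qs) l ∧ B l}} = 0 := by
          intro B
          convert measure_empty (μ := (runQueries K D r qs).toOuterMeasure) using 2
          ext l
          simp [ha]
        rw [h0, h0, zero_mul]

open Classical in
theorem runQueries_not_forall_le {R : X → Result n → Prop} {ε : ℝ≥0∞} (qs : List X)
    (hR : ∀ q ∈ qs, mean (query K D r q) (fun a => if R q a then 0 else 1) ≤ ε) :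
    (runQueries K D r qs).toOuterMeasure {l | ¬ List.Forall₂ R qs l} ≤ qs.length * ε := by
  induction qs with
  | nil => simp [runQueries, toOuterMeasure_eq_mean, mean_pure]
  | cons q qs ih =>
    rw [runQueries_cons]
    have h1 : ∀ a : Result n, (runQueries K D r qs).toOuterMeasure
        {l | a :: l ∈ {l : List (Result n) | ¬ List.Forall₂ R (q :: qs) l}} ≤
        (if R q a then 0 else 1) + qs.length * ε := by
      intro a
      split_ifs with ha
      · rw [zero_add]
        simpa [ha] using ih fun q hq => hR q (by simp [hq])
      · refine le_add_right ?_
        rw [toOuterMeasure_eq_mean]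
        refine (mean_mono _ (g' := fun _ => 1) fun l _ => ?_).trans (mean_const _ 1).le
        exact Set.indicator_le_self' (fun _ _ => zero_le) _
    refine (mean_mono _ fun a _ => h1 a).trans ?_
    rw [mean_add, mean_const, List.length_cons, Nat.cast_succ, add_mul, one_mul, add_comm]
    exact add_le_add_right (hR q (by simp)) _

theorem runQueries_none (qs : List X) (i : ℕ) (q : X) (hq : qs[i]? = some q)
    (hnone : ∀ a, query K D r q a ≠ 0 → a.out = none) :
    (runQueries K D r qs).toOuterMeasure (outIs i none) = 1 := by
  induction qs generalizing i with
  | nil => simp at hq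
  | cons q₀ qs ih =>
    rw [runQueries_cons]
    refine (mean_congr _ fun a ha => ?_).trans (mean_const _ 1)
    cases i with
    | zero =>
      obtain rfl : q₀ = q := by simpa using hq
      have : {l | a :: l ∈ outIs 0 none} = Set.univ := by
        ext l; simp [outIs, hnone a ha]
      rw [this, PMF.toOuterMeasure_apply_eq_one_iff]
      exact Set.subset_univ _
    | succ i =>
      rw [List.getElem?_cons_succ] at hq
      rw [← ih i hq]
      rfl

end Sequence

/-! ### Independent sampling -/

/-- The event `E` is that the construction is good for all queries and that no query fails. -/
theorem solves {X U Ω : Type*} [MetricSpace X] [MeasurableSpace Ω] {μ : Measure Ω}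
    [IsProbabilityMeasure μ] {h : Ω → X → U} {n : ℕ} {S : Fin n ↪ X} {r R p₁ p₂ : ℝ}
    {law : PMF (Fin n → Fin (n ^ 3))} (hn : 2 ≤ n) (hr : 0 < r) (hp : 0 < p₁)
    (hμ : IsSensitive μ h r R p₁ p₂) (hlaw : PairwiseIndep law) :
    Solves (seedMeasure μ n (numTables params n p₁) (numLists params n) law)
      (fun ω => runQueries params (buildSeed params S h ω).val r) S r (1 / n) := by
  classical
  set L := numTables params n p₁
  set Δ := numLists params n with hΔ
  set P := seedMeasure μ n L Δ law
  have hΔ0 : 0 < Δ := Nat.mul_pos params.cΔ_pos (lg_pos hn)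
  have hn0 : (0 : ℝ) < n := by exact_mod_cast (by omega : 0 < n)
  have hn2 : (2 : ℝ) ≤ n := by exact_mod_cast hn
  intro qs hqs
  have hlen : (qs.length : ℝ) ≤ n := by exact_mod_cast hqs
  set ε : ℝ := ((n : ℝ) ^ 4)⁻¹ with hε
  have hε0 : 0 ≤ ε := by positivity
  set G : Set (Seed Ω n L Δ) := {ω | ∀ q ∈ qs, ω ∈ goodSeeds S r q h L Δ} with hG
  have hGeq : G = ⋂ i : Fin qs.length, goodSeeds S r qs[i] h L Δ := by
    ext ω
    simp only [hG, Set.mem_ofPred_eq, Set.mem_iInter]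
    constructor
    · intro h i; exact h _ (List.getElem_mem _)
    · intro h q hq
      obtain ⟨i, hi, rfl⟩ := List.mem_iff_getElem.1 hq
      exact h ⟨i, hi⟩
  have hGm : MeasurableSet G := by
    rw [hGeq]
    exact MeasurableSet.iInter fun i => measurableSet_goodSeeds S r _ hμ L Δ
  have hGc : P.real Gᶜ ≤ n * (3 * ε) := by
    rw [hGeq, Set.compl_iInter]
    refine (measureReal_iUnion_fintype_le _).trans ((Finset.sum_le_sum fun i _ =>
      measure_compl_goodSeeds_le S r qs[i] hn hr hp hμ hlaw).trans ?_)
    rw [Finset.sum_const, Finset.card_univ, Fintype.card_fin, nsmul_eq_mul]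
    gcongr
  refine ⟨{x | x.1 ∈ G ∧ List.Forall₂ (Succeeds S r) qs x.2}, fun l => ?_, ?_, ?_⟩
  · exact hGm.inter (MeasurableSet.const (List.Forall₂ (Succeeds S r) qs l))
  · -- both the choices of the construction and those of the queries are good
    have hrun : ∀ ω ∈ G, ENNReal.ofReal (1 - n * ε) ≤
        (runQueries params (buildSeed params S h ω).val r qs).toOuterMeasure
          {l | (ω, l) ∈ {x : Seed Ω n L Δ × List (Result n) |
            x.1 ∈ G ∧ List.Forall₂ (Succeeds S r) qs x.2}} := by
      intro ω hω
      have h1 := runQueries_not_forall_le (R := Succeeds S r) (ε := ENNReal.ofReal ε) qs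
        fun q hq => mean_query_not_succeeds_le hn hΔ0 (hω q hq)
      have h2 : (qs.length : ℝ≥0∞) * ENNReal.ofReal ε ≤ ENNReal.ofReal (n * ε) := by
        rw [ENNReal.ofReal_mul hn0.le, ENNReal.ofReal_natCast]
        gcongr
      have h3 : (1 : ℝ≥0∞) ≤
          (runQueries params (buildSeed params S h ω).val r qs).toOuterMeasure
            {l | List.Forall₂ (Succeeds S r) qs l} +
          (runQueries params (buildSeed params S h ω).val r qs).toOuterMeasure
            {l | ¬ List.Forall₂ (Succeeds S r) qs l} := by
        rw [toOuterMeasure_eq_mean, toOuterMeasure_eq_mean, ← mean_add,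
          ← mean_const (runQueries params (buildSeed params S h ω).val r qs) 1]
        refine mean_mono _ fun l _ => ?_
        by_cases hl : List.Forall₂ (Succeeds S r) qs l <;> simp [Set.indicator, hl]
      simp only [Set.mem_ofPred_eq, hω, true_and]
      rw [ENNReal.ofReal_sub _ (by positivity), ENNReal.ofReal_one]
      exact tsub_le_iff_right.2 (h3.trans (add_le_add_right (h1.trans h2) _))
    have hint : ENNReal.ofReal (1 - n * ε) * P G ≤ jointProb P
        (fun ω => runQueries params (buildSeed params S h ω).val r qs)
        {x | x.1 ∈ G ∧ List.Forall₂ (Succeeds S r) qs x.2} := by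
      rw [jointProb, ← setLIntegral_const]
      exact (setLIntegral_mono' hGm hrun).trans (setLIntegral_le_lintegral _ _)
    refine le_trans ?_ hint
    have hPG : ENNReal.ofReal (1 - n * (3 * ε)) ≤ P G := by
      rw [← ENNReal.ofReal_toReal (measure_ne_top P G)]
      refine ENNReal.ofReal_le_ofReal ?_
      have := probReal_compl_eq_one_sub (μ := P) hGm
      change _ ≤ P.real G
      linarith
    have hx : (n : ℝ) * ε ≤ 1 / n / 4 := by
      rw [hε, div_div, ← div_eq_mul_inv, div_le_div_iff₀ (by positivity) (by positivity)]
      nlinarith [mul_le_mul hn2 hn2 (by norm_num) hn0.le, sq_nonneg (n : ℝ)]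
    have hn1 : 1 / (n : ℝ) ≤ 1 := by rw [div_le_one hn0]; linarith
    have hnε : 0 ≤ (n : ℝ) * ε := by positivity
    calc ENNReal.ofReal (1 - 1 / n)
        ≤ ENNReal.ofReal ((1 - n * ε) * (1 - n * (3 * ε))) := by
          refine ENNReal.ofReal_le_ofReal ?_
          nlinarith [mul_nonneg hnε hnε]
      _ = ENNReal.ofReal (1 - n * ε) * ENNReal.ofReal (1 - n * (3 * ε)) :=
          ENNReal.ofReal_mul (by linarith)
      _ ≤ _ := mul_le_mul_right hPG _
  · intro i q hq
    have hqmem : q ∈ qs := List.mem_of_getElem? hq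
    have key : ∀ ω, ∀ p ∈ ball S q r, ∀ A : Set (List (Option (Fin n))),
        (runQueries params (buildSeed params S h ω).val r qs).toOuterMeasure
          {l | (ω ∈ G ∧ List.Forall₂ (Succeeds S r) qs l) ∧ (l.map Result.out).take i ∈ A ∧
            (l.map Result.out)[i]? = some (some p)} =
        (runQueries params (buildSeed params S h ω).val r qs).toOuterMeasure
          {l | (ω ∈ G ∧ List.Forall₂ (Succeeds S r) qs l) ∧ (l.map Result.out).take i ∈ A} /
            ballCard S q r := by
      intro ω p hpb A
      rw [mem_ball_iff] at hpb
      by_cases hω : ω ∈ G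
      · rw [ballCard_eq]
        simp only [hω, true_and]
        refine runQueries_uniform qs (fun q' hq' p' hp' => ?_) i q hq p hpb A
        rw [toOuterMeasure_eq_mean, toOuterMeasure_eq_mean]
        refine Eq.trans ?_ ((mean_query_uniform (hω q' hq') hp').trans ?_)
        · refine mean_congr _ fun a _ => ?_
          simp [Set.indicator]
        · congr 1
      · simp [hω]
    refine ⟨fun p hpb => ?_, fun p hpb past => ?_, fun ω p hpb past => ?_, fun hb ω => ?_⟩
    · simp only [jointProb, ENNReal.div_eq_inv_mul]
      rw [← lintegral_const_mul']
      · refine lintegral_congr fun ω => ?_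
        rw [← ENNReal.div_eq_inv_mul]
        simpa [outIs] using key ω p hpb Set.univ
      · rw [Ne, ENNReal.inv_eq_top, ballCard_eq]
        exact_mod_cast (Finset.card_pos.2 ⟨p, (mem_ball_iff S r q p).1 hpb⟩).ne'
    · simp only [jointProb, ENNReal.div_eq_inv_mul]
      rw [← lintegral_const_mul']
      · refine lintegral_congr fun ω => ?_
        rw [← ENNReal.div_eq_inv_mul]
        simpa [and_assoc, pastIs, outIs] using key ω p hpb {past}
      · rw [Ne, ENNReal.inv_eq_top, ballCard_eq]
        exact_mod_cast (Finset.card_pos.2 ⟨p, (mem_ball_iff S r q p).1 hpb⟩).ne'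
    · have := key ω p hpb {past}
      simp only [Set.mem_singleton_iff, ← and_assoc] at this
      exact this
    · refine runQueries_none qs i q hq fun a ha => ?_
      by_contra hne
      obtain ⟨p, hp'⟩ := Option.ne_none_iff_exists'.1 hne
      have := query_mem_near ha hp'
      rw [← mem_ball_iff, hb] at this
      exact this

/-! ### Query time -/

section QueryTime

variable {X U Ω : Type*} [MetricSpace X] {n L Δ : ℕ} {S : Fin n ↪ X} {r : ℝ} {q : X}
  {h : Ω → X → U} {ω : Seed Ω n L Δ}

/-- The total size of the buckets of the query `q`. -/
abbrev bucketsSize (S : Fin n ↪ X) (h : Ω → X → U) (q : X) (ω : Seed Ω n L Δ) : ℕ :=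
  totalSize (lookup params (buildSeed params S h ω).val q).val

omit [MetricSpace X] in
theorem bucketsSize_le : bucketsSize S h q ω ≤ n * L := by
  have := Finset.sum_le_card_nsmul Finset.univ
    (fun i => ((lookup params (buildSeed params S h ω).val q).val i).1.size) n
    fun i _ => (lookup_sorted params S _ ω.2.1 ω.2.2 q).size_le i
  exact this.trans (le_of_eq (by simp [mul_comm]))

omit [MetricSpace X] in
theorem startLevel_add_one_le (hn : 2 ≤ n) :
    startLevel params (buildSeed params S h ω).val q + 1 ≤ 5 * lg n := by
  have h1 := estimateCollisions_le params hn (lookup params (buildSeed params S h ω).val q).val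
  rw [startLevel]
  set est := (estimateCollisions params (lookup params (buildSeed params S h ω).val q).val).val
  have h2 : ⌈2 * est⌉₊ ≤ 2 ^ (3 * lg n + 1) := by
    refine Nat.ceil_le.2 ?_
    have h3 : (n : ℚ) ≤ 2 ^ lg n := by exact_mod_cast Nat.le_pow_clog one_lt_two n
    have h4 : (n : ℚ) ^ 3 ≤ 2 ^ (3 * lg n) := by
      rw [mul_comm 3, pow_mul]; gcongr
    have h5 : est ≤ (n : ℚ) ^ 3 := by simpa [params] using h1
    push_cast
    rw [pow_succ]
    linarith
  have h3 := Nat.clog_mono_right 2 h2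
  rw [Nat.clog_pow 2 _ one_lt_two] at h3
  have := lg_pos hn
  omega

theorem roundCost_le (hn : 2 ≤ n) (hL : 0 < L) (b : Fin L → Array (Fin n) × Sketch Δ) (e : ℕ) :
    roundCost b e ≤ (13 * L * lg n : ℕ) + 5 * (totalSize b : ℝ≥0∞) / (2 ^ e : ℕ) := by
  refine add_le_add_left ?_ _
  have := lg_pos hn
  have h1 : L * (3 * lg n + 7) + 3 ≤ 13 * L * lg n := by nlinarith [Nat.mul_le_mul hL this]
  exact_mod_cast h1

/-- A bound for the duration of a search in the worst case. -/
def worstCost (n L : ℕ) : ℕ :=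
  5 * lg n * (1600 * lg n ^ 2 * (13 * L * lg n + 5 * (n * L)) + 1)

omit [MetricSpace X] in
theorem mul_roundCost_zero_le (hn : 2 ≤ n) (hL : 0 < L) {e : ℕ} (he : e + 1 ≤ 5 * lg n) :
    ((e : ℝ≥0∞) + 1) * ((params.cσ * lg n ^ 2 : ℕ) *
      roundCost (lookup params (buildSeed params S h ω).val q).val 0 + 1) ≤ worstCost n L := by
  have h1 : ((e : ℝ≥0∞) + 1) ≤ (5 * lg n : ℕ) := by exact_mod_cast he
  have h2 : roundCost (lookup params (buildSeed params S h ω).val q).val 0 ≤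
      (13 * L * lg n + 5 * (n * L) : ℕ) := by
    refine (roundCost_le hn hL _ 0).trans ?_
    rw [pow_zero, Nat.cast_one, div_one]
    have := bucketsSize_le (S := S) (h := h) (q := q) (ω := ω)
    exact_mod_cast Nat.add_le_add_left (Nat.mul_le_mul_left 5 this) _
  refine (mul_le_mul' h1 (add_le_add_left (mul_le_mul_right h2 _) 1)).trans (le_of_eq ?_)
  simp only [worstCost, params]
  push_cast
  ring

/-- The expected duration of the search on given random choices of the construction. -/
theorem cost_query_search_le (hn : 2 ≤ n) (hL : 0 < L) (hΔ : 0 < Δ) :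
    (search (buildSeed params S h ω).val q r
      (lookup params (buildSeed params S h ω).val q).val (params.cl * lg n)
      (params.cσ * lg n ^ 2) (startLevel params (buildSeed params S h ω).val q)).cost ≤
    (5 * lg n * (1600 * lg n ^ 2 * (13 * L * lg n) + 1) : ℕ) +
      (5 * lg n * (1600 * lg n ^ 2 * 160) : ℕ) *
        ((bucketsSize S h q ω : ℝ≥0∞) / (max (near S r q).card 1 : ℕ)) +
      (ENNReal.ofReal (((n : ℝ) ^ 4)⁻¹) + (goodSeeds S r q h L Δ)ᶜ.indicator 1 ω) *
        worstCost n L := by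
  have hb : SortedBuckets (buildSeed params S h ω).val.rank
      (lookup params (buildSeed params S h ω).val q).val :=
    lookup_sorted params S (fun i => h (ω.1 i)) ω.2.1 ω.2.2 q
  have he := startLevel_add_one_le (S := S) (h := h) (q := q) (ω := ω) hn
  by_cases hω : ω ∈ goodSeeds S r q h L Δ
  swap
  · refine (cost_search_le hn hb _ _).trans ((mul_roundCost_zero_le hn hL he).trans ?_)
    rw [Set.indicator_of_mem (by exact hω)]
    refine le_add_left (le_mul_of_one_le_left' ?_)
    exact le_add_self
  have he' : ((startLevel params (buildSeed params S h ω).val q : ℝ≥0∞) + 1) ≤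
      (5 * lg n : ℕ) := by exact_mod_cast he
  -- the bound for the levels with sufficiently many segments
  have main : ∀ e, (near S r q).card ≤ 32 * 2 ^ e →
      ((startLevel params (buildSeed params S h ω).val q : ℝ≥0∞) + 1) *
        ((params.cσ * lg n ^ 2 : ℕ) *
          roundCost (lookup params (buildSeed params S h ω).val q).val e + 1) ≤
      (5 * lg n * (1600 * lg n ^ 2 * (13 * L * lg n) + 1) : ℕ) +
        (5 * lg n * (1600 * lg n ^ 2 * 160) : ℕ) *
          ((bucketsSize S h q ω : ℝ≥0∞) / (max (near S r q).card 1 : ℕ)) := by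
    intro e hcard
    have h1 : 5 * (bucketsSize S h q ω : ℝ≥0∞) / (2 ^ e : ℕ) ≤
        160 * ((bucketsSize S h q ω : ℝ≥0∞) / (max (near S r q).card 1 : ℕ)) := by
      have hle : max (near S r q).card 1 ≤ 32 * 2 ^ e :=
        max_le hcard (by have := Nat.two_pow_pos e; omega)
      have hinv : ((2 ^ e : ℕ) : ℝ≥0∞)⁻¹ ≤ 32 * ((max (near S r q).card 1 : ℕ) : ℝ≥0∞)⁻¹ := by
        rw [← ENNReal.div_eq_inv_mul.trans (mul_comm _ _)]
        rw [ENNReal.le_div_iff_mul_le (Or.inl (by simp)) (Or.inl (by simp)), mul_comm,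
          ← div_eq_mul_inv]
        refine ENNReal.div_le_of_le_mul ?_
        exact_mod_cast hle
      calc 5 * (bucketsSize S h q ω : ℝ≥0∞) / (2 ^ e : ℕ)
          ≤ 5 * (bucketsSize S h q ω : ℝ≥0∞) *
            (32 * ((max (near S r q).card 1 : ℕ) : ℝ≥0∞)⁻¹) := mul_le_mul_right hinv _
        _ = _ := by rw [div_eq_mul_inv]; ring
    refine (mul_le_mul' he' (add_le_add_left (mul_le_mul_right
      ((roundCost_le hn hL _ e).trans (add_le_add_right h1 _)) _) 1)).trans (le_of_eq ?_)
    simp only [params]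
    push_cast
    ring
  rw [Set.indicator_of_notMem (by simpa using hω), add_zero]
  by_cases hne : (near S r q).Nonempty
  · obtain ⟨e, h1, h2, h3, h4⟩ := exists_level hn hΔ hω hne
    refine (cost_search_le_of_le hn hb _ h1 h2).trans (add_le_add (main e h3) ?_)
    exact mul_le_mul' (rejectProb_pow_le hn hω h3 h4) (mul_roundCost_zero_le hn hL (by omega))
  · rw [Finset.not_nonempty_iff_eq_empty] at hne
    exact (cost_search_le hn hb _ _).trans ((main 0 (by simp [hne])).trans le_self_add)

/-- The expected duration of a query on given random choices of the construction. -/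
theorem mean_query_time_le (hn : 2 ≤ n) (hL : 0 < L) (hΔ : Δ = numLists params n) :
    mean (query params (buildSeed params S h ω).val r q) (fun a => (a.time : ℝ≥0∞)) ≤
    (82 * L * lg n ^ 2 + 5 * lg n * (1600 * lg n ^ 2 * (13 * L * lg n) + 1) : ℕ) +
      (5 * lg n * (1600 * lg n ^ 2 * 160) : ℕ) *
        ((bucketsSize S h q ω : ℝ≥0∞) / (max (near S r q).card 1 : ℕ)) +
      (ENNReal.ofReal (((n : ℝ) ^ 4)⁻¹) + (goodSeeds S r q h L Δ)ᶜ.indicator 1 ω) *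
        worstCost n L := by
  have hlg := lg_pos hn
  have hΔ' : Δ = 4 * lg n := hΔ
  have hΔ0 : 0 < Δ := by omega
  have h1 : (lookup params (buildSeed params S h ω).val q).time ≤ 24 * L * lg n ^ 2 := by
    refine (lookup_time_le params S (fun i => h (ω.1 i)) ω.2.1 ω.2.2 q hn).trans ?_
    rw [hΔ', mul_comm 24, mul_assoc L 24]
    refine Nat.mul_le_mul_left L ?_
    simp only [params]
    nlinarith
  have h2 : (estimateCollisions params
      (lookup params (buildSeed params S h ω).val q).val).time ≤ 53 * L * lg n ^ 2 := by
    refine (estimateCollisions_time_le params fun i w => ?_).trans ?_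
    · have := lookup_sketch params S (fun i => h (ω.1 i)) ω.2.1 ω.2.2 q hn i
      change (((lookup params (build params S _ ω.2.1 ω.2.2).val q).val i).2 w).length ≤ _
      rw [this]
      exact Sketch.length_ofPoints_le _ _ _ _
    · rw [hΔ']
      simp only [params]
      have h3 : lg n ≤ lg n ^ 2 := Nat.le_self_pow (by norm_num) _
      have h4 : 1 ≤ lg n ^ 2 := Nat.one_le_pow _ _ hlg
      have h5 : 4 * lg n * (4 * lg n + 1 + 4) ≤ 36 * lg n ^ 2 := by nlinarith
      have h6 : 36 * lg n ^ 2 ≤ L * (36 * lg n ^ 2) := Nat.le_mul_of_pos_left _ hL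
      have h7 : L * (1 + 4 * lg n * (1 + 1 * (1 + 2 * 1))) ≤ L * (17 * lg n ^ 2) :=
        Nat.mul_le_mul_left _ (by omega)
      calc _ ≤ L * (17 * lg n ^ 2) + L * (36 * lg n ^ 2) := Nat.add_le_add h7 (h5.trans h6)
        _ = _ := by ring
  have h3 : startLevel params (buildSeed params S h ω).val q + 1 ≤ 5 * L * lg n ^ 2 := by
    refine (startLevel_add_one_le hn).trans ?_
    have h3 : lg n ≤ lg n ^ 2 := Nat.le_self_pow (by norm_num) _
    nlinarith [Nat.mul_le_mul hL h3]
  rw [mean_query_time, ← add_assoc, ← add_assoc]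
  refine (add_le_add (b := ((82 * L * lg n ^ 2 : ℕ) : ℝ≥0∞)) ?_
    (cost_query_search_le hn hL hΔ0)).trans (le_of_eq ?_)
  · have : (lookup params (buildSeed params S h ω).val q).time +
        (estimateCollisions params (lookup params (buildSeed params S h ω).val q).val).time +
        (startLevel params (buildSeed params S h ω).val q + 1) ≤ 82 * L * lg n ^ 2 := by
      linarith
    exact_mod_cast this
  · push_cast
    ring

end QueryTime

section Expectation

variable {X U Ω : Type*} [MetricSpace X] [MeasurableSpace Ω] {μ : Measure Ω}
  [IsProbabilityMeasure μ] {h : Ω → X → U} {n : ℕ} {S : Fin n ↪ X} {r c p₁ p₂ : ℝ} {q : X}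
  {law : PMF (Fin n → Fin (n ^ 3))}

omit [MetricSpace X] [MeasurableSpace Ω] in
theorem bucketsSize_eq {L Δ : ℕ} (ω : Seed Ω n L Δ) :
    (bucketsSize S h q ω : ℝ≥0∞) = ∑ i : Fin L, ∑ p : Fin n,
      {ω : Seed Ω n L Δ | h (ω.1 i) (S p) = h (ω.1 i) q}.indicator 1 ω := by
  classical
  have h1 : ∀ i, ((lookup params (buildSeed params S h ω).val q).val i).1.size =
      ∑ p : Fin n, if h (ω.1 i) (S p) = h (ω.1 i) q then 1 else 0 := by
    intro i
    rw [← Array.length_toList]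
    have := lookup_bucket params S (fun i => h (ω.1 i)) ω.2.1 ω.2.2 q i
    change ((lookup params (build params S (fun i => h (ω.1 i)) ω.2.1 ω.2.2).val q).val
      i).1.toList.length = _
    rw [this, ← List.toFinset_card_of_nodup ((nodup_byRank _).filter _), ← Finset.card_filter]
    congr 1
    ext p
    simp [mem_byRank]
  rw [bucketsSize, totalSize]
  push_cast
  refine Finset.sum_congr rfl fun i _ => ?_
  rw [h1]
  push_cast
  refine Finset.sum_congr rfl fun p _ => ?_
  simp [Set.indicator]

/-- The probability that a point collides with the query in a given table. -/
theorem measure_collision (hμ : IsSensitive μ h r (c * r) p₁ p₂) {L Δ : ℕ} (i : Fin L) (x y : X) :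
    MeasurableSet {ω : Seed Ω n L Δ | h (ω.1 i) x = h (ω.1 i) y} ∧
      seedMeasure μ n L Δ law {ω | h (ω.1 i) x = h (ω.1 i) y} = μ {ω | h ω x = h ω y} := by
  have hm := hμ.measurable_collision x y
  have hp : MeasurePreserving (fun ω : Seed Ω n L Δ => ω.1 i) (seedMeasure μ n L Δ law) μ :=
    (measurePreserving_eval (fun _ : Fin L => μ) i).comp measurePreserving_fst
  exact ⟨hp.measurable hm, hp.measure_preimage hm.nullMeasurableSet⟩

/-- A far point collides with probability at most `p₂`, a point of the outer ball with probability
at most `p₁`, and nothing is assumed about the points of the inner ball. -/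
theorem sum_collision_le (hμ : IsSensitive μ h r (c * r) p₁ p₂) (hp₁ : 0 ≤ p₁) (hp₂ : 0 ≤ p₂)
    (hmid : ∀ x y : X, r < dist x y → dist x y ≤ c * r → μ.real {ω | h ω x = h ω y} ≤ p₁) :
    ∑ p : Fin n, μ.real {ω | h ω (S p) = h ω q} ≤
      (near S r q).card + p₁ * (near S (c * r) q).card + p₂ * n := by
  classical
  have h1 : ∀ p, μ.real {ω | h ω (S p) = h ω q} ≤
      (if p ∈ near S r q then 1 else 0) + p₁ * (if p ∈ near S (c * r) q then 1 else 0) + p₂ := by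
    intro p
    simp only [mem_near]
    by_cases h1 : dist (S p) q ≤ r
    · have : μ.real {ω | h ω (S p) = h ω q} ≤ 1 := measureReal_le_one
      rw [if_pos h1]
      split_ifs <;> linarith
    · by_cases h2 : dist (S p) q ≤ c * r
      · have := hmid _ _ (not_le.1 h1) h2
        rw [if_neg h1, if_pos h2]
        linarith
      · have := hμ.far _ _ (not_le.1 h2)
        rw [if_neg h1, if_neg h2]
        linarith
  refine (Finset.sum_le_sum fun p _ => h1 p).trans (le_of_eq ?_)
  rw [Finset.sum_add_distrib, Finset.sum_add_distrib, ← Finset.mul_sum]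
  simp [mul_comm p₂]

theorem lintegral_bucketsSize_le (hμ : IsSensitive μ h r (c * r) p₁ p₂) (hp₁ : 0 ≤ p₁)
    (hp₂ : 0 ≤ p₂)
    (hmid : ∀ x y : X, r < dist x y → dist x y ≤ c * r → μ.real {ω | h ω x = h ω y} ≤ p₁)
    (L Δ : ℕ) :
    ∫⁻ ω, (bucketsSize S h q ω : ℝ≥0∞) ∂(seedMeasure μ n L Δ law) ≤
      ENNReal.ofReal (L * ((near S r q).card + p₁ * (near S (c * r) q).card + p₂ * n)) := by
  simp_rw [bucketsSize_eq]
  rw [lintegral_finsetSum _ fun i _ => Finset.measurable_sum _ fun p _ =>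
    measurable_one.indicator (measure_collision (law := law) hμ i _ _).1]
  have h1 : ∀ i : Fin L, ∫⁻ ω, ∑ p : Fin n,
      {ω : Seed Ω n L Δ | h (ω.1 i) (S p) = h (ω.1 i) q}.indicator 1 ω
        ∂(seedMeasure μ n L Δ law) ≤
      ENNReal.ofReal ((near S r q).card + p₁ * (near S (c * r) q).card + p₂ * n) := by
    intro i
    rw [lintegral_finsetSum _ fun p _ =>
      measurable_one.indicator (measure_collision (law := law) hμ i _ _).1]
    refine le_trans (le_of_eq ?_) (ENNReal.ofReal_le_ofReal
      (sum_collision_le (S := S) (q := q) hμ hp₁ hp₂ hmid))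
    rw [ENNReal.ofReal_sum_of_nonneg fun _ _ => measureReal_nonneg]
    refine Finset.sum_congr rfl fun p _ => ?_
    obtain ⟨hm, he⟩ := measure_collision (law := law) (n := n) (Δ := Δ) hμ i (S p) q
    rw [lintegral_indicator_one hm, he, Measure.real, ENNReal.ofReal_toReal (measure_ne_top _ _)]
  refine (Finset.sum_le_sum fun i _ => h1 i).trans (le_of_eq ?_)
  rw [Finset.sum_const, Finset.card_univ, Fintype.card_fin, nsmul_eq_mul,
    ENNReal.ofReal_mul (by positivity), ENNReal.ofReal_natCast]

theorem measurable_bucketsSize (hμ : IsSensitive μ h r (c * r) p₁ p₂) (L Δ : ℕ) :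
    Measurable fun ω : Seed Ω n L Δ => (bucketsSize S h q ω : ℝ≥0∞) := by
  simp_rw [bucketsSize_eq]
  exact Finset.measurable_sum _ fun i _ => Finset.measurable_sum _ fun p _ =>
    measurable_one.indicator (measure_collision (law := PMF.pure fun _ => ⟨0, by
      have := p.pos; positivity⟩) hμ i _ _).1

/-- The expected query time in terms of the number of tables and the numbers of near points. -/
theorem expectedQueryTime_le (hn : 2 ≤ n) (hr : 0 < r) (hp₁ : 0 < p₁) (hp₂ : 0 ≤ p₂)
    (hμ : IsSensitive μ h r (c * r) p₁ p₂) (hlaw : PairwiseIndep law)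
    (hmid : ∀ x y : X, r < dist x y → dist x y ≤ c * r → μ.real {ω | h ω x = h ω y} ≤ p₁)
    (hL : 0 < numTables params n p₁) :
    expectedQueryTime (numTables params n p₁) (numLists params n) params μ h law S r q ≤
      ENNReal.ofReal (
        (82 * numTables params n p₁ * lg n ^ 2 +
          5 * lg n * (1600 * lg n ^ 2 * (13 * numTables params n p₁ * lg n) + 1) : ℕ) +
        (5 * lg n * (1600 * lg n ^ 2 * 160) : ℕ) *
          (numTables params n p₁ * ((near S r q).card + p₁ * (near S (c * r) q).card + p₂ * n) /
            (max (near S r q).card 1 : ℕ)) +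
        4 * ((n : ℝ) ^ 4)⁻¹ * worstCost n (numTables params n p₁)) := by
  set L := numTables params n p₁ with hLdef
  set Δ := numLists params n with hΔ
  set P := seedMeasure μ n L Δ law with hP
  set c₀ : ℕ := 82 * L * lg n ^ 2 + 5 * lg n * (1600 * lg n ^ 2 * (13 * L * lg n) + 1)
  set c₁ : ℕ := 5 * lg n * (1600 * lg n ^ 2 * 160)
  set b : ℕ := max (near S r q).card 1
  have hb : 0 < b := lt_max_of_lt_right one_pos
  set ε : ℝ := ((n : ℝ) ^ 4)⁻¹ with hε
  have hε0 : 0 ≤ ε := by positivity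
  set B : ℝ := L * ((near S r q).card + p₁ * (near S (c * r) q).card + p₂ * n) with hB
  have hB0 : 0 ≤ B := by positivity
  have hgood := measurableSet_goodSeeds S r q hμ L Δ
  have hbad : P (goodSeeds S r q h L Δ)ᶜ ≤ ENNReal.ofReal (3 * ε) := by
    rw [← ENNReal.ofReal_toReal (measure_ne_top P _)]
    exact ENNReal.ofReal_le_ofReal (measure_compl_goodSeeds_le S r q hn hr hp₁ hμ hlaw)
  have hm1 : Measurable fun ω : Seed Ω n L Δ =>
      (c₁ : ℝ≥0∞) * ((bucketsSize S h q ω : ℝ≥0∞) / (b : ℕ)) :=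
    ((measurable_bucketsSize hμ L Δ).div_const _).const_mul _
  have hm2 : Measurable fun ω : Seed Ω n L Δ =>
      (c₀ : ℝ≥0∞) + c₁ * ((bucketsSize S h q ω : ℝ≥0∞) / (b : ℕ)) := measurable_const.add hm1
  have hm3 : Measurable fun ω : Seed Ω n L Δ =>
      ENNReal.ofReal ε + (goodSeeds S r q h L Δ)ᶜ.indicator 1 ω :=
    (measurable_one.indicator hgood.compl).const_add _
  calc expectedQueryTime L Δ params μ h law S r q
      ≤ ∫⁻ ω, ((c₀ : ℝ≥0∞) + c₁ * ((bucketsSize S h q ω : ℝ≥0∞) / (b : ℕ)) +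
          (ENNReal.ofReal ε + (goodSeeds S r q h L Δ)ᶜ.indicator 1 ω) * worstCost n L) ∂P :=
        lintegral_mono fun ω => mean_query_time_le hn hL hΔ
    _ = c₀ + c₁ * ((∫⁻ ω, (bucketsSize S h q ω : ℝ≥0∞) ∂P) / (b : ℕ)) +
          (ENNReal.ofReal ε + P (goodSeeds S r q h L Δ)ᶜ) * worstCost n L := by
        rw [lintegral_add_left hm2, lintegral_add_left measurable_const,
          lintegral_const_mul _ ((measurable_bucketsSize hμ L Δ).div_const _),
          lintegral_mul_const _ hm3,
          lintegral_add_left measurable_const, lintegral_indicator_one hgood.compl]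
        simp only [lintegral_const, measure_univ, mul_one, div_eq_mul_inv]
        rw [lintegral_mul_const _ (measurable_bucketsSize hμ L Δ)]
    _ ≤ c₀ + c₁ * (ENNReal.ofReal B / (b : ℕ)) +
          (ENNReal.ofReal ε + ENNReal.ofReal (3 * ε)) * worstCost n L := by
        gcongr
        exact lintegral_bucketsSize_le hμ hp₁.le hp₂ hmid L Δ
    _ = ENNReal.ofReal (c₀ + c₁ * (B / b) + 4 * ε * worstCost n L) := by
        clear_value B
        rw [ENNReal.ofReal_add (by positivity) (by positivity),
          ENNReal.ofReal_add (by positivity) (by positivity),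
          ENNReal.ofReal_mul (p := (c₁ : ℝ)) (by positivity),
          ENNReal.ofReal_mul (p := 4 * ε) (by positivity),
          ENNReal.ofReal_div_of_pos (by exact_mod_cast hb), ← ENNReal.ofReal_add hε0 (by positivity)]
        simp only [ENNReal.ofReal_natCast]
        congr 3
        ring

end Expectation

/-! ### The order of magnitude of the parameters -/

section Magnitude

variable {n : ℕ}

theorem half_le_log (hn : 2 ≤ n) : 1 / 2 ≤ Real.log n := by
  have h1 : Real.log 2 ≤ Real.log n := Real.log_le_log two_pos (by exact_mod_cast hn)
  linarith [Real.log_two_gt_d9]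

theorem lg_le (hn : 2 ≤ n) : (lg n : ℝ) ≤ 3 * Real.log n := by
  have h1 : 2 ^ (lg n - 1) ≤ n := (Nat.pow_pred_clog_lt_self one_lt_two (by omega)).le
  have h2 : ((lg n - 1 : ℕ) : ℝ) * Real.log 2 ≤ Real.log n := by
    rw [← Real.log_pow]
    exact Real.log_le_log (by positivity) (by exact_mod_cast h1)
  have h3 : Real.log 2 ≤ Real.log n := Real.log_le_log two_pos (by exact_mod_cast hn)
  have h4 := Real.log_two_gt_d9
  rw [Nat.cast_sub (lg_pos hn), Nat.cast_one] at h2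
  have h5 : (0 : ℝ) ≤ lg n := by positivity
  nlinarith

theorem log_le_lg (hn : 2 ≤ n) : Real.log n ≤ lg n := by
  have h1 : Real.log n ≤ lg n * Real.log 2 := by
    rw [← Real.log_pow]
    exact Real.log_le_log (by exact_mod_cast (by omega : 0 < n)) (le_two_pow_lg n)
  have h2 := Real.log_two_lt_d9
  have h3 : (0 : ℝ) ≤ lg n := by positivity
  nlinarith

variable {a b p₁ p₂ : ℝ}

theorem log_div_log_mem (hp₂ : 0 < p₂) (hlt : p₂ < p₁) (hp₁ : p₁ ≤ 1) :
    0 ≤ Real.log p₁ / Real.log p₂ ∧ Real.log p₁ / Real.log p₂ ≤ 1 := by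
  have h1 : Real.log p₂ < 0 := Real.log_neg hp₂ (hlt.trans_le hp₁)
  have h2 : Real.log p₁ ≤ 0 := Real.log_nonpos (hp₂.trans hlt).le hp₁
  exact ⟨div_nonneg_of_nonpos h2 h1.le,
    (div_le_one_of_neg h1).2 (Real.log_le_log hp₂ hlt.le)⟩

theorem one_div_eq_rpow (hp₂ : 0 < p₂) (hlt : p₂ < p₁) (hp₁ : p₁ ≤ 1) :
    1 / p₁ = (1 / p₂) ^ (Real.log p₁ / Real.log p₂) := by
  have h1 : Real.log p₂ < 0 := Real.log_neg hp₂ (hlt.trans_le hp₁)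
  rw [Real.rpow_def_of_pos (by positivity), one_div p₂, Real.log_inv, one_div,
    ← Real.exp_log (inv_pos.2 (hp₂.trans hlt)), Real.log_inv]
  congr 1
  have h2 := h1.ne
  field_simp

theorem rpow_le_max {x ρ : ℝ} (hx : 0 < x) (h0 : 0 ≤ ρ) (h1 : ρ ≤ 1) : x ^ ρ ≤ max 1 x := by
  rcases le_total x 1 with h | h
  · exact (Real.rpow_le_one hx.le h h0).trans (le_max_left _ _)
  · exact (Real.rpow_le_rpow_of_exponent_le h h1).trans
      ((Real.rpow_one x).le.trans (le_max_right _ _))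

theorem min_le_rpow {x ρ : ℝ} (hx : 0 < x) (h0 : 0 ≤ ρ) (h1 : ρ ≤ 1) : min 1 x ≤ x ^ ρ := by
  rcases le_total x 1 with h | h
  · exact (min_le_right _ _).trans ((Real.rpow_one x).ge.trans
      (Real.rpow_le_rpow_of_exponent_ge hx h h1))
  · exact (min_le_left _ _).trans (Real.one_le_rpow h h0)

theorem one_div_le (hn : 2 ≤ n) (ha : 0 < a) (hap : a / n ≤ p₂) (hlt : p₂ < p₁) (hp₁ : p₁ ≤ 1) :
    1 / p₁ ≤ max 1 (1 / a) * (n : ℝ) ^ (Real.log p₁ / Real.log p₂) := by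
  have hn' : (0 : ℝ) < n := by exact_mod_cast (by omega : 0 < n)
  have hp₂ : 0 < p₂ := (div_pos ha hn').trans_le hap
  obtain ⟨h0, h1⟩ := log_div_log_mem hp₂ hlt hp₁
  rw [one_div_eq_rpow hp₂ hlt hp₁]
  have h2 : 1 / p₂ ≤ 1 / a * n := by
    rw [div_mul_eq_mul_div, one_mul, div_le_div_iff₀ hp₂ ha, one_mul]
    rw [div_le_iff₀ hn'] at hap
    linarith
  calc (1 / p₂) ^ (Real.log p₁ / Real.log p₂) ≤ (1 / a * n) ^ (Real.log p₁ / Real.log p₂) :=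
        Real.rpow_le_rpow (by positivity) h2 h0
    _ = (1 / a) ^ (Real.log p₁ / Real.log p₂) * (n : ℝ) ^ (Real.log p₁ / Real.log p₂) :=
        Real.mul_rpow (by positivity) hn'.le
    _ ≤ _ := by
        gcongr
        exact rpow_le_max (by positivity) h0 h1

theorem le_one_div (hn : 2 ≤ n) (hp₂ : 0 < p₂) (hpb : p₂ ≤ b / n) (hlt : p₂ < p₁) (hp₁ : p₁ ≤ 1) :
    min 1 (1 / b) * (n : ℝ) ^ (Real.log p₁ / Real.log p₂) ≤ 1 / p₁ := by
  have hn' : (0 : ℝ) < n := by exact_mod_cast (by omega : 0 < n)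
  obtain ⟨h0, h1⟩ := log_div_log_mem hp₂ hlt hp₁
  rw [le_div_iff₀ hn'] at hpb
  have hb : 0 < b := (mul_pos hp₂ hn').trans_le hpb
  rw [one_div_eq_rpow hp₂ hlt hp₁]
  have h2 : 1 / b * n ≤ 1 / p₂ := by
    rw [div_mul_eq_mul_div, one_mul, div_le_div_iff₀ hb hp₂, one_mul]
    linarith
  calc min 1 (1 / b) * (n : ℝ) ^ (Real.log p₁ / Real.log p₂)
      ≤ (1 / b) ^ (Real.log p₁ / Real.log p₂) * (n : ℝ) ^ (Real.log p₁ / Real.log p₂) := by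
        gcongr
        exact min_le_rpow (by positivity) h0 h1
    _ = (1 / b * n) ^ (Real.log p₁ / Real.log p₂) :=
        (Real.mul_rpow (by positivity) hn'.le).symm
    _ ≤ _ := Real.rpow_le_rpow (by positivity) h2 h0

theorem le_numTables_mul (hp : 0 < p₁) : 5 * (lg n : ℝ) ≤ numTables params n p₁ * p₁ := by
  have : (params.cL * lg n / p₁ : ℝ) ≤ numTables params n p₁ := Nat.le_ceil _
  rw [div_le_iff₀ hp] at this
  simpa [params] using this

theorem numTables_mul_le (hn : 2 ≤ n) (hp : 0 < p₁) (hp₁ : p₁ ≤ 1) :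
    numTables params n p₁ * p₁ ≤ 6 * lg n := by
  have h1 : (numTables params n p₁ : ℝ) < params.cL * lg n / p₁ + 1 :=
    Nat.ceil_lt_add_one (by positivity)
  have h2 : params.cL * lg n / p₁ * p₁ = 5 * lg n := by
    rw [div_mul_cancel₀ _ hp.ne']; simp [params]
  have h3 : (1 : ℝ) ≤ lg n := by exact_mod_cast lg_pos hn
  nlinarith

theorem numTables_pos (hn : 2 ≤ n) (hp : 0 < p₁) : 0 < numTables params n p₁ := by
  refine Nat.ceil_pos.2 (div_pos ?_ hp)
  exact_mod_cast Nat.mul_pos params.cL_pos (lg_pos hn)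

theorem numTables_le (hn : 2 ≤ n) (ha : 0 < a) (hap : a / n ≤ p₂) (hlt : p₂ < p₁)
    (hp₁ : p₁ ≤ 1) :
    (numTables params n p₁ : ℝ) ≤
      18 * max 1 (1 / a) * ((n : ℝ) ^ (Real.log p₁ / Real.log p₂) * Real.log n) := by
  have hn' : (0 : ℝ) < n := by exact_mod_cast (by omega : 0 < n)
  have hp : 0 < p₁ := ((div_pos ha hn').trans_le hap).trans hlt
  calc (numTables params n p₁ : ℝ) ≤ 6 * lg n * (1 / p₁) := by
        rw [mul_one_div, le_div_iff₀ hp]; exact numTables_mul_le hn hp hp₁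
    _ ≤ 6 * (3 * Real.log n) * (max 1 (1 / a) * (n : ℝ) ^ (Real.log p₁ / Real.log p₂)) := by
        gcongr
        · exact lg_le hn
        · exact one_div_le hn ha hap hlt hp₁
    _ = _ := by ring

theorem le_numTables (hn : 2 ≤ n) (hp₂ : 0 < p₂) (hpb : p₂ ≤ b / n) (hlt : p₂ < p₁)
    (hp₁ : p₁ ≤ 1) :
    5 * min 1 (1 / b) * ((n : ℝ) ^ (Real.log p₁ / Real.log p₂) * Real.log n) ≤
      numTables params n p₁ := by
  have hp : 0 < p₁ := hp₂.trans hlt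
  have hlog := half_le_log hn
  calc 5 * min 1 (1 / b) * ((n : ℝ) ^ (Real.log p₁ / Real.log p₂) * Real.log n)
      = 5 * Real.log n * (min 1 (1 / b) * (n : ℝ) ^ (Real.log p₁ / Real.log p₂)) := by ring
    _ ≤ 5 * Real.log n * (1 / p₁) := by
        refine mul_le_mul_of_nonneg_left (le_one_div hn hp₂ hpb hlt hp₁) (by linarith)
    _ ≤ 5 * lg n * (1 / p₁) := by
        gcongr
        exact log_le_lg hn
    _ ≤ _ := by
        rw [mul_one_div, div_le_iff₀ hp]; exact le_numTables_mul hp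

end Magnitude

section Bounds

variable {X U Ω : Type*} {n L Δ : ℕ} {S : Fin n ↪ X} {h : Ω → X → U}

theorem lg_le_self (n : ℕ) : lg n ≤ n := Nat.clog_le_of_le_pow (Nat.lt_two_pow_self).le

theorem words_le (hn : 2 ≤ n) (hL : 0 < L) (hΔ : Δ = numLists params n) (ω : Seed Ω n L Δ) :
    (buildSeed params S h ω).val.words ≤ 20 * (n * L) := by
  refine (buildWords_le params S (fun i => h (ω.1 i)) ω.2.1 ω.2.2 hn hΔ).trans ?_
  have h1 : Δ = 4 * lg n := hΔ
  have h2 := lg_le_self n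
  have h3 : n ≤ n * L := Nat.le_mul_of_pos_right _ hL
  have h4 : L ≤ n * L := Nat.le_mul_of_pos_left _ (by omega)
  simp only [params]
  nlinarith

theorem time_le (hn : 2 ≤ n) (hL : 0 < L) (hΔ : Δ = numLists params n) (ω : Seed Ω n L Δ) :
    (buildSeed params S h ω).time ≤ 37 * (n * L * lg n) := by
  refine (build_time_le params S (fun i => h (ω.1 i)) ω.2.1 ω.2.2).trans ?_
  have h1 : Δ = 4 * lg n := hΔ
  have hlg := lg_pos hn
  have h2 := lg_le_self n
  have h3 : n ≤ n * L := Nat.le_mul_of_pos_right _ hL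
  have h4 : L ≤ n * L := Nat.le_mul_of_pos_left _ (by omega)
  have h5 : n * L ≤ n * L * lg n := Nat.le_mul_of_pos_right _ hlg
  rw [h1]
  simp only [params]
  have h6 : L * (1 + n * (8 + 4 * lg n * (3 + 2 * 1))) = L + 8 * (n * L) + 20 * (n * L * lg n) := by
    ring
  rw [h6]
  omega

/-- The bound for the expected query time, in terms of `ℓ = ⌈log₂ n⌉`, the number `L` of tables,
and the numbers `x` and `y` of points within the inner and the outer radius. -/
theorem queryBound_le {p₁ p₂ b : ℝ} (hn : 2 ≤ n) (hL : 0 < L) (hp₂ : 0 ≤ p₂) (hpb : p₂ * n ≤ b)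
    (hLp : L * p₁ ≤ 6 * lg n) (x y : ℕ) :
    ((82 * L * lg n ^ 2 + 5 * lg n * (1600 * lg n ^ 2 * (13 * L * lg n) + 1) : ℕ) : ℝ) +
        (5 * lg n * (1600 * lg n ^ 2 * 160) : ℕ) *
          (L * (x + p₁ * y + p₂ * n) / (max x 1 : ℕ)) +
        4 * ((n : ℝ) ^ 4)⁻¹ * worstCost n L ≤
      2000000 * (1 + b) * (L * (lg n : ℝ) ^ 4) +
        7680000 * ((lg n : ℝ) ^ 4 * (y / (max x 1 : ℕ))) := by
  have hlg := lg_pos hn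
  have hl1 : (1 : ℝ) ≤ lg n := by exact_mod_cast hlg
  have hL1 : (1 : ℝ) ≤ L := by exact_mod_cast hL
  have hn2 : (2 : ℝ) ≤ n := by exact_mod_cast hn
  have hb : 0 ≤ b := le_trans (by positivity) hpb
  set l : ℝ := (lg n : ℝ) with hl
  set m : ℝ := ((max x 1 : ℕ) : ℝ) with hm
  have hm1 : (1 : ℝ) ≤ m := by rw [hm]; exact_mod_cast le_max_right _ _
  have hxm : (x : ℝ) ≤ m := by rw [hm]; exact_mod_cast le_max_left _ _
  have hm0 : 0 < m := by linarith
  have hl2 : l ^ 2 ≤ l ^ 4 := pow_le_pow_right₀ hl1 (by norm_num)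
  have hl3 : l ^ 3 ≤ l ^ 4 := pow_le_pow_right₀ hl1 (by norm_num)
  have hl4 : l ≤ l ^ 4 := le_self_pow₀ hl1 (by norm_num)
  have hl0 : 0 ≤ l ^ 4 := by positivity
  have hLl : l ^ 4 ≤ L * l ^ 4 := le_mul_of_one_le_left hl0 hL1
  have h1 : ((82 * L * lg n ^ 2 + 5 * lg n * (1600 * lg n ^ 2 * (13 * L * lg n) + 1) : ℕ) : ℝ) ≤
      104087 * (L * l ^ 4) := by
    push_cast
    rw [← hl]
    have : (L : ℝ) * l ^ 2 ≤ L * l ^ 4 := by gcongr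
    nlinarith
  have h2 : L * (x + p₁ * y + p₂ * n) / m ≤ L * (1 + b) + 6 * l * (y / m) := by
    rw [div_le_iff₀ hm0]
    have e1 : (L * (1 + b) + 6 * l * (y / m)) * m = L * m + L * b * m + 6 * l * y := by
      field_simp
    rw [e1]
    have e2 : (L : ℝ) * x ≤ L * m := by gcongr
    have e3 : L * p₁ * y ≤ 6 * l * y := by gcongr
    have e4 : L * (p₂ * n) ≤ L * b * m := by
      calc L * (p₂ * n) ≤ L * b := by gcongr
        _ ≤ L * b * m := le_mul_of_one_le_right (by positivity) hm1
    linarith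
  have h3 : ((5 * lg n * (1600 * lg n ^ 2 * 160) : ℕ) : ℝ) *
      (L * (x + p₁ * y + p₂ * n) / m) ≤
      1280000 * (1 + b) * (L * l ^ 4) + 7680000 * (l ^ 4 * (y / m)) := by
    have e1 : ((5 * lg n * (1600 * lg n ^ 2 * 160) : ℕ) : ℝ) = 1280000 * l ^ 3 := by
      push_cast; ring
    rw [e1]
    calc 1280000 * l ^ 3 * (L * (x + p₁ * y + p₂ * n) / m)
        ≤ 1280000 * l ^ 3 * (L * (1 + b) + 6 * l * (y / m)) := by gcongr
      _ = 1280000 * ((1 + b) * (L * l ^ 3)) + 7680000 * (l ^ 4 * (y / m)) := by ring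
      _ ≤ 1280000 * ((1 + b) * (L * l ^ 4)) + 7680000 * (l ^ 4 * (y / m)) := by gcongr
      _ = _ := by ring
  have h4 : 4 * ((n : ℝ) ^ 4)⁻¹ * worstCost n L ≤ 576020 * (L * l ^ 4) := by
    have e1 : (worstCost n L : ℝ) ≤ 144005 * (n * (L * l ^ 4)) := by
      simp only [worstCost]
      push_cast
      rw [← hl]
      have e2 : (L : ℝ) * l ^ 4 ≤ n * (L * l ^ 4) :=
        le_mul_of_one_le_left (by positivity) (by linarith)
      have e3 : (n : ℝ) * (L * l ^ 3) ≤ n * (L * l ^ 4) := by gcongr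
      nlinarith
    have e2 : ((n : ℝ) ^ 4)⁻¹ * n ≤ 1 := by
      rw [inv_mul_le_iff₀ (by positivity), mul_one]
      exact le_self_pow₀ (by linarith) (by norm_num)
    calc 4 * ((n : ℝ) ^ 4)⁻¹ * worstCost n L
        ≤ 4 * ((n : ℝ) ^ 4)⁻¹ * (144005 * (n * (L * l ^ 4))) := by gcongr
      _ = 576020 * ((((n : ℝ) ^ 4)⁻¹ * n) * (L * l ^ 4)) := by ring
      _ ≤ 576020 * (1 * (L * l ^ 4)) := by gcongr
      _ = _ := by ring
  have h5 : 0 ≤ b * (L * l ^ 4) := by positivity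
  nlinarith

end Bounds

end NNIS

end

theorem mainTheorem1 :
    ∃ K : NNIS.Constants, ∀ a b : ℝ, 0 < a → ∃ c₁ C : ℝ, 0 < c₁ ∧ 0 < C ∧
      ∀ {X : Type*} [MetricSpace X] {U : Type*} {Ω : Type*} [MeasurableSpace Ω]
        (μ : MeasureTheory.Measure Ω) [MeasureTheory.IsProbabilityMeasure μ] (h : Ω → X → U)
        (n : ℕ) (S : Fin n ↪ X) (r c p₁ p₂ : ℝ) (law : PMF (Fin n → Fin (n ^ 3))),
        2 ≤ n → 0 < r → 1 < c → p₂ < p₁ → a / n ≤ p₂ → p₂ ≤ b / n →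
        NNIS.IsSensitive μ h r (c * r) p₁ p₂ →
        NNIS.PairwiseIndep law →
        let ρ : ℝ := Real.log p₁ / Real.log p₂
        let L := NNIS.numTables K n p₁
        let Δ := NNIS.numLists K n
        -- the data structure solves the independent sampling problem
        NNIS.Solves (NNIS.seedMeasure μ n L Δ law)
          (fun ω => NNIS.runQueries K (NNIS.buildSeed K S h ω).val r) S r (1 / n) ∧
        -- space
        (∀ ω : NNIS.Seed Ω n L Δ,
          c₁ * ((n : ℝ) ^ (1 + ρ) * Real.log n) ≤ (NNIS.buildSeed K S h ω).val.words ∧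
          ((NNIS.buildSeed K S h ω).val.words : ℝ) ≤ C * ((n : ℝ) ^ (1 + ρ) * Real.log n)) ∧
        -- construction time
        (∀ ω : NNIS.Seed Ω n L Δ,
          ((NNIS.buildSeed K S h ω).time : ℝ) ≤ C * ((n : ℝ) ^ (1 + ρ) * Real.log n ^ 2)) ∧
        -- expected query time
        ((∀ x y : X, r < dist x y → dist x y ≤ c * r → μ.real {ω | h ω x = h ω y} ≤ p₁) →
          ∀ q : X, NNIS.expectedQueryTime L Δ K μ h law S r q ≤
            ENNReal.ofReal (C * (((n : ℝ) ^ ρ +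
              (NNIS.ballCard S q (c * r) : ℝ) / max (NNIS.ballCard S q r : ℝ) 1) *
                Real.log n ^ 5))) := by
  refine ⟨NNIS.params, fun a b ha => ?_⟩
  set M : ℝ := max 1 (1 / a) with hM
  have hM1 : 1 ≤ M := le_max_left _ _
  -- for `b ≤ 0` the hypotheses on `p₂` are contradictory, and any positive constants do
  refine ⟨5 * min 1 (1 / max a b), 1998 * M + (2000000 * (1 + max a b) * (1458 * M) +
    7680000 * 162), by positivity, by positivity, ?_⟩
  intro X _ U Ω _ μ _ h n S r c p₁ p₂ law hn hr _ hlt hap hpb hμ hlaw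
  have hn' : (0 : ℝ) < n := by exact_mod_cast (by omega : 0 < n)
  have hp₂ : 0 < p₂ := (div_pos ha hn').trans_le hap
  have hp : 0 < p₁ := hp₂.trans hlt
  have hp₁ : p₁ ≤ 1 := hμ.le_one r hr (S ⟨0, by omega⟩)
  have hab : max a b = b := by
    refine max_eq_right ?_
    have := hap.trans hpb
    rwa [div_le_div_iff_of_pos_right hn'] at this
  have hb : 0 < b := by rw [← hab]; exact lt_max_of_lt_left ha
  rw [hab]
  have hL := NNIS.numTables_pos hn hp
  have hLle := NNIS.numTables_le hn ha hap hlt hp₁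
  have hLge := NNIS.le_numTables hn hp₂ hpb hlt hp₁
  have hLp := NNIS.numTables_mul_le hn hp hp₁
  intro ρ L Δ
  have hpow : (n : ℝ) ^ (1 + ρ) = n * (n : ℝ) ^ ρ := by
    rw [Real.rpow_add hn', Real.rpow_one]
  have hlog := NNIS.half_le_log hn
  have hlg := NNIS.lg_le hn
  have hW : 0 ≤ (n : ℝ) ^ ρ * Real.log n := by positivity
  have hC0 : 0 ≤ 2000000 * (1 + b) * (1458 * M) + 7680000 * 162 := by positivity
  refine ⟨NNIS.solves hn hr hp hμ hlaw, fun ω => ⟨?_, ?_⟩, fun ω => ?_, fun hmid q => ?_⟩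
  · have h1 : ((L * n : ℕ) : ℝ) ≤ (NNIS.buildSeed NNIS.params S h ω).val.words := by
      exact_mod_cast NNIS.le_buildWords NNIS.params S (fun i => h (ω.1 i)) ω.2.1 ω.2.2
    refine le_trans ?_ h1
    push_cast
    calc 5 * min 1 (1 / b) * ((n : ℝ) ^ (1 + ρ) * Real.log n)
        = 5 * min 1 (1 / b) * ((n : ℝ) ^ ρ * Real.log n) * n := by rw [hpow]; ring
      _ ≤ L * n := by gcongr
  · have h1 : ((NNIS.buildSeed NNIS.params S h ω).val.words : ℝ) ≤ (20 * (n * L) : ℕ) := by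
      exact_mod_cast NNIS.words_le hn hL rfl ω
    refine h1.trans ?_
    push_cast
    calc (20 : ℝ) * (n * L) ≤ 20 * (n * (18 * M * ((n : ℝ) ^ ρ * Real.log n))) := by gcongr
      _ = 360 * M * ((n : ℝ) ^ (1 + ρ) * Real.log n) := by rw [hpow]; ring
      _ ≤ _ := by
        gcongr
        linarith
  · have h1 : ((NNIS.buildSeed NNIS.params S h ω).time : ℝ) ≤
        (37 * (n * L * NNIS.lg n) : ℕ) := by
      exact_mod_cast NNIS.time_le hn hL rfl ω
    refine h1.trans ?_
    push_cast
    calc (37 : ℝ) * (n * L * NNIS.lg n)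
        ≤ 37 * (n * (18 * M * ((n : ℝ) ^ ρ * Real.log n)) * (3 * Real.log n)) := by gcongr
      _ = 1998 * M * ((n : ℝ) ^ (1 + ρ) * Real.log n ^ 2) := by rw [hpow]; ring
      _ ≤ _ := by
        gcongr
        linarith
  · refine (NNIS.expectedQueryTime_le hn hr hp hp₂.le hμ hlaw hmid hL).trans
      (ENNReal.ofReal_le_ofReal ?_)
    refine (NNIS.queryBound_le hn hL hp₂.le ((le_div_iff₀ hn').1 hpb) hLp _ _).trans ?_
    rw [NNIS.ballCard_eq, NNIS.ballCard_eq]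
    push_cast
    set z : ℝ := ((NNIS.near S (c * r) q).card : ℝ) / max ((NNIS.near S r q).card : ℝ) 1
    have hz : 0 ≤ z := by positivity
    have hl4 : (NNIS.lg n : ℝ) ^ 4 ≤ 81 * Real.log n ^ 4 := by
      calc (NNIS.lg n : ℝ) ^ 4 ≤ (3 * Real.log n) ^ 4 := by gcongr
        _ = _ := by ring
    have h45 : Real.log n ^ 4 ≤ 2 * Real.log n ^ 5 := by
      have : 0 ≤ Real.log n ^ 4 := by positivity
      nlinarith
    calc 2000000 * (1 + b) * (L * (NNIS.lg n : ℝ) ^ 4) +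
          7680000 * ((NNIS.lg n : ℝ) ^ 4 * z)
        ≤ 2000000 * (1 + b) * (18 * M * ((n : ℝ) ^ ρ * Real.log n) * (81 * Real.log n ^ 4)) +
          7680000 * (81 * (2 * Real.log n ^ 5) * z) := by
          gcongr
          linarith
      _ = 2000000 * (1 + b) * (1458 * M) * ((n : ℝ) ^ ρ * Real.log n ^ 5) +
          7680000 * 162 * (z * Real.log n ^ 5) := by ring
      _ ≤ (2000000 * (1 + b) * (1458 * M) + 7680000 * 162) *
          (((n : ℝ) ^ ρ + z) * Real.log n ^ 5) := by
          have e1 : 0 ≤ 2000000 * (1 + b) * (1458 * M) * (z * Real.log n ^ 5) := by positivity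
          have e2 : 0 ≤ 7680000 * 162 * ((n : ℝ) ^ ρ * Real.log n ^ 5) := by positivity
          linarith
      _ ≤ _ := by
          have e1 : 0 ≤ 1998 * M := by positivity
          exact mul_le_mul_of_nonneg_right (by linarith) (by positivity)
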